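/- **Model.** Let $M,N\ge 1$, $[m]=\{0,\dots,m-1\}$ and $\omega_N=e^{2\pi \mathbf i/N}$. A hybrid algorithm with $q$ quantum and $c$ classical queries to $D:[M]\to[N]$ has a memory $\mathcal A$ with basis states $|x,p,w\rangle$, $x\in[M]$, $p\in[N]$, $w\in[N]^s$ ($s$ arbitrary), and a history register $\mathcal H$ with $c$ cells, each holding an element of $([M]\times[N])\cup\{\star\}$. A quantum query is $O^Q_D:|x,p,w\rangle|H\rangle\mapsto\omega_N^{pD(x)}|x,p,w\rangle|H\rangle$. A classical query is $O^C_D:|x,p,w\rangle|H\rangle\mapsto\omega_N^{pD(x)}|x,p,w\rangle|H'\rangle$, where $H'$ is $H$ with its leftmost $\star$ replaced by $(x,D(x))$. Starting from $|0,0,0\rangle|\star,\dots,\star\rangle$, the algorithm applies arbitrary fixed unitaries $U_0,\dots,U_{c+q}$ on $\mathcal A$, interleaved with $c+q$ queries of which, in a fixed order, exactly $q$ are quantum; finally the workspace is measured in the computational basis and an output $x\in[M]$ is read off from the outcome. Its success probability is the probability that $F(x)=0$, for $F:[M]\to[N]$ uniformly random. **Theorem.** (1) There are absolute constants $k,K>0$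 such that, for all $M,N\ge 1$ and all $c,q\ge 0$ with $c+q\ge 1$, every hybrid algorithm with $q$ quantum and $c$ classical queries has success probability at most $K\,\frac{c+q^2}{N}$, and some such algorithm has success probability at least $k\,\frac{\min(c+q^2,\,M,\,N)}{N}$. In particular, when $c+q^2\le\min(M,N)$ the optimal success probability is $\Theta\big((c+q^2)/N\big)$. (2) Let $\mathcal D=\mathcal D_0\cdots\mathcal D_{M-1}$ be a database register whose cells $\mathcal D_x$ hold values in $[N]\cup\{\bot\}$, let history cells also hold pairs $(x,\bot)$, and put $\omega_N^{p\bot}=1$. Let $S_x$ be the unitary on $\mathcal D_x$ that exchanges $|\bot\rangle$ with $|\hat 0\rangle$ and fixes $|\hat p\rangle$ for $1\le p<N$, where $|\hat p\rangle=N^{-1/2}\sum_{y\in[N]}\omega_N^{py}|y\rangle$. Let $S$ be the operator which, on basis states $|x,p,w\rangle|H\rangle|D\rangle$, applies $S_x$ to $\mathcal D_x$ if $x$ does not occur in $H$, and the identity if it does. Put $R^Q=S^\dagger O^QS$ and $R^C=S^\dagger O^CS$, where $O^Q,O^C$ are the query operators above controlled on $D$. Let $\Pi_C$ be the projector onto the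 basis states whose history contains a pair $(x,0)$, $\Pi_{Q\bar C}$ the projector onto those for which $D(x)=0$ for some $x$ but the history contains no pair $(x,0)$, and $\Psi(\phi)=\|\Pi_C\phi\|^2+2\|\Pi_{Q\bar C}\phi\|^2$. There is an absolute constant $K>0$ such that, for all $M,N,s,c$ and every unit vector $\phi$ supported on basis states with $D(x)=y$ for each pair $(x,y)$ in $H$, $$\sqrt{\Psi(R^Q\phi)}\le\sqrt{\Psi(\phi)}+\frac{K}{\sqrt N},$$ and, if moreover every basis state in the support of $\phi$ has a free history cell $\star$, $$\Psi(R^C\phi)\le\Psi(\phi)+\frac KN .$$ -/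

import Mathlib

noncomputable section

namespace HybridOracle

/-! ## Finite-dimensional quantum states -/

/-- The Hilbert space with orthonormal basis indexed by the finite type `ι`. -/
abbrev State (ι : Type) [Fintype ι] := EuclideanSpace ℂ ι

open scoped Classical in
/-- The computational basis state `|i⟩`. -/
def ket {ι : Type} [Fintype ι] (i : ι) : State ι := EuclideanSpace.single i 1

/-- The linear operator that sends the basis state `|i⟩` to `f i`. -/
def ofKets {ι κ : Type} [Fintype ι] [Fintype κ] (f : ι → State κ) : State ι →ₗ[ℂ] State κ :=
  (EuclideanSpace.basisFun ι ℂ).toBasis.constr ℂ f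

theorem ofKets_ket {ι κ : Type} [Fintype ι] [Fintype κ] (f : ι → State κ) (i : ι) :
    ofKets f (ket i) = f i := by
  classical
  have h : ket i = (EuclideanSpace.basisFun ι ℂ).toBasis i := by
    ext j
    simp [ket]
  rw [ofKets, h, Module.Basis.constr_basis]

/-- The operator `U ⊗ 1` on a bipartite system, for `U` acting on the first part. -/
def onFirst {α β : Type} [Fintype α] [Fintype β] (U : State α ≃ₗᵢ[ℂ] State α) :
    State (α × β) →ₗ[ℂ] State (α × β) :=
  ofKets fun b => ∑ a : α, (U (ket b.1)) a • ket (a, b.2)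

open scoped Classical in
/-- The orthogonal projection onto the span of the basis states that satisfy `P`. -/
def proj {ι : Type} [Fintype ι] (P : ι → Prop) : State ι →ₗ[ℂ] State ι :=
  ofKets fun i => if P i then ket i else 0

/-! ## Registers -/

/-- Basis states `|x, p, w⟩` of the memory: an index `x ∈ [M]`, a phase `p ∈ [N]` and a
workspace `w ∈ [N]^s`. -/
abbrev Mem (M N s : ℕ) := Fin M × Fin N × (Fin s → Fin N)

/-- Contents of a history register with `c` cells. The list `[(x₁,y₁), …, (xᵢ,yᵢ)]`, with `i ≤ c`,
stands for `(x₁,y₁), …, (xᵢ,yᵢ), ⋆, …, ⋆`; the empty list is the initial content `⋆, …, ⋆`. -/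
abbrev Hist (M : ℕ) (Y : Type) (c : ℕ) := {l : List (Fin M × Y) // l.length ≤ c}

instance (M : ℕ) (Y : Type) [Finite Y] (c : ℕ) : Fintype (Hist M Y c) :=
  (List.finite_length_le (Fin M × Y) c).fintype

/-- The history with no recorded query. -/
def Hist.empty {M : ℕ} {Y : Type} {c : ℕ} : Hist M Y c := ⟨[], Nat.zero_le c⟩

/-- Write the pair `e` into the leftmost free cell. On a history without a free cell
(which never occurs when at most `c` classical queries are made) the trailing copies of `e` are
erased; this turns `record e` into a permutation, so that the classical oracle is unitary. -/
def Hist.record {M : ℕ} {Y : Type} [DecidableEq Y] {c : ℕ} (e : Fin M × Y) (H : Hist M Y c) :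
    Hist M Y c :=
  if h : H.1.length < c then ⟨H.1 ++ [e], by simpa using h⟩
  else ⟨H.1.rdropWhile (fun e' => decide (e' = e)),
    (List.rdropWhile_prefix (p := fun e' => decide (e' = e)) H.1).length_le.trans H.2⟩

/-- `ω_N ^ (p * y)` where `ω_N = exp (2 π i / N)`. -/
def phase {N : ℕ} (p y : Fin N) : ℂ :=
  Complex.exp (2 * Real.pi * Complex.I / N) ^ (p.val * y.val)

/-! ## Hybrid algorithms -/

inductive QueryKind where
  | classical
  | quantum

/-- A hybrid algorithm making `c` classical and `q` quantum queries to a function `[M] → [N]`.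
The query number `t + 1` has kind `kind t`. At the end the workspace is measured in the
computational basis, and `out` decodes from the outcome the element of `[M]` that is returned. -/
structure HybridAlg (M N c q : ℕ) where
  s : ℕ
  kind : Fin (c + q) → QueryKind
  card_quantum : Nat.card {t // kind t = QueryKind.quantum} = q
  U : Fin (c + q + 1) → (State (Mem M N s) ≃ₗᵢ[ℂ] State (Mem M N s))
  out : (Fin s → Fin N) → Fin M

section
variable {M N : ℕ}

/-- `|x,p,w⟩|H⟩ ↦ ω_N^{p D(x)} |x,p,w⟩|H⟩`. -/
def quantumOracle (s c : ℕ) (D : Fin M → Fin N) :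
    State (Mem M N s × Hist M (Fin N) c) →ₗ[ℂ] State (Mem M N s × Hist M (Fin N) c) :=
  ofKets fun ⟨(x, p, w), H⟩ => phase p (D x) • ket ((x, p, w), H)

/-- `|x,p,w⟩|H⟩ ↦ ω_N^{p D(x)} |x,p,w⟩|H, (x, D(x))⟩`. -/
def classicalOracle (s c : ℕ) (D : Fin M → Fin N) :
    State (Mem M N s × Hist M (Fin N) c) →ₗ[ℂ] State (Mem M N s × Hist M (Fin N) c) :=
  ofKets fun ⟨(x, p, w), H⟩ => phase p (D x) • ket ((x, p, w), H.record (x, D x))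

def oracle (s c : ℕ) (D : Fin M → Fin N) :
    QueryKind →
      (State (Mem M N s × Hist M (Fin N) c) →ₗ[ℂ] State (Mem M N s × Hist M (Fin N) c))
  | .classical => classicalOracle s c D
  | .quantum => quantumOracle s c D

variable [NeZero M] [NeZero N] {c q : ℕ}

/-- The state `U_t O^{λ(t)} U_{t-1} ⋯ U_1 O^{λ(1)} U_0 |0,0,0⟩|⋆,…,⋆⟩` after `t` queries. -/
def HybridAlg.stateAfter (A : HybridAlg M N c q) (D : Fin M → Fin N) :
    (t : ℕ) → t ≤ c + q → State (Mem M N A.s × Hist M (Fin N) c)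
  | 0, _ => onFirst (A.U 0) (ket ((0, 0, 0), Hist.empty))
  | t + 1, h =>
      onFirst (A.U ⟨t + 1, Nat.lt_succ_of_le h⟩)
        (oracle A.s c D (A.kind ⟨t, h⟩) (A.stateAfter D t (Nat.le_of_succ_le h)))

/-- The probability that the output `x` of `A` satisfies `D x = 0`, for a fixed oracle `D`. -/
def HybridAlg.successProbFor (A : HybridAlg M N c q) (D : Fin M → Fin N) : ℝ :=
  ‖proj (fun b : Mem M N A.s × Hist M (Fin N) c => D (A.out b.1.2.2) = 0)
    (A.stateAfter D (c + q) le_rfl)‖ ^ 2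

/-- The probability that the output `x` of `A` satisfies `F x = 0`, for a uniformly random
function `F : [M] → [N]`. -/
def HybridAlg.successProb (A : HybridAlg M N c q) : ℝ :=
  (∑ F : Fin M → Fin N, A.successProbFor F) / (N : ℝ) ^ M

end

/-! ## The hybrid compressed oracle

In databases and histories, `none` plays the role of the symbol `⊥`. -/

section
variable {M N : ℕ}

/-- Basis states of the database register. -/
abbrev Db (M N : ℕ) := Fin M → Option (Fin N)

/-- Basis states `|x,p,w⟩|H⟩|D⟩` of the memory, the history (with `c` cells) and the database. -/
abbrev Joint (M N s c : ℕ) := Mem M N s × Hist M (Option (Fin N)) c × Db M N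

/-- `phase`, extended by `ω_N^{p ⊥} = 1`. -/
def phaseBot (p : Fin N) : Option (Fin N) → ℂ
  | none => 1
  | some y => phase p y

/-- The Fourier basis state `N^{-1/2} ∑_y ω_N^{p y} |y⟩` of a single database cell. -/
def fourier (p : Fin N) : State (Option (Fin N)) :=
  ((Real.sqrt N : ℝ) : ℂ)⁻¹ • ∑ y : Fin N, phase p y • ket (some y)

variable [NeZero N]

/-- The uncompression operator of a single database cell: it exchanges `|⊥⟩` with the Fourier
state of `0` and fixes the other Fourier states (see the three lemmas below). -/
def uncompressCell : State (Option (Fin N)) →ₗ[ℂ] State (Option (Fin N)) :=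
  ofKets fun z => match z with
    | none => fourier 0
    | some y => ket (some y) + ((Real.sqrt N : ℝ) : ℂ)⁻¹ • (ket none - fourier 0)

theorem uncompressCell_none :
    uncompressCell (N := N) (ket none) = fourier 0 := by
  rw [uncompressCell, ofKets_ket]

theorem uncompressCell_fourier (p : Fin N) :
    uncompressCell (fourier p) = fourier p +
      (((N : ℂ))⁻¹ * ∑ y : Fin N, phase p y) • (ket none - fourier 0) := by
  have hN : ((Real.sqrt N : ℝ) : ℂ)⁻¹ * ((Real.sqrt N : ℝ) : ℂ)⁻¹ = (N : ℂ)⁻¹ := by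
    rw [← mul_inv, ← Complex.ofReal_mul, Real.mul_self_sqrt (Nat.cast_nonneg N)]
    simp
  have h : uncompressCell (fourier p) = ((Real.sqrt N : ℝ) : ℂ)⁻¹ • ∑ y : Fin N, phase p y •
      (ket (some y) + ((Real.sqrt N : ℝ) : ℂ)⁻¹ • (ket none - fourier 0)) := by
    conv_lhs => rw [fourier, map_smul, map_sum]
    simp only [map_smul]
    congr 1
    refine Finset.sum_congr rfl fun y _ => ?_
    rw [uncompressCell, ofKets_ket]
  rw [h]
  simp only [smul_add, Finset.sum_add_distrib]
  congr 1
  simp only [smul_smul, ← Finset.sum_smul]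
  rw [← hN, ← Finset.sum_mul]
  congr 1
  ring

theorem uncompressCell_fourier_zero :
    uncompressCell (N := N) (fourier 0) = ket none := by
  have hN : (N : ℂ) ≠ 0 := Nat.cast_ne_zero.mpr (NeZero.ne N)
  rw [uncompressCell_fourier]
  simp [phase, hN]

theorem uncompressCell_fourier_of_ne (p : Fin N) (hp : p ≠ 0) :
    uncompressCell (fourier p) = fourier p := by
  have hN : N ≠ 0 := NeZero.ne N
  have hω : IsPrimitiveRoot (Complex.exp (2 * Real.pi * Complex.I / N)) N :=
    Complex.isPrimitiveRoot_exp N hN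
  have h0 : ∑ y : Fin N, phase p y = 0 := by
    simp only [phase, pow_mul]
    rw [Fin.sum_univ_eq_sum_range
      (fun y => (Complex.exp (2 * Real.pi * Complex.I / N) ^ p.val) ^ y) N]
    have hne : Complex.exp (2 * Real.pi * Complex.I / N) ^ p.val ≠ 1 :=
      hω.pow_ne_one_of_pos_of_lt (fun h => hp (Fin.ext (by simpa using h))) p.isLt
    have hm := mul_neg_geom_sum (Complex.exp (2 * Real.pi * Complex.I / N) ^ p.val) N
    rw [← pow_mul _ p.val N, mul_comm p.val N, pow_mul, hω.pow_eq_one, one_pow, sub_self] at hm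
    exact (mul_eq_zero.mp hm).resolve_left (sub_ne_zero.mpr hne.symm)
  rw [uncompressCell_fourier, h0]
  simp

/-- The controlled uncompression `S`: on `|x,p,w⟩|H⟩|D⟩` it uncompresses the cell `D(x)` unless
`x` occurs in the history. -/
def uncompress (M N s c : ℕ) [NeZero N] : State (Joint M N s c) →ₗ[ℂ] State (Joint M N s c) :=
  ofKets fun ⟨(x, p, w), H, D⟩ =>
    if x ∈ H.1.map Prod.fst then ket ((x, p, w), H, D)
    else ∑ z : Option (Fin N),
      (uncompressCell (ket (D x))) z • ket ((x, p, w), H, Function.update D x z)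

/-- `|x,p,w⟩|H⟩|D⟩ ↦ ω_N^{p D(x)} |x,p,w⟩|H⟩|D⟩`. -/
def jointQuantumOracle (M N s c : ℕ) : State (Joint M N s c) →ₗ[ℂ] State (Joint M N s c) :=
  ofKets fun ⟨(x, p, w), H, D⟩ => phaseBot p (D x) • ket ((x, p, w), H, D)

/-- `|x,p,w⟩|H⟩|D⟩ ↦ ω_N^{p D(x)} |x,p,w⟩|H, (x, D(x))⟩|D⟩`. -/
def jointClassicalOracle (M N s c : ℕ) : State (Joint M N s c) →ₗ[ℂ] State (Joint M N s c) :=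
  ofKets fun ⟨(x, p, w), H, D⟩ => phaseBot p (D x) • ket ((x, p, w), H.record (x, D x), D)

/-- The recording quantum query operator `S† O^Q S`. -/
def recordQuantum (M N s c : ℕ) [NeZero N] : State (Joint M N s c) →ₗ[ℂ] State (Joint M N s c) :=
  (LinearMap.adjoint (uncompress M N s c)) ∘ₗ jointQuantumOracle M N s c ∘ₗ uncompress M N s c

/-- The recording classical query operator `S† O^C S`. -/
def recordClassical (M N s c : ℕ) [NeZero N] :
    State (Joint M N s c) →ₗ[ℂ] State (Joint M N s c) :=
  (LinearMap.adjoint (uncompress M N s c)) ∘ₗ jointClassicalOracle M N s c ∘ₗ uncompress M N s c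

/-- A basis state is history-database consistent if the database agrees with every pair that is
recorded in the history (in particular no two recorded pairs differ only in the second entry). -/
def Consistent {s c : ℕ} (b : Joint M N s c) : Prop :=
  ∀ e ∈ b.2.1.1, b.2.2 e.1 = e.2

/-- The history contains a zero preimage. -/
def ClassicalZero {s c : ℕ} (b : Joint M N s c) : Prop :=
  ∃ x : Fin M, (x, some 0) ∈ b.2.1.1

/-- The database contains a zero preimage. -/
def QuantumZero {s c : ℕ} (b : Joint M N s c) : Prop :=
  ∃ x : Fin M, b.2.2 x = some 0

/-- The potential `‖Π_C φ‖² + 2 ‖Π_{Q ¬C} φ‖²`. -/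
def potential {s c : ℕ} (φ : State (Joint M N s c)) : ℝ :=
  ‖proj ClassicalZero φ‖ ^ 2 + 2 * ‖proj (fun b => QuantumZero b ∧ ¬ ClassicalZero b) φ‖ ^ 2

end

end HybridOracle

end

noncomputable section

namespace HybridOracle

/-! ## Coordinates -/

section Coordinates
variable {ι κ : Type} [Fintype ι] [Fintype κ]

/-! Upper bound. The random function is replaced by a database register that starts with every cell
at ⊥, and the oracles by the recording queries. Uncompressing every cell outside the history
(`globalUncompress`) turns the recording queries into the true oracle queries and sends the all-⊥
database to the uniform superposition over functions. Hence the amplitude of the compressed run at a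
total function F is N^(-M/2) times the amplitude of the real run on F
(`HybridAlg.globalUncompress_compressedState`), and success probabilities can be read off the
compressed state.

All estimates reduce to one database cell. The uncompression matrix `cellMat` is real symmetric and
squares to 1; its row at 0 differs from the identity by a vector of squared norm 2/N. The potential
is a diagonal form with weight 1 on histories with a zero and weight 2 on zeros that are only in the
database. If the history or another cell holds a zero, a query cannot raise the weight, so only a
zero in the queried cell matters. A quantum query moves the amplitude there by O(1/√N), so the
square root of the potential, a seminorm, grows by O(1/√N) (`sqrt_potential_recordQuantum_le`). A
classical query uncompresses the cell for good: the amplitude at 0 becomes a + b with |b|² = O(1/N),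
and |a + b|² ≤ 2|a|² + 2|b|². The factor 2 is paid for by the drop of the weight from 2 to 1, so the
potential itself grows by O(1/N) (`potential_recordClassical_le`). The two kinds of growth combine
in any order to √Ψ ≤ √(4c/N) + 3q/√N. The final measurement costs another 4/N by the same cell
estimate (`sum_norm_sq_globalUncompress_zero_le`), which is absorbed since c + q ≥ 1.

Lower bound. It suffices to search m ≤ min(M, (N+1)/2) inputs and to count only functions with a
unique zero among them. Each position is the unique zero with probability at least 1/(2N), and these
events are disjoint, so success p on them gives at least pm/(2N) (`HybridAlg.le_successProb`). If c
≥ q², the classical queries check min(m, c) inputs. Otherwise k Grover iterations, two queries each,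
reach probability at least (2k+1)²/(4m). Both algorithms keep the phase register in the Fourier
basis, where a query adds F(x) to it, and make classical queries only with a definite index, so that
the history never entangles with the memory. -/

open scoped Classical in
theorem ket_apply (i j : ι) : (ket i : State ι) j = if j = i then 1 else 0 := by
  simp [ket, eq_comm]

theorem sum_smul_ket (φ : State ι) : ∑ i, φ i • ket i = φ := by
  classical
  ext j
  simp [ket_apply]

theorem ofKets_eq_sum (f : ι → State κ) (φ : State ι) : ofKets f φ = ∑ i, φ i • f i := by
  conv_lhs => rw [← sum_smul_ket φ]
  simp [ofKets_ket]

theorem ofKets_apply (f : ι → State κ) (φ : State ι) (k : κ) :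
    ofKets f φ k = ∑ i, φ i * f i k := by
  simp [ofKets_eq_sum]

open scoped Classical in
theorem proj_apply (P : ι → Prop) (φ : State ι) (i : ι) :
    proj P φ i = if P i then φ i else 0 := by
  rw [proj, ofKets_apply, Finset.sum_eq_single i]
  · split_ifs <;> simp [ket_apply]
  · intro j _ hj
    split_ifs <;> simp [ket_apply, hj.symm]
  · simp

open scoped Classical in
theorem norm_sq_proj (P : ι → Prop) (φ : State ι) :
    ‖proj P φ‖ ^ 2 = ∑ i, if P i then ‖φ i‖ ^ 2 else 0 := by
  rw [EuclideanSpace.norm_sq_eq]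
  refine Finset.sum_congr rfl fun i _ => ?_
  rw [proj_apply]
  split_ifs <;> simp

theorem norm_ket (i : ι) : ‖(ket i : State ι)‖ = 1 := by
  simp [ket]

theorem inner_ket_left (i : ι) (φ : State ι) : inner ℂ (ket i) φ = φ i := by
  classical
  simp [ket, EuclideanSpace.inner_single_left]

theorem adjoint_apply (A : State ι →ₗ[ℂ] State κ) (φ : State κ) (i : ι) :
    LinearMap.adjoint A φ i = ∑ k, star (A (ket i) k) * φ k := by
  rw [← inner_ket_left, LinearMap.adjoint_inner_right, PiLp.inner_apply]
  simp [mul_comm]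

section Reindex
variable {σ : ι → κ} {c : ι → ℂ} {T : Set ι} {φ : State ι}

/-- All oracles send basis states to phased basis states. Injectivity is asked only on a set `T`
containing the support, because the recording map is used only on histories with a free cell. -/
theorem ofKets_reindex_apply (hσ : Set.InjOn σ T) (hφ : ∀ i, φ i ≠ 0 → i ∈ T) {i : ι}
    (hi : i ∈ T) : ofKets (fun i => c i • ket (σ i)) φ (σ i) = c i * φ i := by
  classical
  rw [ofKets_apply, Finset.sum_eq_single i]
  · simp [ket_apply, mul_comm]
  · intro j _ hj
    by_cases h : φ j = 0
    · simp [h]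
    · have : σ i ≠ σ j := fun e => hj (hσ (hφ j h) hi e.symm)
      simp [ket_apply, this]
  · simp

theorem ofKets_reindex_eq_zero (hφ : ∀ i, φ i ≠ 0 → i ∈ T) {k : κ}
    (hk : ∀ i ∈ T, σ i ≠ k) : ofKets (fun i => c i • ket (σ i)) φ k = 0 := by
  classical
  rw [ofKets_apply]
  refine Finset.sum_eq_zero fun i _ => ?_
  by_cases h : φ i = 0
  · simp [h]
  · simp [ket_apply, (hk i (hφ i h)).symm]

/-- The weight `W` is arbitrary so that `W = 1` gives norm preservation and the weight of the
potential gives its change under a classical query. -/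
theorem sum_mul_norm_sq_ofKets_reindex (hσ : Set.InjOn σ T) (hφ : ∀ i, φ i ≠ 0 → i ∈ T)
    (hc : ∀ i, ‖c i‖ = 1) (W : κ → ℝ) :
    ∑ k, W k * ‖ofKets (fun i => c i • ket (σ i)) φ k‖ ^ 2 = ∑ i, W (σ i) * ‖φ i‖ ^ 2 := by
  classical
  have h1 : ∑ i, W (σ i) * ‖φ i‖ ^ 2 = ∑ i ∈ Finset.univ.filter (· ∈ T), W (σ i) * ‖φ i‖ ^ 2 := by
    refine (Finset.sum_filter_of_ne fun i _ h => hφ i fun h0 => h ?_).symm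
    simp [h0]
  rw [h1]
  symm
  refine Finset.sum_of_injOn σ (by simpa using hσ) (by simp) ?_ ?_
  · intro k _ hk
    rw [ofKets_reindex_eq_zero hφ]
    · simp
    · intro i hi e
      exact hk ⟨i, by simpa using hi, e⟩
  · intro i hi
    rw [ofKets_reindex_apply hσ hφ (by simpa using hi)]
    simp [hc]

end Reindex

theorem onFirst_apply (U : State ι ≃ₗᵢ[ℂ] State ι) (φ : State (ι × κ)) (a : ι) (b : κ) :
    onFirst U φ (a, b) = U (WithLp.toLp 2 fun a' => φ (a', b)) a := by
  classical
  have h : (WithLp.toLp 2 fun a' => φ (a', b) : State ι) = ∑ a', φ (a', b) • ket a' :=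
    (sum_smul_ket (WithLp.toLp 2 fun a' => φ (a', b) : State ι)).symm
  rw [h, onFirst, ofKets_apply, Fintype.sum_prod_type]
  simp only [map_sum, map_smul, WithLp.ofLp_sum, Finset.sum_apply, WithLp.ofLp_smul,
    Pi.smul_apply, smul_eq_mul, ket_apply, Prod.mk.injEq]
  refine Finset.sum_congr rfl fun a' _ => ?_
  rw [Finset.sum_eq_single b]
  · simp
  · intro b' _ hb
    simp [hb.symm]
  · simp

/-- The unitary acts within each fibre over the second factor, where `W` is constant. This is why
the unitaries of the algorithm leave the potential unchanged. -/
theorem sum_mul_norm_sq_onFirst (U : State ι ≃ₗᵢ[ℂ] State ι) (φ : State (ι × κ)) (W : κ → ℝ) :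
    ∑ j, W j.2 * ‖onFirst U φ j‖ ^ 2 = ∑ j, W j.2 * ‖φ j‖ ^ 2 := by
  rw [Fintype.sum_prod_type_right, Fintype.sum_prod_type_right]
  refine Finset.sum_congr rfl fun b _ => ?_
  simp only [← Finset.mul_sum, onFirst_apply]
  rw [← EuclideanSpace.norm_sq_eq, LinearIsometryEquiv.norm_map, EuclideanSpace.norm_sq_eq]

theorem norm_onFirst (U : State ι ≃ₗᵢ[ℂ] State ι) (φ : State (ι × κ)) :
    ‖onFirst U φ‖ = ‖φ‖ := by
  rw [← sq_eq_sq₀ (norm_nonneg _) (norm_nonneg _), EuclideanSpace.norm_sq_eq,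
    EuclideanSpace.norm_sq_eq]
  simpa using sum_mul_norm_sq_onFirst U φ fun _ => 1

theorem exists_ne_zero_of_onFirst_apply_ne_zero {U : State ι ≃ₗᵢ[ℂ] State ι}
    {φ : State (ι × κ)} {a : ι} {b : κ} (h : onFirst U φ (a, b) ≠ 0) : ∃ a', φ (a', b) ≠ 0 := by
  by_contra! h0
  apply h
  rw [onFirst_apply]
  simp only [h0]
  have : (WithLp.toLp 2 fun _ : ι => (0 : ℂ)) = 0 := rfl
  simp [this]

end Coordinates

/-! ## Tensor products of cell operators -/

section PiKron
open Matrix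
variable {ι κ : Type} [Fintype ι]

/-- The tensor product of the operators `k y` on the cells `y`. -/
def piKron (k : ι → Matrix κ κ ℂ) : Matrix (ι → κ) (ι → κ) ℂ :=
  Matrix.of fun D D' => ∏ y, k y (D y) (D' y)

theorem piKron_mul [DecidableEq ι] [Fintype κ] (k l : ι → Matrix κ κ ℂ) :
    piKron k * piKron l = piKron (k * l) := by
  ext D D'
  simp only [Matrix.mul_apply, piKron, Matrix.of_apply, Pi.mul_apply, ← Finset.prod_mul_distrib]
  rw [Finset.prod_univ_sum]
  simp

theorem piKron_update_one_mulVec [DecidableEq ι] [Fintype κ] [DecidableEq κ] (x : ι)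
    (a : Matrix κ κ ℂ) (g : (ι → κ) → ℂ) (D : ι → κ) :
    (piKron (Function.update 1 x a) *ᵥ g) D = ∑ z, a (D x) z * g (Function.update D x z) := by
  rw [Matrix.mulVec, dotProduct]
  symm
  refine Fintype.sum_of_injective (fun z => Function.update D x z)
    (Function.update_injective D x) _ _ ?_ ?_
  · intro D' hD'
    obtain ⟨y, hy, hne⟩ : ∃ y, y ≠ x ∧ D y ≠ D' y := by
      by_contra! h
      refine hD' ⟨D' x, funext fun y => ?_⟩
      by_cases hy : y = x
      · subst hy; simp
      · simp [hy, h y hy]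
    rw [piKron, Matrix.of_apply, Finset.prod_eq_zero (Finset.mem_univ y), zero_mul]
    simp [hy, Matrix.one_apply_ne hne]
  · intro z
    congr 1
    rw [piKron, Matrix.of_apply, ← Finset.mul_prod_erase _ _ (Finset.mem_univ x)]
    rw [Finset.prod_eq_one]
    · simp
    · intro y hy
      simp [Finset.ne_of_mem_erase hy]

theorem piKron_one [DecidableEq κ] : piKron (1 : ι → Matrix κ κ ℂ) = 1 := by
  ext D D'
  by_cases h : D = D'
  · subst h; simp [piKron]
  · obtain ⟨y, hy⟩ := Function.ne_iff.mp h
    rw [Matrix.one_apply_ne h, piKron, Matrix.of_apply, Finset.prod_eq_zero (Finset.mem_univ y)]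
    simp [Matrix.one_apply_ne hy]

theorem piKron_conjTranspose (k : ι → Matrix κ κ ℂ) :
    (piKron k)ᴴ = piKron fun y => (k y)ᴴ := by
  ext D D'
  simp [piKron, Matrix.conjTranspose_apply]

theorem sum_norm_sq_mulVec [Fintype κ] [DecidableEq κ] {a : Matrix κ κ ℂ} (ha : aᴴ * a = 1)
    (v : κ → ℂ) :
    ∑ z, ‖(a *ᵥ v) z‖ ^ 2 = ∑ z, ‖v z‖ ^ 2 := by
  have key : ∀ w : κ → ℂ, ((∑ z, ‖w z‖ ^ 2 : ℝ) : ℂ) = star w ⬝ᵥ w := by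
    intro w
    simp [dotProduct, ← Complex.conj_mul']
  apply Complex.ofReal_injective
  rw [key, key, Matrix.star_mulVec, ← Matrix.dotProduct_mulVec, Matrix.mulVec_mulVec, ha,
    Matrix.one_mulVec]

/-- It suffices to compare sums over the cell `x` when the other cells are fixed. -/
theorem sum_le_sum_of_forall_cell [DecidableEq ι] [Fintype κ] [Nonempty κ] (x : ι)
    (a b : (ι → κ) → ℝ)
    (h : ∀ D, ∑ z, a (Function.update D x z) ≤ ∑ z, b (Function.update D x z)) :
    ∑ D, a D ≤ ∑ D, b D := by
  have key : ∀ f : (ι → κ) → ℝ,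
      ∑ D, ∑ z, f (Function.update D x z) = Fintype.card κ * ∑ D, f D := by
    intro f
    -- Swapping the content of cell `x` with `z` is an involution, so the double sum counts every
    -- `D` exactly `card κ` times.
    let e : (ι → κ) × κ ≃ (ι → κ) × κ :=
      { toFun := fun p => (Function.update p.1 x p.2, p.1 x)
        invFun := fun p => (Function.update p.1 x p.2, p.1 x)
        left_inv := fun p => by simp
        right_inv := fun p => by simp }
    have h1 := Equiv.sum_comp e fun p => f p.1
    rw [Fintype.sum_prod_type, Fintype.sum_prod_type] at h1
    simpa [e, Finset.mul_sum] using h1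
  have h2 := Finset.sum_le_sum fun D (_ : D ∈ Finset.univ) => h D
  rw [key, key] at h2
  exact le_of_mul_le_mul_left h2 (by exact_mod_cast Fintype.card_pos)

end PiKron

/-! ## The uncompression operator of a cell as a matrix -/

section Cell
open Matrix
variable {N : ℕ}

theorem norm_phase (p y : Fin N) : ‖phase p y‖ = 1 := by
  have h : 2 * (Real.pi : ℂ) * Complex.I / N = ((2 * Real.pi / N : ℝ) : ℂ) * Complex.I := by
    push_cast; ring
  rw [phase, norm_pow, h, Complex.norm_exp_ofReal_mul_I, one_pow]

theorem phase_zero_right [NeZero N] (p : Fin N) : phase p 0 = 1 := by simp [phase]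

theorem phase_zero_left [NeZero N] (y : Fin N) : phase 0 y = 1 := by simp [phase]

theorem norm_phaseBot (p : Fin N) (z : Option (Fin N)) : ‖phaseBot p z‖ = 1 := by
  cases z <;> simp [phaseBot, norm_phase]

theorem diagonal_phaseBot_conjTranspose_mul_self (p : Fin N) :
    (diagonal (phaseBot p))ᴴ * diagonal (phaseBot p) = 1 := by
  rw [Matrix.diagonal_conjTranspose, Matrix.diagonal_mul_diagonal, ← Matrix.diagonal_one]
  congr 1
  ext z
  simp [Complex.conj_mul', norm_phaseBot]

theorem inv_sqrt_mul_self (N : ℕ) :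
    ((Real.sqrt N : ℝ) : ℂ)⁻¹ * ((Real.sqrt N : ℝ) : ℂ)⁻¹ = (N : ℂ)⁻¹ := by
  rw [← mul_inv, ← Complex.ofReal_mul, Real.mul_self_sqrt (Nat.cast_nonneg N)]
  simp

variable [NeZero N]

/-- The matrix of `uncompressCell`. -/
def cellMat (N : ℕ) [NeZero N] : Matrix (Option (Fin N)) (Option (Fin N)) ℂ :=
  Matrix.of fun z z' => uncompressCell (ket z') z

theorem fourier_zero_none : (fourier (0 : Fin N)) none = 0 := by
  simp [fourier, ket_apply]

theorem fourier_zero_some (y : Fin N) :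
    (fourier (0 : Fin N)) (some y) = ((Real.sqrt N : ℝ) : ℂ)⁻¹ := by
  simp [fourier, ket_apply, phase_zero_left]

theorem cellMat_none_none : cellMat N none none = 0 := by
  simp [cellMat, uncompressCell_none, fourier_zero_none]

theorem cellMat_some_none (y : Fin N) :
    cellMat N (some y) none = ((Real.sqrt N : ℝ) : ℂ)⁻¹ := by
  simp [cellMat, uncompressCell_none, fourier_zero_some]

theorem cellMat_none_some (y : Fin N) :
    cellMat N none (some y) = ((Real.sqrt N : ℝ) : ℂ)⁻¹ := by
  simp [cellMat, uncompressCell, ofKets_ket, ket_apply, fourier_zero_none]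

theorem cellMat_some_some (y y' : Fin N) :
    cellMat N (some y) (some y') = (if y = y' then 1 else 0) - (N : ℂ)⁻¹ := by
  rw [← inv_sqrt_mul_self]
  simp [cellMat, uncompressCell, ofKets_ket, ket_apply, fourier_zero_some, sub_eq_add_neg]

theorem cellMat_conjTranspose : (cellMat N)ᴴ = cellMat N := by
  ext z z'
  rcases z with _ | y <;> rcases z' with _ | y' <;>
    simp [Matrix.conjTranspose_apply, cellMat_none_none, cellMat_some_none, cellMat_none_some,
      cellMat_some_some, eq_comm, apply_ite]

theorem uncompressCell_uncompressCell_ket (z : Option (Fin N)) :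
    uncompressCell (uncompressCell (ket z)) = ket z := by
  rcases z with _ | y
  · rw [uncompressCell_none, uncompressCell_fourier_zero]
  · have h : uncompressCell (ket (some y)) =
        ket (some y) + ((Real.sqrt N : ℝ) : ℂ)⁻¹ • (ket none - fourier 0) := by
      rw [uncompressCell, ofKets_ket]
    rw [h, map_add, map_smul, map_sub, h, uncompressCell_none, uncompressCell_fourier_zero]
    module

theorem cellMat_mul_self : cellMat N * cellMat N = 1 := by
  classical
  ext z z'
  have h := congrArg (fun v : State (Option (Fin N)) => v z) (uncompressCell_uncompressCell_ket z')
  simp only at h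
  conv_lhs at h => rw [← sum_smul_ket (uncompressCell (ket z'))]
  rw [map_sum] at h
  simp only [map_smul, WithLp.ofLp_sum, Finset.sum_apply, WithLp.ofLp_smul, Pi.smul_apply,
    smul_eq_mul, ket_apply] at h
  rw [Matrix.mul_apply, Matrix.one_apply]
  simp only [cellMat, Matrix.of_apply, mul_comm (uncompressCell _ z)]
  rw [h]
  congr

theorem cellMat_conjTranspose_mul_self : (cellMat N)ᴴ * cellMat N = 1 := by
  rw [cellMat_conjTranspose, cellMat_mul_self]

/-- The recording quantum query on a cell that is not in the history. -/
def recordCell (p : Fin N) : Matrix (Option (Fin N)) (Option (Fin N)) ℂ :=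
  cellMat N * diagonal (phaseBot p) * cellMat N

theorem recordCell_conjTranspose_mul_self (p : Fin N) :
    (recordCell p)ᴴ * recordCell p = 1 := by
  rw [recordCell, conjTranspose_mul, conjTranspose_mul]
  calc _ = (cellMat N)ᴴ * ((diagonal (phaseBot p))ᴴ * (((cellMat N)ᴴ * cellMat N) *
        diagonal (phaseBot p))) * cellMat N := by simp only [Matrix.mul_assoc]
    _ = 1 := by
        rw [cellMat_conjTranspose_mul_self, Matrix.one_mul,
          diagonal_phaseBot_conjTranspose_mul_self, Matrix.mul_one,
          cellMat_conjTranspose_mul_self]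

theorem norm_sq_sum_mul_le {κ : Type} [Fintype κ] (f g : κ → ℂ) :
    ‖∑ z, f z * g z‖ ^ 2 ≤ (∑ z, ‖f z‖ ^ 2) * ∑ z, ‖g z‖ ^ 2 := by
  have h1 : ‖∑ z, f z * g z‖ ≤ ∑ z, ‖f z‖ * ‖g z‖ :=
    (norm_sum_le _ _).trans (by simp)
  calc _ ≤ (∑ z, ‖f z‖ * ‖g z‖) ^ 2 := by gcongr
    _ ≤ _ := Finset.sum_mul_sq_le_sq_mul_sq _ _ _

/-- Writing 1 = C·C, the difference is row 0 of C(Φ − 1) applied to the unit-norm-preserving image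
Cv. The phase is 1 at ⊥ and at 0, so only the N − 1 entries −1/N survive, each multiplied by at most
2. Row 0 thus has squared norm at most N · 4/N². -/
theorem norm_sq_recordCell_mulVec_sub_le (p : Fin N) (v : Option (Fin N) → ℂ) :
    ‖(recordCell p *ᵥ v) (some 0) - v (some 0)‖ ^ 2 ≤ 4 / N * ∑ z, ‖v z‖ ^ 2 := by
  have hN : (0 : ℝ) < N := Nat.cast_pos.mpr (NeZero.pos N)
  have h1 : (recordCell p *ᵥ v) (some 0) - v (some 0) =
      ∑ z, cellMat N (some 0) z * (phaseBot p z - 1) * (cellMat N *ᵥ v) z := by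
    have h2 : v (some 0) = ∑ z, cellMat N (some 0) z * (cellMat N *ᵥ v) z := by
      have : v = cellMat N *ᵥ (cellMat N *ᵥ v) := by
        rw [Matrix.mulVec_mulVec, cellMat_mul_self, Matrix.one_mulVec]
      conv_lhs => rw [this]
      rfl
    rw [h2, recordCell, Matrix.mul_assoc, ← Matrix.mulVec_mulVec, ← Matrix.mulVec_mulVec]
    rw [Matrix.mulVec, dotProduct, ← Finset.sum_sub_distrib]
    refine Finset.sum_congr rfl fun z _ => ?_
    rw [Matrix.mulVec_diagonal]
    ring
  rw [h1]
  refine (norm_sq_sum_mul_le _ _).trans ?_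
  rw [sum_norm_sq_mulVec cellMat_conjTranspose_mul_self]
  refine mul_le_mul_of_nonneg_right ?_ (Finset.sum_nonneg fun _ _ => by positivity)
  rw [Fintype.sum_option]
  have h3 : ∀ y : Fin N, ‖cellMat N (some 0) (some y) * (phaseBot p (some y) - 1)‖ ^ 2 ≤
      4 / (N : ℝ) ^ 2 := by
    intro y
    by_cases hy : y = 0
    · subst hy
      simp only [phaseBot, phase_zero_right, sub_self, mul_zero, norm_zero]
      rw [zero_pow two_ne_zero]
      positivity
    · have h4 : ‖phaseBot p (some y) - 1‖ ≤ 2 := by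
        refine (norm_sub_le _ _).trans ?_
        rw [norm_phaseBot, norm_one]; norm_num
      have h5 : ‖cellMat N (some 0) (some y)‖ = (N : ℝ)⁻¹ := by
        rw [cellMat_some_some]
        simp [Ne.symm hy]
      rw [norm_mul, h5, mul_pow]
      calc _ ≤ ((N : ℝ)⁻¹) ^ 2 * 2 ^ 2 := by gcongr
        _ = _ := by field_simp; norm_num
  calc _ ≤ (0 : ℝ) + ∑ _y : Fin N, 4 / (N : ℝ) ^ 2 := by
        refine add_le_add (by simp [phaseBot]) (Finset.sum_le_sum fun y _ => h3 y)
    _ = 4 / N := by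
        simp only [Finset.sum_const, Finset.card_univ, Fintype.card_fin, nsmul_eq_mul]
        field_simp
        ring

/-- Row 0 of C minus the identity has entry 1/√N at ⊥ and −1/N at every value, hence squared norm
2/N. The factor 2 in front of the old amplitude is the one that the weights of the potential are
designed to absorb. -/
theorem norm_sq_cellMat_mulVec_le (v : Option (Fin N) → ℂ) :
    ‖(cellMat N *ᵥ v) (some 0)‖ ^ 2 ≤ 2 * ‖v (some 0)‖ ^ 2 + 4 / N * ∑ z, ‖v z‖ ^ 2 := by
  have hN : (0 : ℝ) < N := Nat.cast_pos.mpr (NeZero.pos N)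
  set f : Option (Fin N) → ℂ := fun z => cellMat N (some 0) z - if z = some 0 then 1 else 0
    with hf
  have h1 : (cellMat N *ᵥ v) (some 0) = v (some 0) + ∑ z, f z * v z := by
    simp [hf, sub_mul, Finset.sum_sub_distrib, Matrix.mulVec, dotProduct]
  have h2 : ∑ z, ‖f z‖ ^ 2 = 2 / N := by
    have h3 : ∀ y : Fin N, f (some y) = -(N : ℂ)⁻¹ := by
      intro y
      by_cases hy : y = 0 <;> simp [hf, cellMat_some_some, hy, Ne.symm]
    rw [Fintype.sum_option]
    simp only [h3]
    simp only [hf, cellMat_some_none]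
    simp [inv_pow, Real.sq_sqrt]
    field_simp
    norm_num
  rw [h1]
  have h4 := norm_sq_sum_mul_le f v
  rw [h2] at h4
  have h5 := norm_add_le (v (some 0)) (∑ z, f z * v z)
  have h6 : ‖v (some 0) + ∑ z, f z * v z‖ ^ 2 ≤ (‖v (some 0)‖ + ‖∑ z, f z * v z‖) ^ 2 := by
    gcongr
  have h7 : 4 / (N : ℝ) * ∑ z, ‖v z‖ ^ 2 = 2 * (2 / N * ∑ z, ‖v z‖ ^ 2) := by ring
  rw [h7]
  nlinarith [sq_nonneg (‖v (some 0)‖ - ‖∑ z, f z * v z‖)]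

end Cell

/-! ## Coordinates of the joint operators -/

section Joint
open Matrix
variable {M N s c : ℕ}

theorem jointQuantumOracle_apply (φ : State (Joint M N s c)) (m : Mem M N s)
    (H : Hist M (Option (Fin N)) c) (D : Db M N) :
    jointQuantumOracle M N s c φ (m, H, D) = phaseBot m.2.1 (D m.1) * φ (m, H, D) :=
  ofKets_reindex_apply (σ := id) (T := Set.univ)
    (c := fun b : Joint M N s c => phaseBot b.1.2.1 (b.2.2 b.1.1))
    Function.injective_id.injOn (fun _ _ => trivial) trivial

theorem piKron_update_conjTranspose (x : Fin M)
    (a : Matrix (Option (Fin N)) (Option (Fin N)) ℂ) :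
    (piKron (Function.update 1 x a))ᴴ = piKron (Function.update (1 : Fin M → _) x aᴴ) := by
  rw [piKron_conjTranspose]
  congr 1
  ext1 y
  by_cases hy : y = x
  · subst hy; simp
  · simp [hy]

theorem piKron_update_one_mul (x : Fin M) (a b : Matrix (Option (Fin N)) (Option (Fin N)) ℂ) :
    piKron (Function.update 1 x a) * piKron (Function.update 1 x b) =
      piKron (Function.update (1 : Fin M → _) x (a * b)) := by
  rw [piKron_mul]
  congr 1
  ext1 y
  by_cases hy : y = x
  · subst hy; simp
  · simp [hy]

variable [NeZero N]

/-- The cell operator that uncompression applies to the cell `x` when the history is `H`. -/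
def gate (H : Hist M (Option (Fin N)) c) (x : Fin M) :
    Matrix (Option (Fin N)) (Option (Fin N)) ℂ :=
  if x ∈ H.1.map Prod.fst then 1 else cellMat N

theorem gate_mul_self (H : Hist M (Option (Fin N)) c) (x : Fin M) : gate H x * gate H x = 1 := by
  rw [gate]
  split_ifs
  · simp
  · exact cellMat_mul_self

theorem gate_conjTranspose (H : Hist M (Option (Fin N)) c) (x : Fin M) :
    (gate H x)ᴴ = gate H x := by
  rw [gate]
  split_ifs
  · simp
  · exact cellMat_conjTranspose

/-- Uncompression is block diagonal in memory and history, and inside a block it is a tensor product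
of cell operators. All later computations are products of such tensors. -/
theorem uncompress_ket_apply (m m' : Mem M N s) (H H' : Hist M (Option (Fin N)) c)
    (D D' : Db M N) : uncompress M N s c (ket (m', H', D')) (m, H, D) =
      if m' = m ∧ H' = H then piKron (Function.update 1 m'.1 (gate H' m'.1)) D D' else 0 := by
  classical
  have key : ∀ a : Matrix (Option (Fin N)) (Option (Fin N)) ℂ,
      piKron (Function.update 1 m'.1 a) D D' =
        ∑ z, a (D m'.1) z * if Function.update D m'.1 z = D' then 1 else 0 := by
    intro a
    have := piKron_update_one_mulVec m'.1 a (fun E => if E = D' then 1 else 0) D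
    rw [← this]
    simp [Matrix.mulVec, dotProduct]
  obtain ⟨x, p, w⟩ := m'
  rw [uncompress, ofKets_ket]
  by_cases hx : x ∈ H'.1.map Prod.fst
  · have h1 : gate H' x = 1 := by rw [gate, if_pos hx]
    have h2 : Function.update (1 : Fin M → Matrix (Option (Fin N)) (Option (Fin N)) ℂ) x 1 = 1 :=
      Function.update_eq_self x 1
    simp only [hx, if_true, h1, h2, piKron_one, ket_apply, Matrix.one_apply, Prod.mk.injEq]
    by_cases hm : (x, p, w) = m <;> by_cases hH : H' = H <;> by_cases hD : D = D' <;>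
      simp [hm, hH, hD, eq_comm] <;> aesop
  · have h1 : gate H' x = cellMat N := by rw [gate, if_neg hx]
    simp only [hx, if_false, h1]
    have h3 : (∑ z : Option (Fin N), (uncompressCell (ket (D' x))) z •
        (ket ((x, p, w), H', Function.update D' x z) : State (Joint M N s c))) (m, H, D) =
        ∑ z, (uncompressCell (ket (D' x))) z *
          if m = (x, p, w) ∧ H = H' ∧ D = Function.update D' x z then 1 else 0 := by
      simp [ket_apply]
    rw [h3]
    by_cases hmH : (x, p, w) = m ∧ H' = H
    · rw [if_pos hmH, key]
      obtain ⟨rfl, rfl⟩ := hmH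
      simp only [true_and]
      by_cases hD : ∃ z, D = Function.update D' x z
      · obtain ⟨z, rfl⟩ := hD
        rw [Finset.sum_eq_single z, Finset.sum_eq_single (D' x)]
        · simp [cellMat]
        · intro z' _ hz'
          rw [if_neg, mul_zero]
          intro h
          apply hz'
          simpa using congrFun h x
        · simp
        · intro z' _ hz'
          rw [if_neg, mul_zero]
          intro h
          apply hz'
          simpa using (congrFun h x).symm
        · simp
      · rw [Finset.sum_eq_zero, Finset.sum_eq_zero]
        · intro z _
          rw [if_neg, mul_zero]
          rintro rfl
          exact hD ⟨D x, by simp⟩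
        · intro z _
          rw [if_neg, mul_zero]
          exact fun h => hD ⟨z, h⟩
    · rw [if_neg hmH]
      refine Finset.sum_eq_zero fun z _ => ?_
      rw [if_neg, mul_zero]
      rintro ⟨rfl, rfl, -⟩
      exact hmH ⟨rfl, rfl⟩

theorem uncompress_apply (φ : State (Joint M N s c)) (m : Mem M N s)
    (H : Hist M (Option (Fin N)) c) (D : Db M N) : uncompress M N s c φ (m, H, D) =
      (piKron (Function.update 1 m.1 (gate H m.1)) *ᵥ fun D => φ (m, H, D)) D := by
  classical
  conv_lhs => rw [← sum_smul_ket φ]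
  simp only [map_sum, map_smul, WithLp.ofLp_sum, Finset.sum_apply, WithLp.ofLp_smul,
    Pi.smul_apply, smul_eq_mul]
  rw [Fintype.sum_prod_type, Finset.sum_eq_single m, Fintype.sum_prod_type,
    Finset.sum_eq_single H]
  · simp [uncompress_ket_apply, Matrix.mulVec, dotProduct, mul_comm]
  · intro H' _ h
    simp [uncompress_ket_apply, h]
  · simp
  · intro m' _ h
    refine Finset.sum_eq_zero fun e _ => ?_
    obtain ⟨H', D'⟩ := e
    simp [uncompress_ket_apply, h]
  · simp

theorem adjoint_uncompress_apply (φ : State (Joint M N s c)) (m : Mem M N s)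
    (H : Hist M (Option (Fin N)) c) (D : Db M N) :
    LinearMap.adjoint (uncompress M N s c) φ (m, H, D) =
      (piKron (Function.update 1 m.1 (gate H m.1)) *ᵥ fun D => φ (m, H, D)) D := by
  rw [adjoint_apply, Fintype.sum_prod_type, Finset.sum_eq_single m, Fintype.sum_prod_type,
    Finset.sum_eq_single H]
  · simp only [uncompress_ket_apply, and_self, if_true, Matrix.mulVec, dotProduct]
    refine Finset.sum_congr rfl fun D' _ => ?_
    rw [← Matrix.conjTranspose_apply, piKron_update_conjTranspose, gate_conjTranspose]
  · intro H' _ h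
    simp [uncompress_ket_apply, h.symm]
  · simp
  · intro m' _ h
    refine Finset.sum_eq_zero fun e _ => ?_
    obtain ⟨H', D'⟩ := e
    simp [uncompress_ket_apply, h.symm]
  · simp

theorem recordQuantum_apply (φ : State (Joint M N s c)) (m : Mem M N s)
    (H : Hist M (Option (Fin N)) c) (D : Db M N) : recordQuantum M N s c φ (m, H, D) =
      (piKron (Function.update 1 m.1 (gate H m.1 * diagonal (phaseBot m.2.1) * gate H m.1)) *ᵥ
        fun D => φ (m, H, D)) D := by
  have h : (fun D => jointQuantumOracle M N s c (uncompress M N s c φ) (m, H, D)) =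
      piKron (Function.update 1 m.1 (diagonal (phaseBot m.2.1))) *ᵥ
        (piKron (Function.update 1 m.1 (gate H m.1)) *ᵥ fun D => φ (m, H, D)) := by
    ext D
    rw [piKron_update_one_mulVec, jointQuantumOracle_apply, uncompress_apply]
    simp [Matrix.diagonal_apply]
  rw [recordQuantum, LinearMap.comp_apply, LinearMap.comp_apply, adjoint_uncompress_apply, h]
  rw [Matrix.mulVec_mulVec, Matrix.mulVec_mulVec, piKron_update_one_mul, piKron_update_one_mul,
    Matrix.mul_assoc]

theorem recordQuantum_apply_of_mem (φ : State (Joint M N s c)) {m : Mem M N s}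
    {H : Hist M (Option (Fin N)) c} (h : m.1 ∈ H.1.map Prod.fst) (D : Db M N) :
    recordQuantum M N s c φ (m, H, D) = phaseBot m.2.1 (D m.1) * φ (m, H, D) := by
  rw [recordQuantum_apply, piKron_update_one_mulVec, gate, if_pos h]
  simp only [Matrix.one_mul, Matrix.mul_one, Matrix.diagonal_apply, ite_mul, zero_mul,
    Finset.sum_ite_eq, Finset.mem_univ, if_true, Function.update_eq_self]

theorem recordQuantum_update_of_not_mem (φ : State (Joint M N s c)) {m : Mem M N s}
    {H : Hist M (Option (Fin N)) c} (h : m.1 ∉ H.1.map Prod.fst) (D : Db M N)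
    (z : Option (Fin N)) : recordQuantum M N s c φ (m, H, Function.update D m.1 z) =
      (recordCell m.2.1 *ᵥ fun z => φ (m, H, Function.update D m.1 z)) z := by
  rw [recordQuantum_apply, piKron_update_one_mulVec, gate, if_neg h]
  simp [Matrix.mulVec, dotProduct, recordCell]

theorem uncompress_apply_of_mem (φ : State (Joint M N s c)) {m : Mem M N s}
    {H : Hist M (Option (Fin N)) c} (h : m.1 ∈ H.1.map Prod.fst) (D : Db M N) :
    uncompress M N s c φ (m, H, D) = φ (m, H, D) := by
  rw [uncompress_apply, piKron_update_one_mulVec, gate, if_pos h]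
  simp [Matrix.one_apply]

theorem uncompress_update_of_not_mem (φ : State (Joint M N s c)) {m : Mem M N s}
    {H : Hist M (Option (Fin N)) c} (h : m.1 ∉ H.1.map Prod.fst) (D : Db M N)
    (z : Option (Fin N)) : uncompress M N s c φ (m, H, Function.update D m.1 z) =
      (cellMat N *ᵥ fun z => φ (m, H, Function.update D m.1 z)) z := by
  rw [uncompress_apply, piKron_update_one_mulVec, gate, if_neg h]
  simp [Matrix.mulVec, dotProduct]

/-- Comparison of two weighted sums over the joint basis, one query cell at a time. -/
theorem sum_joint_le (a b : Joint M N s c → ℝ)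
    (h : ∀ (m : Mem M N s) (H : Hist M (Option (Fin N)) c) (D : Db M N),
      ∑ z, a (m, H, Function.update D m.1 z) ≤ ∑ z, b (m, H, Function.update D m.1 z)) :
    ∑ j, a j ≤ ∑ j, b j := by
  simp only [Fintype.sum_prod_type (f := a), Fintype.sum_prod_type (f := b)]
  refine Finset.sum_le_sum fun m _ => ?_
  rw [Fintype.sum_prod_type, Fintype.sum_prod_type]
  exact Finset.sum_le_sum fun H _ => sum_le_sum_of_forall_cell m.1 _ _ fun D => h m H D

end Joint

/-! ## Norms and supports -/

section Support
open Matrix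
variable {M N s c : ℕ}

theorem piKron_update_conjTranspose_mul_self (x : Fin M)
    {a : Matrix (Option (Fin N)) (Option (Fin N)) ℂ} (ha : aᴴ * a = 1) :
    (piKron (Function.update 1 x a))ᴴ * piKron (Function.update (1 : Fin M → _) x a) = 1 := by
  rw [piKron_update_conjTranspose, piKron_update_one_mul, ha]
  have : Function.update (1 : Fin M → Matrix (Option (Fin N)) (Option (Fin N)) ℂ) x 1 = 1 :=
    Function.update_eq_self x 1
  rw [this, piKron_one]

/-- A query touches only the queried cell, and not even that one when its index is recorded; no
recorded pair can then be contradicted. -/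
theorem Consistent.of_update {m : Mem M N s} {H : Hist M (Option (Fin N)) c} {D : Db M N}
    {z : Option (Fin N)} (hz : m.1 ∈ H.1.map Prod.fst → z = D m.1)
    (h : Consistent ((m, H, Function.update D m.1 z) : Joint M N s c)) :
    Consistent ((m, H, D) : Joint M N s c) := by
  intro e he
  have h1 := h e he
  by_cases hx : e.1 = m.1
  · have : z = D m.1 := hz (hx ▸ List.mem_map_of_mem he)
    subst this
    simpa using h1
  · simpa [hx] using h1

theorem norm_eq_of_slices {φ ψ : State (Joint M N s c)}
    (h : ∀ (m : Mem M N s) (H : Hist M (Option (Fin N)) c),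
      ∑ D : Db M N, ‖ψ (m, H, D)‖ ^ 2 = ∑ D : Db M N, ‖φ (m, H, D)‖ ^ 2) : ‖ψ‖ = ‖φ‖ := by
  rw [← sq_eq_sq₀ (norm_nonneg _) (norm_nonneg _), EuclideanSpace.norm_sq_eq,
    EuclideanSpace.norm_sq_eq]
  refine (Fintype.sum_prod_type _).trans
    ((Finset.sum_congr rfl fun m _ => ?_).trans (Fintype.sum_prod_type _).symm)
  rw [Fintype.sum_prod_type, Fintype.sum_prod_type]
  exact Finset.sum_congr rfl fun H _ => h m H

variable [NeZero N]

theorem gate_conjTranspose_mul_self (H : Hist M (Option (Fin N)) c) (x : Fin M) :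
    (gate H x)ᴴ * gate H x = 1 := by
  rw [gate_conjTranspose, gate_mul_self]

theorem norm_uncompress (φ : State (Joint M N s c)) : ‖uncompress M N s c φ‖ = ‖φ‖ := by
  refine norm_eq_of_slices fun m H => ?_
  simp only [uncompress_apply]
  exact sum_norm_sq_mulVec (piKron_update_conjTranspose_mul_self _
    (gate_conjTranspose_mul_self H m.1)) _

theorem norm_recordQuantum (φ : State (Joint M N s c)) : ‖recordQuantum M N s c φ‖ = ‖φ‖ := by
  refine norm_eq_of_slices fun m H => ?_
  simp only [recordQuantum_apply]
  refine sum_norm_sq_mulVec (piKron_update_conjTranspose_mul_self _ ?_) _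
  rw [gate]
  split_ifs
  · simpa using diagonal_phaseBot_conjTranspose_mul_self m.2.1
  · exact recordCell_conjTranspose_mul_self _

theorem exists_of_uncompress_ne_zero {φ : State (Joint M N s c)} {m : Mem M N s}
    {H : Hist M (Option (Fin N)) c} {D : Db M N} (h : uncompress M N s c φ (m, H, D) ≠ 0) :
    ∃ z, φ (m, H, Function.update D m.1 z) ≠ 0 ∧ (m.1 ∈ H.1.map Prod.fst → z = D m.1) := by
  by_cases hx : m.1 ∈ H.1.map Prod.fst
  · rw [uncompress_apply_of_mem _ hx] at h
    exact ⟨D m.1, by simpa using h, fun _ => rfl⟩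
  · rw [uncompress_apply, piKron_update_one_mulVec] at h
    obtain ⟨z, -, hz⟩ := Finset.exists_ne_zero_of_sum_ne_zero h
    exact ⟨z, right_ne_zero_of_mul hz, fun h => absurd h hx⟩

theorem exists_of_recordQuantum_ne_zero {φ : State (Joint M N s c)} {m : Mem M N s}
    {H : Hist M (Option (Fin N)) c} {D : Db M N} (h : recordQuantum M N s c φ (m, H, D) ≠ 0) :
    ∃ z, φ (m, H, Function.update D m.1 z) ≠ 0 ∧ (m.1 ∈ H.1.map Prod.fst → z = D m.1) := by
  by_cases hx : m.1 ∈ H.1.map Prod.fst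
  · rw [recordQuantum_apply_of_mem _ hx] at h
    exact ⟨D m.1, by simpa using right_ne_zero_of_mul h, fun _ => rfl⟩
  · rw [recordQuantum_apply, piKron_update_one_mulVec] at h
    obtain ⟨z, -, hz⟩ := Finset.exists_ne_zero_of_sum_ne_zero h
    exact ⟨z, right_ne_zero_of_mul hz, fun h => absurd h hx⟩

theorem consistent_of_recordQuantum_ne_zero {φ : State (Joint M N s c)}
    (hφ : ∀ b, φ b ≠ 0 → Consistent b) (b : Joint M N s c)
    (h : recordQuantum M N s c φ b ≠ 0) : Consistent b := by
  obtain ⟨m, H, D⟩ := b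
  obtain ⟨z, h1, h2⟩ := exists_of_recordQuantum_ne_zero h
  exact (hφ _ h1).of_update h2

end Support

/-! ## The potential -/

section Potential
open Matrix
variable {M N s c : ℕ} [NeZero N]

open scoped Classical in
/-- The weight of a basis state in the potential. -/
def weight (b : Joint M N s c) : ℝ :=
  if ClassicalZero b then 1 else if QuantumZero b then 2 else 0

theorem weight_nonneg (b : Joint M N s c) : 0 ≤ weight b := by
  rw [weight]; split_ifs <;> norm_num

theorem weight_le_two (b : Joint M N s c) : weight b ≤ 2 := by
  rw [weight]; split_ifs <;> norm_num

/-- Both projections are diagonal and their ranges are orthogonal. As a weighted ℓ² norm, the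
potential obeys the triangle inequality after taking roots and can be compared slice by slice. -/
theorem potential_eq_sum (φ : State (Joint M N s c)) :
    potential φ = ∑ b, weight b * ‖φ b‖ ^ 2 := by
  rw [potential, norm_sq_proj, norm_sq_proj, Finset.mul_sum, ← Finset.sum_add_distrib]
  refine Finset.sum_congr rfl fun b _ => ?_
  by_cases h1 : ClassicalZero b <;> by_cases h2 : QuantumZero b <;> simp [weight, h1, h2]

theorem weight_of_classicalZero {b : Joint M N s c} (h : ClassicalZero b) : weight b = 1 := by
  rw [weight, if_pos h]

theorem weight_of_quantumZero {b : Joint M N s c} (h : ¬ ClassicalZero b) (h' : QuantumZero b) :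
    weight b = 2 := by
  rw [weight, if_neg h, if_pos h']

theorem weight_eq_zero {b : Joint M N s c} (h : ¬ ClassicalZero b) (h' : ¬ QuantumZero b) :
    weight b = 0 := by
  rw [weight, if_neg h, if_neg h']

theorem quantumZero_update_iff {m : Mem M N s} {H : Hist M (Option (Fin N)) c} {D : Db M N}
    {z : Option (Fin N)} {x : Fin M} :
    QuantumZero ((m, H, Function.update D x z) : Joint M N s c) ↔
      z = some 0 ∨ ∃ y, y ≠ x ∧ D y = some 0 := by
  constructor
  · rintro ⟨y, hy⟩
    by_cases hyx : y = x
    · subst hyx; left; simpa using hy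
    · right; exact ⟨y, hyx, by simpa [hyx] using hy⟩
  · rintro (rfl | ⟨y, hyx, hy⟩)
    · exact ⟨x, by simp⟩
    · exact ⟨y, by simpa [hyx] using hy⟩

theorem norm_add_le_of_sq {ι : Type} [Fintype ι] {V X Y : ι → ℂ} {A B : ℝ}
    (hV : ∀ i, V i = X i + Y i) (hX : ∑ i, ‖X i‖ ^ 2 ≤ A) (hY : ∑ i, ‖Y i‖ ^ 2 ≤ B) :
    Real.sqrt (∑ i, ‖V i‖ ^ 2) ≤ Real.sqrt A + Real.sqrt B := by
  have h : WithLp.toLp 2 V = (WithLp.toLp 2 X + WithLp.toLp 2 Y : State ι) := by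
    ext i; simp [hV]
  have h2 := norm_add_le (WithLp.toLp 2 X : State ι) (WithLp.toLp 2 Y)
  rw [← h, EuclideanSpace.norm_eq, EuclideanSpace.norm_eq, EuclideanSpace.norm_eq] at h2
  exact h2.trans (add_le_add (Real.sqrt_le_sqrt hX) (Real.sqrt_le_sqrt hY))

/-- The query cell holds the only zero, and it is not in the history. -/
def QueryZero (b : Joint M N s c) : Prop :=
  (b.1.1 ∉ b.2.1.1.map Prod.fst ∧ ¬ ClassicalZero b ∧ ∀ y, y ≠ b.1.1 → b.2.2 y ≠ some 0) ∧
    b.2.2 b.1.1 = some 0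

theorem QueryZero.weight {b : Joint M N s c} (h : QueryZero b) : weight b = 2 :=
  weight_of_quantumZero h.1.2.1 ⟨_, h.2⟩

theorem sum_norm_sq_recordCell (p : Fin N) (v : Option (Fin N) → ℂ) :
    ∑ z, ‖(recordCell p *ᵥ v) z‖ ^ 2 = ∑ z, ‖v z‖ ^ 2 :=
  sum_norm_sq_mulVec (recordCell_conjTranspose_mul_self p) v

-- Replacing the new amplitude by the old one on `QueryZero` states leaves no growth. On a slice
-- over the queried cell the weight is constant, and the query unitary, when the history or another
-- cell holds a zero. Otherwise the only weighted entry is the one that was replaced. A recorded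
-- index only produces phases.
open scoped Classical in
theorem sum_recordQuantum_le (φ : State (Joint M N s c)) :
    ∑ b, (if QueryZero b then 2 * ‖φ b‖ ^ 2
      else weight b * ‖recordQuantum M N s c φ b‖ ^ 2) ≤ potential φ := by
  rw [potential_eq_sum]
  refine sum_joint_le _ _ fun m H D => ?_
  by_cases hx : m.1 ∈ H.1.map Prod.fst
  · refine Finset.sum_le_sum fun z _ => ?_
    rw [if_neg (fun h => h.1.1 hx), recordQuantum_apply_of_mem _ hx, norm_mul, norm_phaseBot,
      one_mul]
  simp only [recordQuantum_update_of_not_mem _ hx]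
  set v : Option (Fin N) → ℂ := fun z => φ (m, H, Function.update D m.1 z)
  by_cases hC : ClassicalZero ((m, H, D) : Joint M N s c)
  · have hC' : ∀ z, ClassicalZero ((m, H, Function.update D m.1 z) : Joint M N s c) := fun _ => hC
    have hS : ∀ z, ¬ QueryZero ((m, H, Function.update D m.1 z) : Joint M N s c) :=
      fun z h => h.1.2.1 (hC' z)
    simp only [hS, if_false, weight_of_classicalZero (hC' _), one_mul]
    exact (sum_norm_sq_recordCell _ _).le
  have hC' : ∀ z, ¬ ClassicalZero ((m, H, Function.update D m.1 z) : Joint M N s c) := fun _ => hC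
  by_cases hO : ∃ y, y ≠ m.1 ∧ D y = some 0
  · have hQ : ∀ z, QuantumZero ((m, H, Function.update D m.1 z) : Joint M N s c) :=
      fun z => quantumZero_update_iff.mpr (Or.inr hO)
    have hS : ∀ z, ¬ QueryZero ((m, H, Function.update D m.1 z) : Joint M N s c) := by
      obtain ⟨y, hy, hy'⟩ := hO
      exact fun z h => h.1.2.2 y hy (by simpa [hy] using hy')
    simp only [hS, if_false, weight_of_quantumZero (hC' _) (hQ _), ← Finset.mul_sum]
    exact mul_le_mul_of_nonneg_left (sum_norm_sq_recordCell _ _).le zero_le_two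
  · refine Finset.sum_le_sum fun z _ => ?_
    by_cases hz : z = some 0
    · have hS : QueryZero ((m, H, Function.update D m.1 z) : Joint M N s c) := by
        refine ⟨⟨hx, hC' z, fun y hy h => hO ⟨y, hy, ?_⟩⟩, by simpa using hz⟩
        simpa [show y ≠ m.1 from hy] using h
      rw [if_pos hS, hS.weight]
    · have hQ : ¬ QuantumZero ((m, H, Function.update D m.1 z) : Joint M N s c) := by
        rw [quantumZero_update_iff]; exact not_or.mpr ⟨hz, hO⟩
      have hS : ¬ QueryZero ((m, H, Function.update D m.1 z) : Joint M N s c) :=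
        fun h => hz (by simpa using h.2)
      rw [if_neg hS, weight_eq_zero (hC' z) hQ]
      simp

-- At most one entry per slice contributes; the constant is the weight 2 times the cell bound 4/N.
open scoped Classical in
theorem sum_recordQuantum_sub_le (φ : State (Joint M N s c)) :
    ∑ b, (if QueryZero b then 2 * ‖recordQuantum M N s c φ b - φ b‖ ^ 2 else 0) ≤
      8 / N * ‖φ‖ ^ 2 := by
  rw [EuclideanSpace.norm_sq_eq, Finset.mul_sum]
  refine sum_joint_le _ _ fun m H D => ?_
  have h0 : 0 ≤ ∑ z, 8 / (N : ℝ) * ‖φ (m, H, Function.update D m.1 z)‖ ^ 2 :=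
    Finset.sum_nonneg fun _ _ => by positivity
  rw [Finset.sum_eq_single (some 0)]
  · split_ifs with hS
    · rw [recordQuantum_update_of_not_mem _ hS.1.1]
      have h := norm_sq_recordCell_mulVec_sub_le m.2.1
        fun z => φ (m, H, Function.update D m.1 z)
      rw [← Finset.mul_sum]
      calc _ ≤ 2 * (4 / (N : ℝ) * ∑ z, ‖φ (m, H, Function.update D m.1 z)‖ ^ 2) := by gcongr
        _ = _ := by ring
    · exact h0
  · intro z _ hz
    rw [if_neg]
    exact fun h => hz (by simpa using h.2)
  · simp

/-- Triangle inequality for the √weight-scaled amplitudes: the hybrid of old and new amplitudes,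
bounded by the old potential, plus the change on `QueryZero` states. -/
theorem sqrt_potential_recordQuantum_le (φ : State (Joint M N s c)) :
    Real.sqrt (potential (recordQuantum M N s c φ)) ≤
      Real.sqrt (potential φ) + Real.sqrt (8 / N * ‖φ‖ ^ 2) := by
  classical
  have h2 : ∀ w : ℝ, 0 ≤ w → ∀ z : ℂ, ‖(Real.sqrt w : ℂ) * z‖ ^ 2 = w * ‖z‖ ^ 2 := by
    intro w hw z
    rw [norm_mul, mul_pow, Complex.norm_real, Real.norm_eq_abs, sq_abs, Real.sq_sqrt hw]
  have key := norm_add_le_of_sq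
    (V := fun b => (Real.sqrt (weight b) : ℂ) * recordQuantum M N s c φ b)
    (X := fun b => if QueryZero b then (Real.sqrt 2 : ℂ) * φ b
      else (Real.sqrt (weight b) : ℂ) * recordQuantum M N s c φ b)
    (Y := fun b => if QueryZero b then (Real.sqrt 2 : ℂ) * (recordQuantum M N s c φ b - φ b)
      else 0) (A := potential φ) (B := 8 / N * ‖φ‖ ^ 2) ?_ ?_ ?_
  · simpa only [h2 _ (weight_nonneg _), ← potential_eq_sum] using key
  · intro b
    by_cases h : QueryZero b
    · simp only [if_pos h, h.weight]; ring
    · simp only [if_neg h]; ring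
  · refine le_trans (le_of_eq (Finset.sum_congr rfl fun b _ => ?_)) (sum_recordQuantum_le φ)
    split_ifs
    · exact h2 _ zero_le_two _
    · exact h2 _ (weight_nonneg _) _
  · refine le_trans (le_of_eq (Finset.sum_congr rfl fun b _ => ?_)) (sum_recordQuantum_sub_le φ)
    split_ifs
    · exact h2 _ zero_le_two _
    · simp

end Potential

/-! ## The recording classical query -/

section RecordClassical
open Matrix

theorem Hist.record_val {M c : ℕ} {Y : Type} [DecidableEq Y] (e : Fin M × Y) {H : Hist M Y c}
    (h : H.1.length < c) : (H.record e).1 = H.1 ++ [e] := by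
  rw [Hist.record, dif_pos h]

theorem Hist.record_inj {M c : ℕ} {Y : Type} [DecidableEq Y] {e e' : Fin M × Y} {H H' : Hist M Y c}
    (h : H.1.length < c) (h' : H'.1.length < c) (heq : H.record e = H'.record e') :
    H = H' ∧ e = e' := by
  have h1 := congrArg Subtype.val heq
  rw [Hist.record_val e h, Hist.record_val e' h'] at h1
  obtain ⟨h2, h3⟩ := List.append_inj' h1 rfl
  exact ⟨Subtype.ext h2, by simpa using h3⟩

variable {M N s c : ℕ}

/-- The basis state after a classical query. -/
def recordBasis (b : Joint M N s c) : Joint M N s c :=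
  (b.1, b.2.1.record (b.1.1, b.2.2 b.1.1), b.2.2)

theorem injOn_recordBasis :
    Set.InjOn (recordBasis : Joint M N s c → _) {b | b.2.1.1.length < c} := by
  rintro ⟨m, H, D⟩ h ⟨m', H', D'⟩ h' heq
  simp only [recordBasis, Prod.mk.injEq] at heq
  obtain ⟨rfl, h1, rfl⟩ := heq
  obtain rfl := (Hist.record_inj h h' h1).1
  rfl

theorem jointClassicalOracle_eq : jointClassicalOracle M N s c =
    ofKets fun b => phaseBot b.1.2.1 (b.2.2 b.1.1) • ket (recordBasis b) := rfl

theorem consistent_recordBasis {b : Joint M N s c} (h : b.2.1.1.length < c)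
    (hb : Consistent b) : Consistent (recordBasis b) := by
  intro e he
  simp only [recordBasis, Hist.record_val _ h, List.mem_append, List.mem_singleton] at he
  rcases he with he | rfl
  · exact hb e he
  · rfl

variable [NeZero N]

theorem length_lt_of_uncompress_ne_zero {φ : State (Joint M N s c)} {n : ℕ}
    (hφ : ∀ b, φ b ≠ 0 → b.2.1.1.length < n) (b : Joint M N s c)
    (h : uncompress M N s c φ b ≠ 0) : b.2.1.1.length < n := by
  obtain ⟨m, H, D⟩ := b
  obtain ⟨z, h1, -⟩ := exists_of_uncompress_ne_zero h
  have h2 := hφ _ h1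
  exact h2

/-- When a history cell is free, the query cell is not compressed again after the query. -/
theorem recordClassical_eq {φ : State (Joint M N s c)}
    (hφ : ∀ b, φ b ≠ 0 → b.2.1.1.length < c) :
    recordClassical M N s c φ = jointClassicalOracle M N s c (uncompress M N s c φ) := by
  have hψ := length_lt_of_uncompress_ne_zero hφ
  set ψ := uncompress M N s c φ with hψdef
  have h0 : ∀ m H D, m.1 ∉ H.1.map Prod.fst →
      jointClassicalOracle M N s c ψ (m, H, D) = 0 := by
    intro m H D hx
    rw [jointClassicalOracle_eq]
    refine ofKets_reindex_eq_zero hψ fun b hb heq => hx ?_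
    simp only [recordBasis, Prod.mk.injEq] at heq
    obtain ⟨h1, h2, h3⟩ := heq
    rw [← h1, ← h2, Hist.record_val _ hb]
    simp
  rw [recordClassical, LinearMap.comp_apply, LinearMap.comp_apply, ← hψdef]
  ext ⟨m, H, D⟩
  rw [adjoint_uncompress_apply, piKron_update_one_mulVec]
  by_cases hx : m.1 ∈ H.1.map Prod.fst
  · rw [gate, if_pos hx]
    simp [Matrix.one_apply]
  · simp [h0 m H _ hx]

/-- The adjoint uncompression is idle here, so a classical query is an uncompression followed by a
phased injection of basis states; the weights can be pulled back along it. -/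
theorem sum_mul_norm_sq_recordClassical {φ : State (Joint M N s c)}
    (hφ : ∀ b, φ b ≠ 0 → b.2.1.1.length < c) (W : Joint M N s c → ℝ) :
    ∑ b, W b * ‖recordClassical M N s c φ b‖ ^ 2 =
      ∑ b, W (recordBasis b) * ‖uncompress M N s c φ b‖ ^ 2 := by
  rw [recordClassical_eq hφ, jointClassicalOracle_eq]
  exact sum_mul_norm_sq_ofKets_reindex injOn_recordBasis (length_lt_of_uncompress_ne_zero hφ)
    (fun _ => norm_phaseBot _ _) W

theorem norm_recordClassical {φ : State (Joint M N s c)}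
    (hφ : ∀ b, φ b ≠ 0 → b.2.1.1.length < c) : ‖recordClassical M N s c φ‖ = ‖φ‖ := by
  have h := sum_mul_norm_sq_recordClassical hφ fun _ => 1
  simp only [one_mul] at h
  rw [← EuclideanSpace.norm_sq_eq, ← EuclideanSpace.norm_sq_eq, norm_uncompress] at h
  exact (sq_eq_sq₀ (norm_nonneg _) (norm_nonneg _)).mp h

theorem exists_of_recordClassical_ne_zero {φ : State (Joint M N s c)}
    (hφ : ∀ b, φ b ≠ 0 → b.2.1.1.length < c) {b : Joint M N s c}
    (h : recordClassical M N s c φ b ≠ 0) :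
    ∃ b', b'.2.1.1.length < c ∧ uncompress M N s c φ b' ≠ 0 ∧ recordBasis b' = b := by
  by_contra! h0
  apply h
  rw [recordClassical_eq hφ, jointClassicalOracle_eq]
  refine ofKets_reindex_eq_zero (T := {b' | b'.2.1.1.length < c ∧ uncompress M N s c φ b' ≠ 0})
    (fun b' hb' => ⟨length_lt_of_uncompress_ne_zero hφ b' hb', hb'⟩)
    fun b' hb' => h0 b' hb'.1 hb'.2

theorem consistent_of_recordClassical_ne_zero {φ : State (Joint M N s c)}
    (hφ : ∀ b, φ b ≠ 0 → Consistent b) (hlen : ∀ b, φ b ≠ 0 → b.2.1.1.length < c)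
    (b : Joint M N s c) (h : recordClassical M N s c φ b ≠ 0) : Consistent b := by
  obtain ⟨⟨m, H, D⟩, hb, h1, rfl⟩ := exists_of_recordClassical_ne_zero hlen h
  obtain ⟨z, h2, h3⟩ := exists_of_uncompress_ne_zero h1
  exact consistent_recordBasis hb ((hφ _ h2).of_update h3)

theorem classicalZero_recordBasis_iff {b : Joint M N s c} (hb : b.2.1.1.length < c) :
    ClassicalZero (recordBasis b) ↔ ClassicalZero b ∨ b.2.2 b.1.1 = some 0 := by
  simp only [ClassicalZero, recordBasis, Hist.record_val _ hb, List.mem_append,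
    List.mem_singleton, Prod.mk.injEq]
  constructor
  · rintro ⟨x, h | ⟨-, h⟩⟩
    · exact Or.inl ⟨x, h⟩
    · exact Or.inr h.symm
  · rintro (⟨x, h⟩ | h)
    · exact ⟨x, Or.inl h⟩
    · exact ⟨_, Or.inr ⟨rfl, h.symm⟩⟩

/-- The only delicate slices have an unrecorded index and no other zero. There the database zero, of
weight 2, becomes a history zero, of weight 1, and this drop pays for the factor 2 of
`norm_sq_cellMat_mulVec_le`. -/
theorem potential_recordClassical_le {φ : State (Joint M N s c)}
    (hφ : ∀ b, φ b ≠ 0 → Consistent b) (hlen : ∀ b, φ b ≠ 0 → b.2.1.1.length < c) :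
    potential (recordClassical M N s c φ) ≤ potential φ + 4 / N * ‖φ‖ ^ 2 := by
  rw [potential_eq_sum, sum_mul_norm_sq_recordClassical hlen, potential_eq_sum,
    EuclideanSpace.norm_sq_eq, Finset.mul_sum, ← Finset.sum_add_distrib]
  refine sum_joint_le _ _ fun m H D => ?_
  have hpos : ∀ b : Joint M N s c, 0 ≤ 4 / (N : ℝ) * ‖φ b‖ ^ 2 := fun b => by positivity
  have hpos' : ∀ b : Joint M N s c, 0 ≤ weight b * ‖φ b‖ ^ 2 :=
    fun b => mul_nonneg (weight_nonneg b) (by positivity)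
  by_cases hc : H.1.length < c
  swap
  · refine Finset.sum_le_sum fun z _ => ?_
    have h0 : uncompress M N s c φ (m, H, Function.update D m.1 z) = 0 := by
      by_contra h
      exact hc (length_lt_of_uncompress_ne_zero hlen _ h)
    rw [h0]
    simpa using add_nonneg (hpos' (m, H, Function.update D m.1 z)) (hpos _)
  by_cases hx : m.1 ∈ H.1.map Prod.fst
  · refine Finset.sum_le_sum fun z _ => ?_
    rw [uncompress_apply_of_mem _ hx]
    set b : Joint M N s c := (m, H, Function.update D m.1 z) with hb
    by_cases h0 : φ b = 0
    · simp [h0]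
    -- By consistency, a repeated query records a pair that is already in the history.
    have hw : weight (recordBasis b) = weight b := by
      have h1 : ClassicalZero (recordBasis b) ↔ ClassicalZero b := by
        rw [classicalZero_recordBasis_iff hc, or_iff_left_iff_imp]
        intro hz
        obtain ⟨e, he, hex⟩ := List.mem_map.mp hx
        refine ⟨m.1, ?_⟩
        have h2 : b.2.2 e.1 = e.2 := hφ b h0 e he
        rw [hex] at h2
        have h3 : e = (m.1, some 0) := Prod.ext hex (h2.symm.trans hz)
        exact h3 ▸ he
      have h2 : QuantumZero (recordBasis b) ↔ QuantumZero b := Iff.rfl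
      classical
      rw [weight, weight]
      exact if_congr h1 rfl (if_congr h2 rfl rfl)
    rw [hw]
    linarith [hpos b]
  simp only [uncompress_update_of_not_mem _ hx]
  rw [Finset.sum_add_distrib]
  set v : Option (Fin N) → ℂ := fun z => φ (m, H, Function.update D m.1 z) with hv
  have hnorm : ∑ z, ‖(cellMat N *ᵥ v) z‖ ^ 2 = ∑ z, ‖v z‖ ^ 2 :=
    sum_norm_sq_mulVec cellMat_conjTranspose_mul_self v
  have hrest : 0 ≤ ∑ z, 4 / (N : ℝ) * ‖v z‖ ^ 2 := Finset.sum_nonneg fun _ _ => by positivity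
  by_cases hC : ClassicalZero ((m, H, D) : Joint M N s c)
  · have hC' : ∀ z, ClassicalZero ((m, H, Function.update D m.1 z) : Joint M N s c) := fun _ => hC
    have hC2 : ∀ z, ClassicalZero
        (recordBasis ((m, H, Function.update D m.1 z) : Joint M N s c)) :=
      fun z => (classicalZero_recordBasis_iff hc).mpr (Or.inl (hC' z))
    simp only [weight_of_classicalZero (hC' _), weight_of_classicalZero (hC2 _), one_mul, hnorm]
    linarith
  have hC' : ∀ z, ¬ ClassicalZero ((m, H, Function.update D m.1 z) : Joint M N s c) := fun _ => hC
  -- With a zero in another cell the whole slice has the maximal weight 2 beforehand, so unitarity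
  -- of the cell operator suffices.
  by_cases hO : ∃ y, y ≠ m.1 ∧ D y = some 0
  · have hQ : ∀ z, QuantumZero ((m, H, Function.update D m.1 z) : Joint M N s c) :=
      fun z => quantumZero_update_iff.mpr (Or.inr hO)
    simp only [weight_of_quantumZero (hC' _) (hQ _)]
    calc _ ≤ ∑ z, 2 * ‖(cellMat N *ᵥ v) z‖ ^ 2 := by
          refine Finset.sum_le_sum fun z _ => ?_
          exact mul_le_mul_of_nonneg_right (weight_le_two _) (by positivity)
      _ = ∑ z, 2 * ‖v z‖ ^ 2 := by rw [← Finset.mul_sum, hnorm, Finset.mul_sum]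
      _ ≤ _ := by linarith
  · have hw : ∀ z, z ≠ some 0 →
        weight (recordBasis ((m, H, Function.update D m.1 z) : Joint M N s c)) = 0 := by
      intro z hz
      refine weight_eq_zero ?_ ?_
      · rw [classicalZero_recordBasis_iff hc]
        simpa [hz] using hC' z
      · change ¬ QuantumZero ((m, H, Function.update D m.1 z) : Joint M N s c)
        rw [quantumZero_update_iff]; exact not_or.mpr ⟨hz, hO⟩
    have hw0 : weight (recordBasis
        ((m, H, Function.update D m.1 (some 0)) : Joint M N s c)) = 1 :=
      weight_of_classicalZero ((classicalZero_recordBasis_iff hc).mpr (Or.inr (by simp)))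
    have hw1 : weight ((m, H, Function.update D m.1 (some 0)) : Joint M N s c) = 2 :=
      weight_of_quantumZero (hC' _) (quantumZero_update_iff.mpr (Or.inl rfl))
    rw [Finset.sum_eq_single (some 0) (fun z _ hz => by rw [hw z hz, zero_mul]) (by simp), hw0,
      one_mul]
    refine (norm_sq_cellMat_mulVec_le v).trans ?_
    rw [Finset.mul_sum]
    gcongr
    have h := Finset.single_le_sum (f := fun z =>
      weight ((m, H, Function.update D m.1 z) : Joint M N s c) * ‖v z‖ ^ 2)
      (fun z _ => mul_nonneg (weight_nonneg _) (by positivity)) (Finset.mem_univ (some 0))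
    simpa only [hw1] using h

end RecordClassical

/-! ## Uncompressing the whole database -/

section GlobalUncompress
open Matrix
variable {M N s c : ℕ}

theorem piKron_update_diagonal_mulVec (x : Fin M) (d : Option (Fin N) → ℂ) (g : Db M N → ℂ)
    (D : Db M N) : (piKron (Function.update 1 x (diagonal d)) *ᵥ g) D = d (D x) * g D := by
  rw [piKron_update_one_mulVec]
  simp only [Matrix.diagonal_apply, ite_mul, zero_mul, Finset.sum_ite_eq, Finset.mem_univ,
    if_true, Function.update_eq_self]

variable [NeZero N]

/-- The amplitudes after uncompressing every cell that is not in the history. -/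
def globalUncompress (φ : State (Joint M N s c)) (m : Mem M N s)
    (H : Hist M (Option (Fin N)) c) (D : Db M N) : ℂ :=
  (piKron (gate H) *ᵥ fun D => φ (m, H, D)) D

theorem globalUncompress_eq_zero {φ : State (Joint M N s c)} {m : Mem M N s}
    {H : Hist M (Option (Fin N)) c} (h : ∀ D, φ (m, H, D) = 0) (D : Db M N) :
    globalUncompress φ m H D = 0 := by
  simp [globalUncompress, Matrix.mulVec, dotProduct, h]

theorem exists_of_globalUncompress_ne_zero {φ : State (Joint M N s c)} {m : Mem M N s}
    {H : Hist M (Option (Fin N)) c} {D : Db M N} (h : globalUncompress φ m H D ≠ 0) :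
    ∃ D', φ (m, H, D') ≠ 0 ∧ ∀ y ∈ H.1.map Prod.fst, D' y = D y := by
  rw [globalUncompress, Matrix.mulVec, dotProduct] at h
  obtain ⟨D', -, hD'⟩ := Finset.exists_ne_zero_of_sum_ne_zero h
  refine ⟨D', right_ne_zero_of_mul hD', fun y hy => ?_⟩
  by_contra hne
  refine left_ne_zero_of_mul hD' ?_
  rw [piKron, Matrix.of_apply, Finset.prod_eq_zero (Finset.mem_univ y)]
  rw [gate, if_pos hy, Matrix.one_apply_ne (Ne.symm hne)]

theorem sum_norm_sq_globalUncompress (φ : State (Joint M N s c)) (m : Mem M N s)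
    (H : Hist M (Option (Fin N)) c) :
    ∑ D, ‖globalUncompress φ m H D‖ ^ 2 = ∑ D, ‖φ (m, H, D)‖ ^ 2 := by
  refine sum_norm_sq_mulVec ?_ _
  rw [piKron_conjTranspose, piKron_mul, ← piKron_one]
  congr 1
  ext1 y
  exact gate_conjTranspose_mul_self H y

theorem globalUncompress_onFirst (U : State (Mem M N s) ≃ₗᵢ[ℂ] State (Mem M N s))
    (φ : State (Joint M N s c)) (m : Mem M N s) (H : Hist M (Option (Fin N)) c) (D : Db M N) :
    globalUncompress (onFirst U φ) m H D =
      U (WithLp.toLp 2 fun m' => globalUncompress φ m' H D) m := by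
  have h : (WithLp.toLp 2 fun m' => globalUncompress φ m' H D : State (Mem M N s)) =
      ∑ D', piKron (gate H) D D' • WithLp.toLp 2 fun m' => φ (m', H, D') := by
    ext m'
    simp [globalUncompress, Matrix.mulVec, dotProduct]
  rw [h]
  simp [globalUncompress, Matrix.mulVec, dotProduct, onFirst_apply]

/-- At the queried cell the two adjacent uncompressions cancel, since `gate` squares to 1; the other
cells are untouched. Thus uncompression intertwines the recording query with the true one. -/
theorem globalUncompress_recordQuantum (φ : State (Joint M N s c)) (m : Mem M N s)
    (H : Hist M (Option (Fin N)) c) (D : Db M N) :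
    globalUncompress (recordQuantum M N s c φ) m H D =
      phaseBot m.2.1 (D m.1) * globalUncompress φ m H D := by
  have h : piKron (gate H) *
      piKron (Function.update 1 m.1 (gate H m.1 * diagonal (phaseBot m.2.1) * gate H m.1)) =
      piKron (Function.update 1 m.1 (diagonal (phaseBot m.2.1))) * piKron (gate H) := by
    rw [piKron_mul, piKron_mul]
    congr 1
    ext1 y
    by_cases hy : y = m.1
    · subst hy
      simp only [Pi.mul_apply, Function.update_self]
      rw [← Matrix.mul_assoc, ← Matrix.mul_assoc, gate_mul_self, Matrix.one_mul]
    · simp [hy]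
  have h2 : (fun D => recordQuantum M N s c φ (m, H, D)) =
      piKron (Function.update 1 m.1 (gate H m.1 * diagonal (phaseBot m.2.1) * gate H m.1)) *ᵥ
        fun D => φ (m, H, D) := by
    ext D; exact recordQuantum_apply φ m H D
  rw [globalUncompress, h2, Matrix.mulVec_mulVec, h, ← Matrix.mulVec_mulVec,
    piKron_update_diagonal_mulVec]
  rfl

theorem recordClassical_record_apply {φ : State (Joint M N s c)}
    (hφ : ∀ b, φ b ≠ 0 → b.2.1.1.length < c) (m : Mem M N s)
    {H : Hist M (Option (Fin N)) c} (hH : H.1.length < c) (z : Option (Fin N)) (D : Db M N) :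
    recordClassical M N s c φ (m, H.record (m.1, z), D) =
      if D m.1 = z then phaseBot m.2.1 z * uncompress M N s c φ (m, H, D) else 0 := by
  rw [recordClassical_eq hφ, jointClassicalOracle_eq]
  have hψ := length_lt_of_uncompress_ne_zero hφ
  split_ifs with hz
  · subst hz
    exact ofKets_reindex_apply (σ := recordBasis) (T := {b : Joint M N s c | b.2.1.1.length < c})
      (c := fun b => phaseBot b.1.2.1 (b.2.2 b.1.1)) injOn_recordBasis hψ (i := (m, H, D)) hH
  · refine ofKets_reindex_eq_zero (T := {b : Joint M N s c | b.2.1.1.length < c}) hψ ?_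
    rintro ⟨m', H', D'⟩ h' heq
    simp only [recordBasis, Prod.mk.injEq] at heq
    obtain ⟨rfl, h1, rfl⟩ := heq
    have h2 := (Hist.record_inj h' hH h1).2
    exact hz (congrArg Prod.snd h2)

/-- The new history contains the queried index, so its global uncompression skips that cell; the
missing factor is supplied by the uncompression inside the query. -/
theorem globalUncompress_recordClassical {φ : State (Joint M N s c)}
    (hφ : ∀ b, φ b ≠ 0 → b.2.1.1.length < c) (m : Mem M N s)
    {H : Hist M (Option (Fin N)) c} (hH : H.1.length < c) (z : Option (Fin N)) (D : Db M N) :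
    globalUncompress (recordClassical M N s c φ) m (H.record (m.1, z)) D =
      if D m.1 = z then phaseBot m.2.1 z * globalUncompress φ m H D else 0 := by
  set d : Option (Fin N) → ℂ := fun z' => if z' = z then phaseBot m.2.1 z else 0 with hd
  have h : piKron (gate (H.record (m.1, z))) * (piKron (Function.update 1 m.1 (diagonal d)) *
      piKron (Function.update 1 m.1 (gate H m.1))) =
      piKron (Function.update 1 m.1 (diagonal d)) * piKron (gate H) := by
    rw [piKron_mul, piKron_mul, piKron_mul]
    congr 1
    ext1 y
    by_cases hy : y = m.1
    · subst hy
      have h1 : gate (H.record (m.1, z)) m.1 = 1 := by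
        rw [gate, if_pos]
        rw [Hist.record_val _ hH]
        simp
      simp [h1]
    · have h1 : gate (H.record (m.1, z)) y = gate H y := by
        rw [gate, gate, Hist.record_val _ hH]
        simp [hy]
      simp [hy, h1]
  have h2 : (fun D => recordClassical M N s c φ (m, H.record (m.1, z), D)) =
      piKron (Function.update 1 m.1 (diagonal d)) *ᵥ
        (piKron (Function.update 1 m.1 (gate H m.1)) *ᵥ fun D => φ (m, H, D)) := by
    ext D
    rw [recordClassical_record_apply hφ m hH, piKron_update_diagonal_mulVec, uncompress_apply]
    simp [hd]
  rw [globalUncompress, h2, Matrix.mulVec_mulVec, Matrix.mulVec_mulVec, Matrix.mul_assoc, h,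
    ← Matrix.mulVec_mulVec, piKron_update_diagonal_mulVec]
  simp [hd, globalUncompress]

theorem globalUncompress_recordClassical_eq_zero {φ : State (Joint M N s c)}
    (hφ : ∀ b, φ b ≠ 0 → b.2.1.1.length < c) (m : Mem M N s)
    {H' : Hist M (Option (Fin N)) c} (D : Db M N)
    (h : ∀ (H : Hist M (Option (Fin N)) c) (z : Option (Fin N)), H.1.length < c →
      H.record (m.1, z) ≠ H') :
    globalUncompress (recordClassical M N s c φ) m H' D = 0 := by
  refine globalUncompress_eq_zero (fun D => ?_) D
  by_contra h0
  obtain ⟨⟨m', H, D'⟩, h1, -, h2⟩ := exists_of_recordClassical_ne_zero hφ h0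
  simp only [recordBasis, Prod.mk.injEq] at h2
  obtain ⟨rfl, h3, -⟩ := h2
  exact h H _ h1 h3

/-- This bounds the probability that the output `x` is a zero. A zero in the history has weight 1,
which covers probability 1. Without one, a recorded `x` cannot be a zero, by consistency. An
unrecorded `x` is handled by the single-cell estimate, at weight 2. -/
theorem sum_norm_sq_globalUncompress_zero_le {φ : State (Joint M N s c)}
    (hφ : ∀ b, φ b ≠ 0 → Consistent b) (m : Mem M N s) (H : Hist M (Option (Fin N)) c)
    (x : Fin M) :
    ∑ D : Db M N, (if D x = some 0 then ‖globalUncompress φ m H D‖ ^ 2 else 0) ≤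
      ∑ D : Db M N, (weight ((m, H, D) : Joint M N s c) + 4 / N) * ‖φ (m, H, D)‖ ^ 2 := by
  by_cases hC : ∃ y, (y, some 0) ∈ H.1
  · calc _ ≤ ∑ D : Db M N, ‖globalUncompress φ m H D‖ ^ 2 := by
          refine Finset.sum_le_sum fun D _ => ?_
          split_ifs
          · exact le_rfl
          · positivity
      _ = ∑ D, ‖φ (m, H, D)‖ ^ 2 := sum_norm_sq_globalUncompress φ m H
      _ ≤ _ := by
          refine Finset.sum_le_sum fun D _ => ?_
          rw [weight_of_classicalZero (show ClassicalZero ((m, H, D) : Joint M N s c) from hC)]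
          have : 0 ≤ 4 / (N : ℝ) * ‖φ (m, H, D)‖ ^ 2 := by positivity
          linarith
  by_cases hx : x ∈ H.1.map Prod.fst
  · rw [Finset.sum_eq_zero]
    · exact Finset.sum_nonneg fun D _ =>
        mul_nonneg (add_nonneg (weight_nonneg _) (by positivity)) (by positivity)
    · intro D _
      split_ifs with hD
      · by_contra h0
        obtain ⟨D', h1, h2⟩ := exists_of_globalUncompress_ne_zero (φ := φ) (m := m) (H := H)
          (D := D) (fun h => h0 (by simp [h]))
        obtain ⟨e, he, rfl⟩ := List.mem_map.mp hx
        have h3 : D' e.1 = e.2 := hφ _ h1 e he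
        rw [h2 _ hx, hD] at h3
        exact hC ⟨e.1, by rw [h3]; exact he⟩
      · rfl
  set d : Option (Fin N) → ℂ := fun z => if z = some 0 then 1 else 0 with hd
  -- The test on cell `x` passes through the uncompression of the other cells, which is unitary and
  -- drops out of the norm.
  have h : piKron (Function.update 1 x (diagonal d)) * piKron (gate H) =
      piKron (Function.update (gate H) x 1) *
        piKron (Function.update 1 x (diagonal d * cellMat N)) := by
    rw [piKron_mul, piKron_mul]
    congr 1
    ext1 y
    by_cases hy : y = x
    · subst hy
      have h0 : gate H y = cellMat N := by rw [gate, if_neg hx]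
      simp [h0]
    · simp [hy]
  have hU : (piKron (Function.update (gate H) x 1))ᴴ * piKron (Function.update (gate H) x 1) =
      1 := by
    rw [piKron_conjTranspose, piKron_mul, ← piKron_one]
    congr 1
    ext1 y
    by_cases hy : y = x
    · subst hy; simp
    · simpa [hy] using gate_conjTranspose_mul_self H y
  have h1 : ∀ D, (if D x = some 0 then ‖globalUncompress φ m H D‖ ^ 2 else 0) =
      ‖(piKron (Function.update (gate H) x 1) *ᵥ
        (piKron (Function.update 1 x (diagonal d * cellMat N)) *ᵥ fun D => φ (m, H, D))) D‖ ^ 2 := by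
    intro D
    rw [Matrix.mulVec_mulVec, ← h, ← Matrix.mulVec_mulVec, piKron_update_diagonal_mulVec]
    simp only [hd, globalUncompress]
    split_ifs <;> simp
  simp only [h1]
  rw [sum_norm_sq_mulVec hU]
  refine sum_le_sum_of_forall_cell x _ _ fun D => ?_
  have h2 : ∀ z, (piKron (Function.update 1 x (diagonal d * cellMat N)) *ᵥ
      fun D => φ (m, H, D)) (Function.update D x z) =
        d z * (cellMat N *ᵥ fun z => φ (m, H, Function.update D x z)) z := by
    intro z
    rw [piKron_update_one_mulVec]
    simp only [Function.update_self, Function.update_idem, Matrix.mulVec, dotProduct,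
      Matrix.diagonal_mul, Finset.mul_sum, mul_assoc]
  simp only [h2]
  set v : Option (Fin N) → ℂ := fun z => φ (m, H, Function.update D x z) with hv
  rw [Finset.sum_eq_single (some 0) (fun z _ hz => by simp [hd, hz]) (by simp)]
  simp only [hd, if_true, one_mul, add_mul]
  refine (norm_sq_cellMat_mulVec_le v).trans ?_
  rw [Finset.sum_add_distrib, Finset.mul_sum]
  gcongr
  have hw1 : weight ((m, H, Function.update D x (some 0)) : Joint M N s c) = 2 :=
    weight_of_quantumZero hC (quantumZero_update_iff.mpr (Or.inl rfl))
  have h3 := Finset.single_le_sum (f := fun z =>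
    weight ((m, H, Function.update D x z) : Joint M N s c) * ‖v z‖ ^ 2)
    (fun z _ => mul_nonneg (weight_nonneg _) (by positivity)) (Finset.mem_univ (some 0))
  simpa only [hw1] using h3

end GlobalUncompress

/-! ## Compressed simulation of a hybrid algorithm -/

section Simulation
variable {M N c : ℕ}

/-- View a history of an actual run as a history of the compressed run. -/
def Hist.toOption (H : Hist M (Fin N) c) : Hist M (Option (Fin N)) c :=
  ⟨H.1.map fun e => (e.1, some e.2), by simpa using H.2⟩

theorem Hist.toOption_injective :
    Function.Injective (Hist.toOption : Hist M (Fin N) c → Hist M (Option (Fin N)) c) := by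
  intro H H' h
  have h1 := congrArg Subtype.val h
  refine Subtype.ext (List.map_injective_iff.mpr ?_ h1)
  rintro ⟨a, b⟩ ⟨a', b'⟩ h
  simpa using h

theorem Hist.length_toOption (H : Hist M (Fin N) c) : H.toOption.1.length = H.1.length := by
  simp [Hist.toOption]

theorem Hist.toOption_record (H : Hist M (Fin N) c) (e : Fin M × Fin N) (h : H.1.length < c) :
    (H.record e).toOption = H.toOption.record (e.1, some e.2) := by
  apply Subtype.ext
  rw [Hist.record_val _ (by rwa [Hist.length_toOption])]
  simp [Hist.toOption, Hist.record_val _ h]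

/-- A history that comes from an actual run has no ⊥, so its last entry is an actual query answer.
-/
theorem Hist.exists_of_toOption_eq_record {H' : Hist M (Fin N) c} {x : Fin M}
    {H : Hist M (Option (Fin N)) c} {z : Option (Fin N)} (h : H.1.length < c)
    (heq : H.record (x, z) = H'.toOption) :
    ∃ (H₀ : Hist M (Fin N) c) (y : Fin N), H₀.1.length < c ∧ H' = H₀.record (x, y) := by
  have h1 := congrArg Subtype.val heq
  rw [Hist.record_val _ h, Hist.toOption] at h1
  obtain ⟨l₁, l₂, h2, h3, h4⟩ := List.map_eq_append_iff.mp h1.symm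
  obtain ⟨⟨a, y⟩, h5, h6⟩ : ∃ e, l₂ = [e] ∧ (e.1, some e.2) = (x, z) := by
    simpa [List.map_eq_singleton_iff] using h4
  have hl : l₁.length < c := by
    rw [← h3] at h
    simpa using h
  refine ⟨⟨l₁, hl.le⟩, y, hl, Subtype.ext ?_⟩
  rw [Hist.record_val _ hl, h2, h5]
  simp_all

theorem quantumOracle_apply {s : ℕ} (F : Fin M → Fin N)
    (v : State (Mem M N s × Hist M (Fin N) c)) (m : Mem M N s) (H : Hist M (Fin N) c) :
    quantumOracle s c F v (m, H) = phase m.2.1 (F m.1) * v (m, H) :=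
  ofKets_reindex_apply (σ := id) (T := Set.univ)
    (c := fun b : Mem M N s × Hist M (Fin N) c => phase b.1.2.1 (F b.1.1))
    Function.injective_id.injOn (fun _ _ => trivial) trivial

theorem classicalOracle_eq {s : ℕ} (F : Fin M → Fin N) : classicalOracle s c F =
    ofKets fun b => phase b.1.2.1 (F b.1.1) • ket (b.1, b.2.record (b.1.1, F b.1.1)) := rfl

theorem injOn_record {s : ℕ} (F : Fin M → Fin N) :
    Set.InjOn (fun b : Mem M N s × Hist M (Fin N) c => (b.1, b.2.record (b.1.1, F b.1.1)))
      {b | b.2.1.length < c} := by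
  rintro ⟨m, H⟩ h ⟨m', H'⟩ h' heq
  simp only [Prod.mk.injEq] at heq
  obtain ⟨rfl, h1⟩ := heq
  obtain rfl := (Hist.record_inj h h' h1).1
  rfl

theorem classicalOracle_record_apply {s : ℕ} (F : Fin M → Fin N)
    {v : State (Mem M N s × Hist M (Fin N) c)} (hv : ∀ b, v b ≠ 0 → b.2.1.length < c)
    (m : Mem M N s) {H : Hist M (Fin N) c} (hH : H.1.length < c) (y : Fin N) :
    classicalOracle s c F v (m, H.record (m.1, y)) =
      if F m.1 = y then phase m.2.1 y * v (m, H) else 0 := by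
  rw [classicalOracle_eq]
  split_ifs with hy
  · subst hy
    have h := ofKets_reindex_apply
      (c := fun b : Mem M N s × Hist M (Fin N) c => phase b.1.2.1 (F b.1.1))
      (injOn_record (s := s) F) hv (i := (m, H)) hH
    exact h
  · refine ofKets_reindex_eq_zero
      (T := {b | b.2.1.length < c}) hv ?_
    rintro ⟨m', H'⟩ h' heq
    simp only [Prod.mk.injEq] at heq
    obtain ⟨rfl, h1⟩ := heq
    exact hy (congrArg Prod.snd (Hist.record_inj h' hH h1).2)

theorem classicalOracle_apply_eq_zero {s : ℕ} (F : Fin M → Fin N)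
    {v : State (Mem M N s × Hist M (Fin N) c)} (hv : ∀ b, v b ≠ 0 → b.2.1.length < c)
    (m : Mem M N s) {H' : Hist M (Fin N) c}
    (h : ∀ (H : Hist M (Fin N) c) (y : Fin N), H.1.length < c → H' ≠ H.record (m.1, y)) :
    classicalOracle s c F v (m, H') = 0 := by
  rw [classicalOracle_eq]
  refine ofKets_reindex_eq_zero
    (T := {b | b.2.1.length < c}) hv ?_
  rintro ⟨m', H⟩ h' heq
  simp only [Prod.mk.injEq] at heq
  obtain ⟨rfl, h1⟩ := heq
  exact h H _ h' h1.symm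

variable {q : ℕ}

open scoped Classical in
/-- The number of queries of the given kind among the first `t` queries. -/
def HybridAlg.count (A : HybridAlg M N c q) (k : QueryKind) (t : ℕ) : ℕ :=
  (Finset.univ.filter fun i : Fin (c + q) => i.val < t ∧ A.kind i = k).card

open scoped Classical in
theorem HybridAlg.count_succ (A : HybridAlg M N c q) (k : QueryKind) {t : ℕ} (h : t < c + q) :
    A.count k (t + 1) = A.count k t + if A.kind ⟨t, h⟩ = k then 1 else 0 := by
  have h1 : (Finset.univ.filter fun i : Fin (c + q) => i.val < t + 1 ∧ A.kind i = k) =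
      (Finset.univ.filter fun i : Fin (c + q) => i.val < t ∧ A.kind i = k) ∪
        if A.kind ⟨t, h⟩ = k then {⟨t, h⟩} else ∅ := by
    ext i
    simp only [Finset.mem_filter, Finset.mem_univ, true_and, Finset.mem_union]
    by_cases hi : i = ⟨t, h⟩
    · subst hi
      split_ifs with hk <;> simp [hk]
    · have : (i : ℕ) ≠ t := fun e => hi (Fin.ext e)
      have h2 : i ∉ (if A.kind ⟨t, h⟩ = k then {⟨t, h⟩} else ∅ : Finset (Fin (c + q))) := by
        split_ifs <;> simp [hi]
      have h3 : (i : ℕ) < t + 1 ↔ (i : ℕ) < t := by omega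
      simp [h2, h3]
  rw [count, h1, Finset.card_union_of_disjoint]
  · rw [count]
    split_ifs <;> simp
  · rw [Finset.disjoint_left]
    intro i hi
    simp only [Finset.mem_filter, Finset.mem_univ, true_and] at hi
    split_ifs
    · simp only [Finset.mem_singleton]
      rintro rfl
      exact lt_irrefl _ hi.1
    · simp

theorem HybridAlg.count_mono (A : HybridAlg M N c q) (k : QueryKind) {t t' : ℕ} (h : t ≤ t') :
    A.count k t ≤ A.count k t' := by
  refine Finset.card_le_card fun i => ?_
  simp only [Finset.mem_filter, Finset.mem_univ, true_and]
  exact fun hi => ⟨hi.1.trans_le h, hi.2⟩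

theorem HybridAlg.count_quantum_total (A : HybridAlg M N c q) :
    A.count .quantum (c + q) = q := by
  classical
  have h := A.card_quantum
  rw [Nat.card_eq_fintype_card, Fintype.card_subtype] at h
  refine Eq.trans ?_ h
  simp [count]

theorem HybridAlg.count_classical_total (A : HybridAlg M N c q) :
    A.count .classical (c + q) = c := by
  classical
  have h : A.count .classical (c + q) + A.count .quantum (c + q) = c + q := by
    rw [count, count, ← Finset.card_union_of_disjoint]
    · conv_rhs => rw [← Fintype.card_fin (c + q), ← Finset.card_univ]
      congr 1
      ext i
      rcases hk : A.kind i <;> simp [hk]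
    · rw [Finset.disjoint_left]
      intro i hi
      simp only [Finset.mem_filter, Finset.mem_univ, true_and] at hi
      simp [hi.2]
  have := A.count_quantum_total
  omega

theorem HybridAlg.count_classical_lt (A : HybridAlg M N c q) {t : ℕ} (h : t < c + q)
    (hk : A.kind ⟨t, h⟩ = .classical) : A.count .classical t < c := by
  have h1 := A.count_succ .classical h
  rw [if_pos hk] at h1
  have h2 := A.count_mono .classical (show t + 1 ≤ c + q from h)
  rw [A.count_classical_total] at h2
  omega

theorem sqrt_eight_div_le (N : ℕ) : Real.sqrt (8 / N * 1 ^ 2) ≤ 3 / Real.sqrt N := by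
  rw [one_pow, mul_one, Real.sqrt_div (by norm_num)]
  gcongr
  rw [Real.sqrt_le_left (by norm_num)]
  norm_num

variable [NeZero N]

/-- The recording query operator of the given kind. -/
def recordOracle (M N s c : ℕ) [NeZero N] :
    QueryKind → (State (Joint M N s c) →ₗ[ℂ] State (Joint M N s c))
  | .classical => recordClassical M N s c
  | .quantum => recordQuantum M N s c

variable [NeZero M]

/-- The state of the compressed simulation after `t` queries. -/
def HybridAlg.compressedState (A : HybridAlg M N c q) :
    (t : ℕ) → t ≤ c + q → State (Joint M N A.s c)
  | 0, _ => onFirst (A.U 0) (ket ((0, 0, 0), Hist.empty, fun _ => none))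
  | t + 1, h =>
      onFirst (A.U ⟨t + 1, Nat.lt_succ_of_le h⟩)
        (recordOracle M N A.s c (A.kind ⟨t, h⟩) (A.compressedState t (Nat.le_of_succ_le h)))

theorem HybridAlg.compressedState_support (A : HybridAlg M N c q) (t : ℕ) (h : t ≤ c + q)
    (b : Joint M N A.s c) (hb : A.compressedState t h b ≠ 0) :
    Consistent b ∧ b.2.1.1.length ≤ A.count .classical t := by
  classical
  induction t generalizing b with
  | zero =>
    obtain ⟨m, e⟩ := b
    obtain ⟨m', hm'⟩ := exists_ne_zero_of_onFirst_apply_ne_zero hb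
    rw [ket_apply] at hm'
    have h1 : e = (Hist.empty, fun _ => none) := by
      by_contra hne
      exact hm' (if_neg fun h => hne (Prod.ext_iff.mp h).2)
    subst h1
    exact ⟨fun e he => absurd he (List.not_mem_nil), Nat.zero_le _⟩
  | succ t ih =>
    obtain ⟨m, e⟩ := b
    obtain ⟨m', hm'⟩ := exists_ne_zero_of_onFirst_apply_ne_zero hb
    suffices H : Consistent ((m', e) : Joint M N A.s c) ∧
        ((m', e) : Joint M N A.s c).2.1.1.length ≤ A.count .classical (t + 1) from H
    rcases hk : A.kind ⟨t, h⟩ with _ | _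
    · rw [hk] at hm'
      have hlen : ∀ b, A.compressedState t (Nat.le_of_succ_le h) b ≠ 0 → b.2.1.1.length < c :=
        fun b hb => (ih _ b hb).2.trans_lt (A.count_classical_lt h hk)
      refine ⟨consistent_of_recordClassical_ne_zero (fun b hb => (ih _ b hb).1) hlen _ hm', ?_⟩
      obtain ⟨⟨m₁, H₁, D₁⟩, h1, h2, h3⟩ := exists_of_recordClassical_ne_zero hlen hm'
      obtain ⟨z, h4, -⟩ := exists_of_uncompress_ne_zero h2
      rw [← h3, A.count_succ _ h, if_pos hk]
      simp only [recordBasis, Hist.record_val _ h1, List.length_append, List.length_singleton]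
      have := (ih _ _ h4).2
      simp only at this
      omega
    · rw [hk] at hm'
      refine ⟨consistent_of_recordQuantum_ne_zero (fun b hb => (ih _ b hb).1) _ hm', ?_⟩
      obtain ⟨H, D⟩ := e
      obtain ⟨z, h4, -⟩ := exists_of_recordQuantum_ne_zero hm'
      exact (ih _ _ h4).2.trans (A.count_mono _ (Nat.le_succ t))

theorem HybridAlg.compressedState_length_lt (A : HybridAlg M N c q) {t : ℕ} (h : t < c + q)
    (hk : A.kind ⟨t, h⟩ = .classical) (b : Joint M N A.s c)
    (hb : A.compressedState t h.le b ≠ 0) : b.2.1.1.length < c :=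
  (A.compressedState_support t h.le b hb).2.trans_lt (A.count_classical_lt h hk)

theorem HybridAlg.norm_compressedState (A : HybridAlg M N c q) (t : ℕ) (h : t ≤ c + q) :
    ‖A.compressedState t h‖ = 1 := by
  induction t with
  | zero => rw [compressedState, norm_onFirst, norm_ket]
  | succ t ih =>
    rw [compressedState, norm_onFirst]
    rcases hk : A.kind ⟨t, h⟩ with _ | _
    · exact (norm_recordClassical (A.compressedState_length_lt h hk)).trans (ih _)
    · exact (norm_recordQuantum _).trans (ih _)

/-- The two runs obey the same recursion, because uncompression intertwines the oracles and commutes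
with the memory unitaries. The scalar comes from the start: each of the `M` cells ⊥ uncompresses to
amplitude 1/√N at every value. -/
theorem HybridAlg.globalUncompress_compressedState (A : HybridAlg M N c q) (F : Fin M → Fin N)
    (t : ℕ) (h : t ≤ c + q) (m : Mem M N A.s) (H : Hist M (Fin N) c) :
    globalUncompress (A.compressedState t h) m H.toOption (fun x => some (F x)) =
      ((Real.sqrt N : ℝ) : ℂ)⁻¹ ^ M * A.stateAfter F t h (m, H) := by
  classical
  induction t generalizing m H with
  | zero =>
    rw [compressedState, stateAfter, globalUncompress_onFirst, onFirst_apply]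
    have h1 : (WithLp.toLp 2 fun m' => globalUncompress
        (ket (((0, 0, 0), Hist.empty, fun _ => none) : Joint M N A.s c)) m' H.toOption
          fun x => some (F x) : State (Mem M N A.s)) =
        ((Real.sqrt N : ℝ) : ℂ)⁻¹ ^ M • WithLp.toLp 2 fun m' =>
          (ket ((0, 0, 0), Hist.empty) : State (Mem M N A.s × Hist M (Fin N) c)) (m', H) := by
      ext m'
      by_cases hm : m' = (0, 0, 0)
      · by_cases hH : H = Hist.empty
        · subst hm hH
          have h2 : (Hist.empty : Hist M (Fin N) c).toOption = Hist.empty := rfl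
          have h3 : ∀ x, gate (Hist.empty : Hist M (Option (Fin N)) c) x = cellMat N := by
            intro x; rw [gate, if_neg]; exact List.not_mem_nil
          simp only [globalUncompress, h2, Matrix.mulVec, dotProduct]
          rw [Finset.sum_eq_single fun _ => none]
          · simp [ket_apply, piKron, h3, cellMat_some_none]
          · intro D _ hD
            simp [ket_apply, hD]
          · simp
        · have h2 : H.toOption ≠ Hist.empty := fun e => hH (Hist.toOption_injective e)
          simp [globalUncompress, Matrix.mulVec, dotProduct, ket_apply, hH, h2]
      · simp [globalUncompress, Matrix.mulVec, dotProduct, ket_apply, hm]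
    rw [h1]
    simp
  | succ t ih =>
    rw [compressedState, stateAfter, globalUncompress_onFirst, onFirst_apply]
    suffices hs : ∀ m', globalUncompress (recordOracle M N A.s c (A.kind ⟨t, h⟩)
        (A.compressedState t (Nat.le_of_succ_le h))) m' H.toOption (fun x => some (F x)) =
        ((Real.sqrt N : ℝ) : ℂ)⁻¹ ^ M * oracle A.s c F (A.kind ⟨t, h⟩)
          (A.stateAfter F t (Nat.le_of_succ_le h)) (m', H) by
      have h1 : (WithLp.toLp 2 fun m' => globalUncompress (recordOracle M N A.s c (A.kind ⟨t, h⟩)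
          (A.compressedState t (Nat.le_of_succ_le h))) m' H.toOption
            (fun x => some (F x)) : State (Mem M N A.s)) =
          ((Real.sqrt N : ℝ) : ℂ)⁻¹ ^ M • WithLp.toLp 2 fun m' => oracle A.s c F (A.kind ⟨t, h⟩)
            (A.stateAfter F t (Nat.le_of_succ_le h)) (m', H) := by
        ext m'
        simp [hs]
      rw [h1]
      simp
    intro m'
    have ih' := ih (Nat.le_of_succ_le h)
    rcases hk : A.kind ⟨t, h⟩ with _ | _
    · have hlen := A.compressedState_length_lt h hk
      -- The bound on the real histories is inherited from the compressed run: the induction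
      -- hypothesis has a nonzero scalar, so the real support lies in the compressed one.
      have hlen' : ∀ b, A.stateAfter F t (Nat.le_of_succ_le h) b ≠ 0 → b.2.1.length < c := by
        rintro ⟨m₁, H₁⟩ hb
        have h1 : globalUncompress (A.compressedState t (Nat.le_of_succ_le h)) m₁ H₁.toOption
            (fun x => some (F x)) ≠ 0 := by
          rw [ih']
          refine mul_ne_zero (pow_ne_zero _ (inv_ne_zero ?_)) hb
          simp [NeZero.ne N]
        obtain ⟨D, h2, -⟩ := exists_of_globalUncompress_ne_zero h1
        have := hlen _ h2
        rwa [Hist.length_toOption] at this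
      simp only [recordOracle, oracle]
      by_cases hH : ∃ (H₀ : Hist M (Fin N) c) (y : Fin N),
          H₀.1.length < c ∧ H = H₀.record (m'.1, y)
      · obtain ⟨H₀, y, hl, rfl⟩ := hH
        rw [Hist.toOption_record _ _ hl, globalUncompress_recordClassical hlen _
          (by rwa [Hist.length_toOption]), classicalOracle_record_apply F hlen' _ hl, ih']
        by_cases hy : F m'.1 = y
        · simp only [hy, if_true, phaseBot]; ring
        · simp [hy]
      · rw [globalUncompress_recordClassical_eq_zero hlen, classicalOracle_apply_eq_zero F hlen',
          mul_zero]
        · exact fun H₀ y hl he => hH ⟨H₀, y, hl, he⟩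
        · exact fun H₁ z hl he => hH (Hist.exists_of_toOption_eq_record hl he)
    · simp only [recordOracle, oracle]
      rw [globalUncompress_recordQuantum, ih', quantumOracle_apply]
      simp only [phaseBot]
      ring

/-- Classical growth is additive in Ψ and quantum growth in √Ψ. The bound splits into a root and a
linear term so that each kind of query changes one of them, whatever their order. -/
theorem HybridAlg.potential_compressedState_le (A : HybridAlg M N c q) (t : ℕ)
    (h : t ≤ c + q) : Real.sqrt (potential (A.compressedState t h)) ≤
      Real.sqrt (4 / N * A.count .classical t) + 3 / Real.sqrt N * A.count .quantum t := by
  classical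
  have hW : ∀ (U : State (Mem M N A.s) ≃ₗᵢ[ℂ] State (Mem M N A.s)) (φ : State (Joint M N A.s c)),
      potential (onFirst U φ) = potential φ := by
    intro U φ
    rw [potential_eq_sum, potential_eq_sum]
    exact sum_mul_norm_sq_onFirst U φ fun e => weight (((0, 0, 0), e) : Joint M N A.s c)
  induction t with
  | zero =>
    rw [compressedState, hW, potential_eq_sum, Finset.sum_eq_zero]
    · simp only [Real.sqrt_zero]; positivity
    · intro b _
      by_cases hb : b = ((0, 0, 0), Hist.empty, fun _ => none)
      · subst hb
        rw [weight_eq_zero, zero_mul]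
        · rintro ⟨x, hx⟩
          exact List.not_mem_nil hx
        · rintro ⟨x, hx⟩
          simp at hx
      · simp [ket_apply, hb]
  | succ t ih =>
    have ih' := ih (Nat.le_of_succ_le h)
    rw [compressedState, hW]
    have hQ : 0 ≤ 3 / Real.sqrt N * A.count .quantum t := by positivity
    rcases hk : A.kind ⟨t, h⟩ with _ | _
    · rw [A.count_succ _ h, A.count_succ _ h, if_pos hk, if_neg (by simp [hk])]
      have h1 := potential_recordClassical_le
        (fun b hb => (A.compressedState_support t _ b hb).1) (A.compressedState_length_lt h hk)
      rw [A.norm_compressedState, one_pow, mul_one] at h1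
      simp only [recordOracle]
      set P := potential (A.compressedState t (Nat.le_of_succ_le h))
      set a : ℝ := 4 / N * A.count .classical t with ha
      set Q : ℝ := 3 / Real.sqrt N * A.count .quantum t
      have ha0 : 0 ≤ a := by positivity
      have h4 : (0 : ℝ) ≤ 4 / N := by positivity
      have h2 : P ≤ (Real.sqrt a + Q) ^ 2 := (Real.sqrt_le_left (by positivity)).mp ih'
      have h5 : 4 / (N : ℝ) * ((A.count .classical t + 1 : ℕ) : ℝ) = a + 4 / N := by
        rw [ha]; push_cast; ring
      rw [h5, add_zero, Real.sqrt_le_left (by positivity)]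
      have h6 : Real.sqrt a ≤ Real.sqrt (a + 4 / N) := Real.sqrt_le_sqrt (by linarith)
      have h7 := Real.sq_sqrt ha0
      have h8 := Real.sq_sqrt (add_nonneg ha0 h4)
      -- (√(a + 4/N) + Q)² exceeds (√a + Q)² by at least 4/N, since the cross term only grows with
      -- a.
      nlinarith [mul_le_mul_of_nonneg_right h6 hQ]
    · rw [A.count_succ _ h, A.count_succ _ h, if_pos hk, if_neg (by simp [hk])]
      have h1 := sqrt_potential_recordQuantum_le (A.compressedState t (Nat.le_of_succ_le h))
      rw [A.norm_compressedState] at h1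
      have h2 := sqrt_eight_div_le N
      simp only [recordOracle]
      push_cast
      rw [add_zero]
      linarith

theorem sum_comp_le_of_injective {ι κ : Type} [Fintype ι] [Fintype κ] {e : ι → κ}
    (he : Function.Injective e) {g : κ → ℝ} (hg : ∀ j, 0 ≤ g j) : ∑ i, g (e i) ≤ ∑ j, g j := by
  classical
  rw [← Finset.sum_image (f := g) (s := Finset.univ) (g := e) he.injOn]
  exact Finset.sum_le_sum_of_subset_of_nonneg (Finset.subset_univ _) fun j _ _ => hg j

/-- The factor N^(-M) of the average over functions is the squared scalar of the simulation. Success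
is thus a sum over total databases and ⊥-free histories; extending it to all basis states only
increases it. -/
theorem HybridAlg.successProb_le_potential (A : HybridAlg M N c q) :
    A.successProb ≤ potential (A.compressedState (c + q) le_rfl) + 4 / N := by
  classical
  have hN : (0 : ℝ) < N := Nat.cast_pos.mpr (NeZero.pos N)
  set φ := A.compressedState (c + q) le_rfl with hφ
  have h1 : ∀ F m H, ‖A.stateAfter F (c + q) le_rfl (m, H)‖ ^ 2 / (N : ℝ) ^ M =
      ‖globalUncompress φ m H.toOption fun x => some (F x)‖ ^ 2 := by
    intro F m H
    rw [A.globalUncompress_compressedState, norm_mul, mul_pow, norm_pow, norm_inv,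
      Complex.norm_real, Real.norm_eq_abs, ← pow_mul, mul_comm M 2, pow_mul, inv_pow, sq_abs,
      Real.sq_sqrt hN.le, inv_pow]
    field_simp
  let g : Joint M N A.s c → ℝ := fun b =>
    if b.2.2 (A.out b.1.2.2) = some 0 then ‖globalUncompress φ b.1 b.2.1 b.2.2‖ ^ 2 else 0
  let e : (Fin M → Fin N) × Mem M N A.s × Hist M (Fin N) c → Joint M N A.s c :=
    fun p => (p.2.1, p.2.2.toOption, fun x => some (p.1 x))
  have he : Function.Injective e := by
    rintro ⟨F, m, H⟩ ⟨F', m', H'⟩ heq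
    simp only [e, Prod.mk.injEq] at heq
    obtain ⟨rfl, h2, h3⟩ := heq
    obtain rfl := Hist.toOption_injective h2
    have : F = F' := funext fun x => Option.some_injective _ (congrFun h3 x)
    rw [this]
  have h2 : A.successProb = ∑ p, g (e p) := by
    rw [successProb, Finset.sum_div, Fintype.sum_prod_type]
    refine Finset.sum_congr rfl fun F _ => ?_
    rw [successProbFor, norm_sq_proj, Finset.sum_div]
    refine Finset.sum_congr rfl fun b _ => ?_
    obtain ⟨m, H⟩ := b
    simp only [g, e, Option.some_inj]
    rw [← h1, ite_div, zero_div]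
  rw [h2]
  refine (sum_comp_le_of_injective he fun b => ?_).trans ?_
  · simp only [g]
    split_ifs <;> positivity
  · have h3 : potential φ + 4 / N = ∑ b, (weight b + 4 / N) * ‖φ b‖ ^ 2 := by
      simp only [add_mul, Finset.sum_add_distrib, ← Finset.mul_sum]
      rw [← potential_eq_sum, ← EuclideanSpace.norm_sq_eq, hφ, A.norm_compressedState]
      ring
    rw [h3]
    refine (Fintype.sum_prod_type _).trans_le
      ((Finset.sum_le_sum fun m _ => ?_).trans_eq (Fintype.sum_prod_type _).symm)
    rw [Fintype.sum_prod_type, Fintype.sum_prod_type]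
    exact Finset.sum_le_sum fun H _ => sum_norm_sq_globalUncompress_zero_le
      (fun b hb => (A.compressedState_support _ _ b hb).1) m H (A.out m.2.2)

theorem HybridAlg.successProb_le (A : HybridAlg M N c q) (h : 1 ≤ c + q) :
    A.successProb ≤ 22 * (((c : ℝ) + (q : ℝ) ^ 2) / N) := by
  have hN : (0 : ℝ) < N := Nat.cast_pos.mpr (NeZero.pos N)
  have h1 := A.successProb_le_potential
  have h2 := A.potential_compressedState_le (c + q) le_rfl
  rw [A.count_classical_total, A.count_quantum_total] at h2
  have h3 := (Real.sqrt_le_left (by positivity)).mp h2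
  have h4 : Real.sqrt (4 / N * c) ^ 2 = 4 / N * c := Real.sq_sqrt (by positivity)
  have h5 : (3 / Real.sqrt N * (q : ℝ)) ^ 2 = 9 / N * q ^ 2 := by
    rw [mul_pow, div_pow, Real.sq_sqrt hN.le]; norm_num
  have h6 : (1 : ℝ) ≤ c + (q : ℝ) ^ 2 := by
    have : 1 ≤ c + q ^ 2 := by nlinarith
    exact_mod_cast this
  have h7 : 4 / (N : ℝ) ≤ 4 / N * (c + (q : ℝ) ^ 2) := le_mul_of_one_le_right (by positivity) h6
  -- By (u + v)² ≤ 2u² + 2v² the potential is at most (8c + 18q²)/N; with 4/N ≤ 4(c + q²)/N the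
  -- total is (12c + 22q²)/N.
  have h8 : 22 * (((c : ℝ) + (q : ℝ) ^ 2) / N) =
      2 * (4 / N * c) + 2 * (9 / N * q ^ 2) + 4 / N * (c + (q : ℝ) ^ 2) + 10 / N * c := by ring
  have h9 : 0 ≤ 10 / (N : ℝ) * c := by positivity
  rw [h8]
  nlinarith [sq_nonneg (Real.sqrt (4 / N * c) - 3 / Real.sqrt N * (q : ℝ))]

end Simulation

/-! ## The Fourier basis of the memory -/

section FourierBasis
variable {M N s : ℕ}

theorem phase_comm (p y : Fin N) : phase p y = phase y p := by
  rw [phase, phase, Nat.mul_comm]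

theorem sum_phase [NeZero N] (y : Fin N) :
    ∑ p : Fin N, phase p y = if y = 0 then (N : ℂ) else 0 := by
  split_ifs with hy
  · subst hy
    simp [phase_zero_right]
  · have hω : IsPrimitiveRoot (Complex.exp (2 * Real.pi * Complex.I / N)) N :=
      Complex.isPrimitiveRoot_exp N (NeZero.ne N)
    simp only [phase_comm _ y]
    simp only [phase, pow_mul]
    rw [Fin.sum_univ_eq_sum_range
      (fun p => (Complex.exp (2 * Real.pi * Complex.I / N) ^ y.val) ^ p) N]
    have hne : Complex.exp (2 * Real.pi * Complex.I / N) ^ y.val ≠ 1 :=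
      hω.pow_ne_one_of_pos_of_lt (fun h => hy (Fin.ext (by simpa using h))) y.isLt
    have hm := mul_neg_geom_sum (Complex.exp (2 * Real.pi * Complex.I / N) ^ y.val) N
    rw [← pow_mul _ y.val N, mul_comm y.val N, pow_mul, hω.pow_eq_one, one_pow, sub_self] at hm
    exact (mul_eq_zero.mp hm).resolve_left (sub_ne_zero.mpr hne.symm)

theorem phase_add [NeZero N] (p y z : Fin N) : phase p (y + z) = phase p y * phase p z := by
  have hω : IsPrimitiveRoot (Complex.exp (2 * Real.pi * Complex.I / N)) N :=
    Complex.isPrimitiveRoot_exp N (NeZero.ne N)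
  have h : (Complex.exp (2 * Real.pi * Complex.I / N) ^ p.val) ^ N = 1 := by
    rw [← pow_mul, Nat.mul_comm, pow_mul, hω.pow_eq_one, one_pow]
  simp only [phase, pow_mul]
  rw [← pow_add, Fin.val_add, ← pow_eq_pow_mod _ h]

theorem star_phase [NeZero N] (p y : Fin N) : star (phase p y) = phase p (-y) := by
  have h1 : phase p y * phase p (-y) = 1 := by
    rw [← phase_add, add_neg_cancel, phase_zero_right]
  have h2 : phase p y * star (phase p y) = 1 := by
    have := Complex.mul_conj' (phase p y)
    rw [norm_phase] at this
    simpa using this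
  have h3 : phase p y ≠ 0 := fun h => by simp [h] at h1
  exact mul_left_cancel₀ h3 (h2.trans h1.symm)

open scoped Classical in
/-- The basis state `(x, y, w)` with the phase register in the Fourier state of `y`. -/
def fourierVec (b : Mem M N s) : State (Mem M N s) :=
  WithLp.toLp 2 fun b' =>
    if b'.1 = b.1 ∧ b'.2.2 = b.2.2 then ((Real.sqrt N : ℝ) : ℂ)⁻¹ * phase b'.2.1 b.2.1 else 0

theorem fst_eq_of_fourierVec_ne_zero {s : ℕ} {b m : Mem M N s} (h : fourierVec b m ≠ 0) :
    m.1 = b.1 := by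
  by_contra hne
  exact h (if_neg fun h => hne h.1)

theorem orthonormal_fourierVec [NeZero N] :
    Orthonormal ℂ (fourierVec : Mem M N s → State (Mem M N s)) := by
  classical
  have hN : (N : ℂ) ≠ 0 := Nat.cast_ne_zero.mpr (NeZero.ne N)
  rw [orthonormal_iff_ite]
  rintro ⟨x, y, w⟩ ⟨x', y', w'⟩
  rw [PiLp.inner_apply, Fintype.sum_prod_type, Finset.sum_eq_single x]
  · rw [Fintype.sum_prod_type_right, Finset.sum_eq_single w]
    · by_cases h : x = x' ∧ w = w'
      · obtain ⟨rfl, rfl⟩ := h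
        have h1 : ∀ p : Fin N, inner ℂ (fourierVec (x, y, w) (x, p, w))
            (fourierVec (x, y', w) (x, p, w)) = (N : ℂ)⁻¹ * phase p (y' - y) := by
          intro p
          have h2 : star (phase p y) = phase p (-y) := star_phase p y
          simp only [fourierVec, and_self, if_true]
          rw [sub_eq_add_neg, phase_add, ← h2, ← inv_sqrt_mul_self]
          simp only [RCLike.inner_apply, map_mul, map_inv₀, Complex.conj_ofReal]
          change _ * (_ * star (phase p y)) = _
          ring
        rw [Finset.sum_congr rfl fun p _ => h1 p, ← Finset.mul_sum, sum_phase]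
        by_cases hy : y = y'
        · subst hy; simp [hN]
        · have h3 : y' - y ≠ 0 := sub_ne_zero.mpr (Ne.symm hy)
          simp [hy, h3]
      · rw [Finset.sum_eq_zero, if_neg]
        · simp only [Prod.mk.injEq]; tauto
        · intro p _
          have h4 : fourierVec (x', y', w') (x, p, w) = 0 := by
            simp only [fourierVec]; exact if_neg h
          rw [h4, inner_zero_right]
    · intro w₁ _ hw
      refine Finset.sum_eq_zero fun p _ => ?_
      have h4 : fourierVec (x, y, w) (x, p, w₁) = 0 := by
        simp only [fourierVec]; exact if_neg fun h => hw h.2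
      rw [h4, inner_zero_left]
    · simp
  · intro x₁ _ hx
    refine Finset.sum_eq_zero fun e _ => ?_
    have h4 : fourierVec (x, y, w) (x₁, e) = 0 := by
      simp only [fourierVec]; exact if_neg fun h => hx h.1
    rw [h4, inner_zero_left]
  · simp

/-- The diagonal phase that a query to `F` applies to the memory. -/
def phaseGate (s : ℕ) (F : Fin M → Fin N) : State (Mem M N s) →ₗ[ℂ] State (Mem M N s) :=
  ofKets fun m => phase m.2.1 (F m.1) • ket m

theorem phaseGate_apply (F : Fin M → Fin N) (v : State (Mem M N s)) (m : Mem M N s) :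
    phaseGate s F v m = phase m.2.1 (F m.1) * v m :=
  ofKets_reindex_apply (σ := id) (T := Set.univ)
    (c := fun b : Mem M N s => phase b.2.1 (F b.1))
    Function.injective_id.injOn (fun _ _ => trivial) trivial

theorem phaseGate_ket (F : Fin M → Fin N) (m : Mem M N s) :
    phaseGate s F (ket m) = phase m.2.1 (F m.1) • ket m := by
  rw [phaseGate, ofKets_ket]

variable [NeZero N]

/-- In the Fourier basis a phase query is the usual "add F(x) to the answer register", which lets
the search algorithms be written as permutations. -/
theorem phaseGate_fourierVec (F : Fin M → Fin N) (x : Fin M) (y : Fin N) (w : Fin s → Fin N) :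
    phaseGate s F (fourierVec (x, y, w)) = fourierVec (x, y + F x, w) := by
  classical
  ext ⟨x', p, w'⟩
  rw [phaseGate_apply]
  simp only [fourierVec]
  by_cases h : x' = x ∧ w' = w
  · obtain ⟨rfl, rfl⟩ := h
    simp only [and_self, if_true, phase_add]
    ring
  · simp only [if_neg h, mul_zero]

variable [NeZero M]

/-- The orthonormal basis of the states `fourierVec`. -/
def fourierBasis (M N s : ℕ) [NeZero M] [NeZero N] :
    OrthonormalBasis (Mem M N s) ℂ (State (Mem M N s)) :=
  (basisOfOrthonormalOfCardEqFinrank orthonormal_fourierVec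
    (by simp [finrank_euclideanSpace])).toOrthonormalBasis
    (by simpa using orthonormal_fourierVec)

theorem fourierBasis_apply (b : Mem M N s) : fourierBasis M N s b = fourierVec b := by
  simp [fourierBasis]

/-- The unitary that permutes the Fourier basis. -/
def permGate (e : Mem M N s ≃ Mem M N s) : State (Mem M N s) ≃ₗᵢ[ℂ] State (Mem M N s) :=
  (fourierBasis M N s).equiv (fourierBasis M N s) e

theorem permGate_fourierVec (e : Mem M N s ≃ Mem M N s) (b : Mem M N s) :
    permGate e (fourierVec b) = fourierVec (e b) := by
  rw [← fourierBasis_apply, ← fourierBasis_apply, permGate, OrthonormalBasis.equiv_apply_basis]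

/-- The unitary that maps the computational basis to the Fourier basis. -/
def fourierGate (M N s : ℕ) [NeZero M] [NeZero N] :
    State (Mem M N s) ≃ₗᵢ[ℂ] State (Mem M N s) :=
  (EuclideanSpace.basisFun (Mem M N s) ℂ).equiv (fourierBasis M N s) (Equiv.refl _)

theorem fourierGate_ket (b : Mem M N s) : fourierGate M N s (ket b) = fourierVec b := by
  classical
  have h : ket b = EuclideanSpace.basisFun (Mem M N s) ℂ b := by
    ext j
    simp [ket]
  rw [fourierGate, h, OrthonormalBasis.equiv_apply_basis, fourierBasis_apply]
  rfl

/-- Extend `v`, placed at index `i`, to an orthonormal basis and map the computational basis to it.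
-/
theorem exists_linearIsometryEquiv_apply_eq {ι : Type} [Fintype ι] (i : ι) {v : State ι}
    (hv : ‖v‖ = 1) : ∃ U : State ι ≃ₗᵢ[ℂ] State ι, U (ket i) = v := by
  classical
  obtain ⟨b, hb⟩ := Orthonormal.exists_orthonormalBasis_extension_of_card_eq (𝕜 := ℂ)
    (ι := ι) (E := State ι) (by simp) (v := fun _ => v) (s := {i})
    (by rw [orthonormal_iff_ite]; rintro ⟨a, ha⟩ ⟨a', ha'⟩
        simp only [Set.mem_singleton_iff] at ha ha'
        subst ha ha'
        simp [inner_self_eq_norm_sq_to_K, hv])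
  refine ⟨(EuclideanSpace.basisFun ι ℂ).equiv b (Equiv.refl _), ?_⟩
  have h : ket i = EuclideanSpace.basisFun ι ℂ i := by
    ext j
    simp [ket]
  rw [h, OrthonormalBasis.equiv_apply_basis]
  exact hb i rfl

end FourierBasis

/-! ## Product states -/

section TensorKet
variable {α β : Type} [Fintype α] [Fintype β]

/-- The state `v ⊗ |b⟩`. -/
def tensorKet (b : β) : State α →ₗ[ℂ] State (α × β) := ofKets fun a => ket (a, b)

open scoped Classical in
theorem tensorKet_apply (b : β) (v : State α) (a : α) (b' : β) :
    tensorKet b v (a, b') = if b' = b then v a else 0 := by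
  rw [tensorKet, ofKets_apply, Finset.sum_eq_single a]
  · simp [ket_apply]
  · intro a' _ h
    simp [ket_apply, h.symm]
  · simp

theorem tensorKet_ket (b : β) (a : α) : tensorKet b (ket a) = ket (a, b) := by
  rw [tensorKet, ofKets_ket]

theorem onFirst_tensorKet (U : State α ≃ₗᵢ[ℂ] State α) (b : β) (v : State α) :
    onFirst U (tensorKet b v) = tensorKet b (U v) := by
  rw [← sum_smul_ket v]
  simp only [map_sum, map_smul]
  refine Finset.sum_congr rfl fun a _ => ?_
  rw [tensorKet_ket, onFirst, ofKets_ket, tensorKet, ofKets_eq_sum]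

theorem norm_tensorKet (b : β) (v : State α) : ‖tensorKet b v‖ = ‖v‖ := by
  classical
  rw [← sq_eq_sq₀ (norm_nonneg _) (norm_nonneg _), EuclideanSpace.norm_sq_eq,
    EuclideanSpace.norm_sq_eq, Fintype.sum_prod_type]
  refine Finset.sum_congr rfl fun a _ => ?_
  rw [Finset.sum_eq_single b]
  · simp [tensorKet_apply]
  · intro b' _ h
    simp [tensorKet_apply, h]
  · simp

variable {M N s c : ℕ}

theorem quantumOracle_tensorKet (F : Fin M → Fin N) (H : Hist M (Fin N) c)
    (v : State (Mem M N s)) :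
    quantumOracle s c F (tensorKet H v) = tensorKet H (phaseGate s F v) := by
  classical
  ext ⟨m, H'⟩
  rw [quantumOracle_apply, tensorKet_apply, tensorKet_apply, phaseGate_apply, mul_ite, mul_zero]

/-- With a definite index every branch records the same pair, so the state stays a product of memory
and history. -/
theorem classicalOracle_tensorKet (F : Fin M → Fin N) (H : Hist M (Fin N) c)
    {v : State (Mem M N s)} {x : Fin M} (hv : ∀ m, v m ≠ 0 → m.1 = x) :
    classicalOracle s c F (tensorKet H v) = tensorKet (H.record (x, F x)) (phaseGate s F v) := by
  rw [← sum_smul_ket v]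
  simp only [map_sum, map_smul]
  refine Finset.sum_congr rfl fun m _ => ?_
  by_cases hm : v m = 0
  · simp [hm]
  · rw [tensorKet_ket, classicalOracle_eq, ofKets_ket, phaseGate_ket, map_smul, tensorKet_ket,
      hv m hm]

theorem exists_oracle_tensorKet (F : Fin M → Fin N) (H : Hist M (Fin N) c)
    {v : State (Mem M N s)} {x : Fin M} (hv : ∀ m, v m ≠ 0 → m.1 = x) (k : QueryKind) :
    ∃ H', oracle s c F k (tensorKet H v) = tensorKet H' (phaseGate s F v) := by
  rcases k with _ | _
  · exact ⟨_, classicalOracle_tensorKet F H hv⟩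
  · exact ⟨_, quantumOracle_tensorKet F H v⟩

variable [NeZero M] [NeZero N] {q : ℕ}

theorem HybridAlg.stateAfter_zero_eq_tensorKet (A : HybridAlg M N c q) (F : Fin M → Fin N)
    (h : 0 ≤ c + q) :
    A.stateAfter F 0 h = tensorKet Hist.empty (A.U 0 (ket (0, 0, 0))) := by
  rw [stateAfter, ← tensorKet_ket, onFirst_tensorKet]

theorem HybridAlg.exists_stateAfter_succ (A : HybridAlg M N c q) (F : Fin M → Fin N) {t : ℕ}
    (h : t + 1 ≤ c + q) {H : Hist M (Fin N) c} {v : State (Mem M N A.s)}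
    (hv : A.stateAfter F t (Nat.le_of_succ_le h) = tensorKet H v) {x : Fin M}
    (hx : ∀ m, v m ≠ 0 → m.1 = x) :
    ∃ H', A.stateAfter F (t + 1) h =
      tensorKet H' (A.U ⟨t + 1, Nat.lt_succ_of_le h⟩ (phaseGate A.s F v)) := by
  obtain ⟨H', h1⟩ := exists_oracle_tensorKet F H hx (A.kind ⟨t, h⟩)
  exact ⟨H', by rw [stateAfter, hv, h1, onFirst_tensorKet]⟩

theorem HybridAlg.stateAfter_succ_of_quantum (A : HybridAlg M N c q) (F : Fin M → Fin N) {t : ℕ}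
    (h : t + 1 ≤ c + q) {H : Hist M (Fin N) c} {v : State (Mem M N A.s)}
    (hv : A.stateAfter F t (Nat.le_of_succ_le h) = tensorKet H v)
    (hk : A.kind ⟨t, h⟩ = .quantum) :
    A.stateAfter F (t + 1) h =
      tensorKet H (A.U ⟨t + 1, Nat.lt_succ_of_le h⟩ (phaseGate A.s F v)) := by
  rw [stateAfter, hv, hk, oracle, quantumOracle_tensorKet, onFirst_tensorKet]

end TensorKet

/-! ## Random functions with a unique zero -/

section UniqueZero
variable {M N c q : ℕ}

/-- The function `F` has exactly one zero among the first `m` inputs, namely `x`. -/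
def UniqueZero (m : ℕ) (x : Fin M) [NeZero N] (F : Fin M → Fin N) : Prop :=
  F x = 0 ∧ ∀ y : Fin M, y.val < m → y ≠ x → F y ≠ 0

variable [NeZero N]

-- The values are independent: a zero at `x` has probability 1/N, and the other m − 1 tested values
-- avoid 0 with probability (1 − 1/N)^(m−1), which is at least 1/2 by Bernoulli's inequality. Inputs
-- beyond the first `m` are free.
open scoped Classical in
theorem card_uniqueZero_ge {m : ℕ} (hm : m ≤ M) (hmN : 2 * (m - 1) ≤ N) {x : Fin M}
    (hx : x.val < m) : (N : ℝ) ^ M / (2 * N) ≤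
      (Finset.univ.filter fun F : Fin M → Fin N => UniqueZero m x F).card := by
  have hN : (0 : ℝ) < N := Nat.cast_pos.mpr (NeZero.pos N)
  have hN1 : (1 : ℝ) ≤ N := by exact_mod_cast NeZero.one_le
  set t : Fin M → Finset (Fin N) := fun y =>
    if y = x then {0} else if y.val < m then {0}ᶜ else Finset.univ with ht
  have h1 : (Finset.univ.filter fun F : Fin M → Fin N => UniqueZero m x F) =
      Fintype.piFinset t := by
    ext F
    rw [Finset.mem_filter, Fintype.mem_piFinset]
    simp only [Finset.mem_univ, true_and]
    constructor
    · rintro ⟨h1, h2⟩ y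
      simp only [ht]
      split_ifs with h3 h4
      · subst h3; simpa using h1
      · simpa using h2 y h4 h3
      · simp
    · intro h
      refine ⟨by simpa [ht] using h x, fun y hy hyx => ?_⟩
      simpa [ht, hyx, hy] using h y
  have h2 : ∀ y, ((t y).card : ℝ) = N * if y = x then (N : ℝ)⁻¹ else
      if y.val < m then 1 - (N : ℝ)⁻¹ else 1 := by
    intro y
    simp only [ht]
    split_ifs
    · simp [hN.ne']
    · rw [Finset.card_compl]
      simp only [Fintype.card_fin, Finset.card_singleton]
      rw [Nat.cast_sub NeZero.one_le]
      field_simp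
      simp
    · simp
  rw [h1, Fintype.card_piFinset, Nat.cast_prod, Finset.prod_congr rfl fun y _ => h2 y,
    Finset.prod_mul_distrib, Finset.prod_const, Finset.card_univ, Fintype.card_fin,
    ← Finset.mul_prod_erase _ _ (Finset.mem_univ x), if_pos rfl]
  have h3 : ∏ y ∈ Finset.univ.erase x, (if y = x then (N : ℝ)⁻¹ else
      if y.val < m then 1 - (N : ℝ)⁻¹ else 1) = (1 - (N : ℝ)⁻¹) ^ (m - 1) := by
    rw [Finset.prod_congr rfl fun y hy => if_neg (Finset.ne_of_mem_erase hy),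
      ← Finset.prod_filter, Finset.prod_const, Finset.filter_erase, Finset.card_erase_of_mem]
    · congr 2
      rw [Fin.card_filter_val_lt, min_eq_right hm]
    · simpa using hx
  have h4 : (1 : ℝ) / 2 ≤ (1 - (N : ℝ)⁻¹) ^ (m - 1) := by
    have h5 := one_add_mul_le_pow (a := -(N : ℝ)⁻¹)
      (by have := inv_le_one_of_one_le₀ hN1; linarith) (m - 1)
    have h6 : ((m - 1 : ℕ) : ℝ) * (N : ℝ)⁻¹ ≤ 1 / 2 := by
      rw [← div_eq_mul_inv, div_le_iff₀ hN]
      have : (2 : ℝ) * ((m - 1 : ℕ) : ℝ) ≤ N := by exact_mod_cast hmN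
      linarith
    rw [← sub_eq_add_neg] at h5
    linarith
  rw [h3]
  calc (N : ℝ) ^ M / (2 * N) = N ^ M * ((N : ℝ)⁻¹ * (1 / 2)) := by field_simp
    _ ≤ _ := by gcongr

variable [NeZero M]

theorem HybridAlg.successProbFor_nonneg (A : HybridAlg M N c q) (F : Fin M → Fin N) :
    0 ≤ A.successProbFor F := by
  rw [successProbFor]; positivity

/-- The events `UniqueZero m x` for distinct x < m are disjoint, so their contributions add up. -/
theorem HybridAlg.le_successProb (A : HybridAlg M N c q) {m : ℕ} (hm : m ≤ M)
    (hmN : 2 * (m - 1) ≤ N) {p : ℝ} (hp : 0 ≤ p)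
    (h : ∀ (x : Fin M) (F : Fin M → Fin N), x.val < m → UniqueZero m x F →
      p ≤ A.successProbFor F) : p * m / (2 * N) ≤ A.successProb := by
  classical
  have hN : (0 : ℝ) < N := Nat.cast_pos.mpr (NeZero.pos N)
  set X : Finset (Fin M) := Finset.univ.filter fun x => x.val < m with hX
  have hXc : X.card = m := by
    rw [hX, Fin.card_filter_val_lt, min_eq_right hm]
  have h1 : ∀ F : Fin M → Fin N,
      ∑ x ∈ X, (if UniqueZero m x F then p else 0) ≤ A.successProbFor F := by
    intro F
    by_cases hF : ∃ x ∈ X, UniqueZero m x F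
    · obtain ⟨x, hx, hxF⟩ := hF
      rw [Finset.sum_eq_single_of_mem x hx, if_pos hxF]
      · exact h x F (by simpa [hX] using hx) hxF
      · intro y hy hyx
        refine if_neg fun hyF => hxF.2 y (by simpa [hX] using hy) hyx hyF.1
    · rw [Finset.sum_eq_zero]
      · exact A.successProbFor_nonneg F
      · exact fun x hx => if_neg fun hxF => hF ⟨x, hx, hxF⟩
  rw [successProb, le_div_iff₀ (by positivity)]
  calc p * m / (2 * N) * (N : ℝ) ^ M = ∑ x ∈ X, (N : ℝ) ^ M / (2 * N) * p := by
        rw [Finset.sum_const, hXc, nsmul_eq_mul]; ring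
    _ ≤ ∑ x ∈ X, ∑ F : Fin M → Fin N, (if UniqueZero m x F then p else 0) := by
        refine Finset.sum_le_sum fun x hx => ?_
        rw [← Finset.sum_filter, Finset.sum_const, nsmul_eq_mul]
        exact mul_le_mul_of_nonneg_right
          (card_uniqueZero_ge hm hmN (by simpa [hX] using hx)) hp
    _ = ∑ F : Fin M → Fin N, ∑ x ∈ X, (if UniqueZero m x F then p else 0) := Finset.sum_comm
    _ ≤ _ := Finset.sum_le_sum fun F _ => h1 F

end UniqueZero

/-! ## Classical search -/

section ClassicalSearch
variable {M N c q : ℕ}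

/-- The classical queries come first. -/
def classicalFirst (c q : ℕ) (i : Fin (c + q)) : QueryKind :=
  if i.val < c then .classical else .quantum

theorem card_classicalFirst (c q : ℕ) :
    Nat.card {i // classicalFirst c q i = QueryKind.quantum} = q := by
  classical
  have h : ∀ i : Fin (c + q), classicalFirst c q i = QueryKind.quantum ↔ ¬ i.val < c := by
    intro i
    rw [classicalFirst]
    split_ifs with hi <;> simp [hi]
  rw [Nat.card_eq_fintype_card, Fintype.card_subtype]
  simp only [h]
  have h1 := Finset.card_filter_add_card_filter_not (s := (Finset.univ : Finset (Fin (c + q))))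
    (fun i => i.val < c)
  rw [Fin.card_filter_val_lt, Finset.card_univ, Fintype.card_fin] at h1
  omega

variable [NeZero M] [NeZero N]

/-- Store the answer of the current query in the `i`-th workspace cell and move on to the next
index. -/
def storePerm (M N : ℕ) [NeZero M] {c : ℕ} (i : Fin c) : Mem M N c ≃ Mem M N c where
  toFun b := (b.1 + 1, b.2.2 i, Function.update b.2.2 i b.2.1)
  invFun b := (b.1 - 1, b.2.2 i, Function.update b.2.2 i b.2.1)
  left_inv := by rintro ⟨x, y, w⟩; simp
  right_inv := by rintro ⟨x, y, w⟩; simp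

/-- The unitary that classical search applies after `t` queries. -/
def searchGate (M N c : ℕ) [NeZero M] [NeZero N] (t : ℕ) :
    State (Mem M N c) ≃ₗᵢ[ℂ] State (Mem M N c) :=
  if t = 0 then fourierGate M N c else
    if h : t - 1 < c then permGate (storePerm M N ⟨t - 1, h⟩) else LinearIsometryEquiv.refl ℂ _

open scoped Classical in
/-- Query the indices `0, 1, …, c - 1` classically and return one with answer `0`, if any. -/
def classicalSearch (M N c q : ℕ) [NeZero M] [NeZero N] : HybridAlg M N c q where
  s := c
  kind := classicalFirst c q
  card_quantum := card_classicalFirst c q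
  U i := searchGate M N c i.val
  out w := if h : ∃ j, w j = 0 then Fin.ofNat M h.choose.val else 0

/-- The workspace content after the first `t` answers have been stored. -/
def answerTable (c : ℕ) (F : Fin M → Fin N) (t : ℕ) (j : Fin c) : Fin N :=
  if j.val < t then F (Fin.ofNat M j.val) else 0

/-- Workspace cell `t` is still 0, so swapping it with the answer also resets the phase register for
the next query. The index is taken modulo `M`. -/
theorem searchGate_succ_of_lt (F : Fin M → Fin N) {t : ℕ} (ht : t < c) :
    searchGate M N c (t + 1)
      (phaseGate c F (fourierVec (Fin.ofNat M t, 0, answerTable c F t))) =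
        fourierVec (Fin.ofNat M (t + 1), 0, answerTable c F (t + 1)) := by
  rw [phaseGate_fourierVec, searchGate, if_neg (Nat.succ_ne_zero t), dif_pos (by simpa using ht),
    permGate_fourierVec]
  congr 1
  simp only [storePerm, Equiv.coe_fn_mk, Prod.mk.injEq]
  refine ⟨?_, ?_, ?_⟩
  · ext
    simp [Fin.val_add, Nat.add_mod]
  · simp [answerTable]
  · ext j
    by_cases hj : j = ⟨t, ht⟩
    · subst hj
      simp [answerTable]
    · have h6 : j.val ≠ t := fun e => hj (Fin.ext e)
      have h7 : j.val < t + 1 ↔ j.val < t := by omega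
      simp [hj, answerTable, h7]

/-- The surplus queries disturb only the phase register, which is not measured. -/
theorem searchGate_succ_of_le (F : Fin M → Fin N) {t : ℕ} (ht : c ≤ t) (x : Fin M) (y : Fin N) :
    searchGate M N c (t + 1) (phaseGate c F (fourierVec (x, y, answerTable c F t))) =
        fourierVec (x, y + F x, answerTable c F (t + 1)) := by
  have h : answerTable c F (t + 1) = answerTable c F t := by
    ext j
    have h7 : j.val < t + 1 := by omega
    have h8 : j.val < t := by omega
    simp [answerTable, h7, h8]
  rw [phaseGate_fourierVec, searchGate, if_neg (Nat.succ_ne_zero t), dif_neg (by omega), h]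
  rfl

theorem classicalSearch_stateAfter (F : Fin M → Fin N) (t : ℕ) (h : t ≤ c + q) :
    ∃ (H : Hist M (Fin N) c) (x : Fin M) (y : Fin N),
      (classicalSearch M N c q).stateAfter F t h =
        tensorKet H (fourierVec (x, y, answerTable c F t)) ∧
      (t ≤ c → x = Fin.ofNat M t ∧ y = 0) := by
  induction t with
  | zero =>
    refine ⟨Hist.empty, 0, 0, ?_, fun _ => ⟨by ext; simp, rfl⟩⟩
    have h1 : answerTable c F 0 = 0 := by
      ext j; simp [answerTable]
    refine ((classicalSearch M N c q).stateAfter_zero_eq_tensorKet F h).trans ?_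
    rw [h1]
    exact congrArg _ (fourierGate_ket _)
  | succ t ih =>
    obtain ⟨H, x, y, h1, h2⟩ := ih (Nat.le_of_succ_le h)
    obtain ⟨H', h3⟩ := (classicalSearch M N c q).exists_stateAfter_succ F h h1
      fun m hm => fst_eq_of_fourierVec_ne_zero hm
    by_cases ht : t < c
    · obtain ⟨rfl, rfl⟩ := h2 ht.le
      exact ⟨H', _, _, h3.trans (congrArg _ (searchGate_succ_of_lt F ht)), fun _ => ⟨rfl, rfl⟩⟩
    · exact ⟨H', x, y + F x, h3.trans (congrArg _ (searchGate_succ_of_le F (not_lt.mp ht) x y)),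
        fun h => absurd h (by omega)⟩

theorem norm_sq_proj_eq_one {ι : Type} [Fintype ι] {P : ι → Prop} {φ : State ι}
    (hφ : ‖φ‖ = 1) (h : ∀ i, φ i ≠ 0 → P i) : ‖proj P φ‖ ^ 2 = 1 := by
  classical
  have h1 : proj P φ = φ := by
    ext i
    rw [proj_apply]
    split_ifs with hi
    · rfl
    · by_contra h0
      exact hi (h i (Ne.symm h0))
  rw [h1, hφ, one_pow]

theorem classicalSearch_successProbFor (F : Fin M → Fin N)
    (h : F ((classicalSearch M N c q).out (answerTable c F (c + q))) = 0) :
    (classicalSearch M N c q).successProbFor F = 1 := by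
  obtain ⟨H, x, y, h1, -⟩ := classicalSearch_stateAfter (c := c) (q := q) F (c + q) le_rfl
  rw [HybridAlg.successProbFor, h1]
  refine norm_sq_proj_eq_one ((norm_tensorKet _ _).trans (orthonormal_fourierVec.1 _)) ?_
  rintro ⟨m, H'⟩ hne
  have h2 : fourierVec (x, y, answerTable c F (c + q)) m ≠ 0 := by
    intro h0
    refine hne ((tensorKet_apply _ _ _ _).trans ?_)
    rw [h0, ite_self]
  have h3 : m.2.2 = answerTable c F (c + q) := by
    by_contra hw
    exact h2 (if_neg fun h => hw h.2)
  simpa only [h3] using h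

theorem classicalSearch_successProbFor_of_zero (F : Fin M → Fin N) {x : Fin M} (hx : x.val < c)
    (hF : F x = 0) : (classicalSearch M N c q).successProbFor F = 1 := by
  refine classicalSearch_successProbFor F ?_
  have h0 : ∀ j : Fin c, answerTable c F (c + q) j = F (Fin.ofNat M j.val) := by
    intro j
    rw [answerTable, if_pos (by omega)]
  have h1 : ∃ j : Fin c, answerTable c F (c + q) j = 0 := by
    refine ⟨⟨x.val, hx⟩, ?_⟩
    rw [h0, ← hF]
    congr 1
    ext
    simp
  have h2 : (classicalSearch M N c q).out (answerTable c F (c + q)) =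
      Fin.ofNat M h1.choose.val := dif_pos h1
  rw [h2, ← h0]
  exact h1.choose_spec

theorem classicalSearch_successProb_ge {m : ℕ} (hm : m ≤ M) (hmc : m ≤ c)
    (hmN : 2 * (m - 1) ≤ N) : (m : ℝ) / (2 * N) ≤ (classicalSearch M N c q).successProb := by
  have h := (classicalSearch M N c q).le_successProb hm hmN zero_le_one fun x F hx hF =>
    (classicalSearch_successProbFor_of_zero F (hx.trans_le hmc) hF.1).ge
  rwa [one_mul] at h

end ClassicalSearch

/-! ## Quantum search -/

section GroverGates
variable {M N s : ℕ}

theorem norm_sq_fourierVec_apply (x : Fin M) (y p : Fin N) (w : Fin s → Fin N) :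
    ‖fourierVec (x, y, w) (x, p, w)‖ ^ 2 = (N : ℝ)⁻¹ := by
  simp only [fourierVec, and_self, if_true, norm_mul, norm_phase, mul_one, norm_inv,
    Complex.norm_real, Real.norm_eq_abs, inv_pow, sq_abs]
  rw [Real.sq_sqrt (Nat.cast_nonneg N)]

theorem sum_norm_sq_le_norm_sq_proj_tensorKet {c : ℕ} (H : Hist M (Fin N) c)
    (v : State (Mem M N s)) {P : Mem M N s × Hist M (Fin N) c → Prop} {x : Fin M}
    {w : Fin s → Fin N} (hP : ∀ p, P ((x, p, w), H)) :
    ∑ p, ‖v (x, p, w)‖ ^ 2 ≤ ‖proj P (tensorKet H v)‖ ^ 2 := by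
  classical
  rw [norm_sq_proj]
  let e : Fin N → Mem M N s × Hist M (Fin N) c := fun p => ((x, p, w), H)
  have he : Function.Injective e := by
    intro p p' h
    simpa [e] using h
  have h3 := sum_comp_le_of_injective he
    (g := fun b => if P b then ‖tensorKet H v b‖ ^ 2 else 0)
    (fun b => by split_ifs <;> positivity)
  refine le_trans (le_of_eq (Finset.sum_congr rfl fun p _ => ?_)) h3
  simp only [e]
  rw [if_pos (hP p), tensorKet_apply, if_pos rfl]

variable [NeZero N]

/-- The state with amplitude `f x` on `fourierVec (x, 0, 0)`. -/
def superposition (s : ℕ) (f : Fin M → ℂ) : State (Mem M N s) :=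
  ∑ x, f x • fourierVec (x, 0, 0)

theorem orthonormal_fourierVec_zero :
    Orthonormal ℂ fun x : Fin M => (fourierVec (x, 0, 0) : State (Mem M N s)) :=
  orthonormal_fourierVec.comp (fun x : Fin M => ((x, 0, 0) : Mem M N s))
    fun _ _ h => (Prod.mk.inj h).1

theorem inner_superposition (f g : Fin M → ℂ) :
    inner ℂ (superposition (N := N) s f) (superposition s g) = ∑ x, star (f x) * g x :=
  orthonormal_fourierVec_zero.inner_sum f g Finset.univ

/-- Reflection through the span of the states `fourierVec (x, 0, 0)`. -/
def zeroReflection (M N s : ℕ) [NeZero N] : State (Mem M N s) ≃ₗᵢ[ℂ] State (Mem M N s) :=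
  (Submodule.span ℂ (Set.range fun x : Fin M =>
    (fourierVec (x, 0, 0) : State (Mem M N s)))).reflection

theorem zeroReflection_fourierVec (x : Fin M) (y : Fin N) :
    zeroReflection M N s (fourierVec (x, y, 0)) =
      (if y = 0 then (1 : ℂ) else -1) • fourierVec (x, y, 0) := by
  split_ifs with hy
  · subst hy
    rw [one_smul]
    exact Submodule.reflection_mem_subspace_eq_self (Submodule.subset_span ⟨x, rfl⟩)
  · rw [neg_one_smul]
    refine Submodule.reflection_mem_subspace_orthogonalComplement_eq_neg ?_
    rw [Submodule.mem_orthogonal]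
    intro u hu
    induction hu using Submodule.span_induction with
    | mem u hu =>
      obtain ⟨x', rfl⟩ := hu
      exact orthonormal_fourierVec.2 fun h => hy (Prod.mk.inj (Prod.mk.inj h).2).1.symm
    | zero => exact inner_zero_left _
    | add a b _ _ ha hb => rw [inner_add_left, ha, hb, add_zero]
    | smul r a _ ha => rw [inner_smul_left, ha, mul_zero]

/-- The indicator of the first `m` inputs. -/
def firstInputs (M m : ℕ) (x : Fin M) : ℂ := if x.val < m then 1 else 0

theorem sum_firstInputs_mul (m : ℕ) (f : Fin M → ℂ) :
    ∑ x, firstInputs M m x * f x = ∑ x with x.val < m, f x := by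
  simp only [firstInputs, ite_mul, one_mul, zero_mul]
  rw [Finset.sum_filter]

theorem norm_sq_superposition_firstInputs {m : ℕ} (hm : m ≤ M) :
    ‖(superposition s (firstInputs M m) : State (Mem M N s))‖ ^ 2 = m := by
  have h : ((‖(superposition s (firstInputs M m) : State (Mem M N s))‖ : ℂ)) ^ 2 = m := by
    refine (inner_self_eq_norm_sq_to_K (𝕜 := ℂ)
      (superposition s (firstInputs M m) : State (Mem M N s))).symm.trans ?_
    rw [inner_superposition]
    have h1 : ∀ x, star (firstInputs M m x) = firstInputs M m x := by
      intro x; rw [firstInputs]; split_ifs <;> simp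
    simp only [h1]
    rw [sum_firstInputs_mul]
    simp only [firstInputs]
    rw [Finset.sum_congr rfl fun x hx => if_pos (Finset.mem_filter.mp hx).2]
    rw [Finset.sum_const, Fin.card_filter_val_lt, min_eq_right hm]
    simp
  exact_mod_cast h

/-- Reflection through the orthogonal complement of the uniform superposition of the first `m`
inputs. -/
def diffusionGate (M N s m : ℕ) [NeZero N] : State (Mem M N s) ≃ₗᵢ[ℂ] State (Mem M N s) :=
  (Submodule.span ℂ {(superposition s (firstInputs M m) : State (Mem M N s))})ᗮ.reflection

/-- The unnormalised uniform vector has squared norm `m`, whence the coefficient 2/m. -/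
theorem diffusionGate_superposition {m : ℕ} (hm : m ≤ M) (f : Fin M → ℂ) :
    diffusionGate M N s m (superposition s f) =
      superposition s fun x => f x - 2 / m * (∑ y with y.val < m, f y) * firstInputs M m x := by
  rw [diffusionGate, Submodule.reflection_orthogonal_apply, Submodule.reflection_singleton_apply]
  have h1 : (RCLike.ofReal ‖(superposition s (firstInputs M m) : State (Mem M N s))‖ : ℂ) ^ 2 =
      m := by
    rw [← RCLike.ofReal_pow, norm_sq_superposition_firstInputs hm]
    simp
  have h2 : ∀ x, star (firstInputs M m x) = firstInputs M m x := by
    intro x; rw [firstInputs]; split_ifs <;> simp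
  rw [h1, inner_superposition]
  simp only [h2]
  rw [sum_firstInputs_mul]
  simp only [superposition, Finset.smul_sum, ← Finset.sum_sub_distrib, ← Finset.sum_neg_distrib]
  refine Finset.sum_congr rfl fun x _ => ?_
  rw [← Nat.cast_smul_eq_nsmul ℂ, smul_smul, smul_smul, ← sub_smul, ← neg_smul]
  congr 1
  push_cast
  ring

variable [NeZero M]

/-- Negate the phase register in the Fourier basis. -/
def negPerm (M N s : ℕ) [NeZero N] : Mem M N s ≃ Mem M N s where
  toFun b := (b.1, -b.2.1, b.2.2)
  invFun b := (b.1, -b.2.1, b.2.2)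
  left_inv := by rintro ⟨x, y, w⟩; simp
  right_inv := by rintro ⟨x, y, w⟩; simp

/-- Between two queries, this gate turns them into a sign flip on the nonzeros of the function. -/
def markGate (M N s : ℕ) [NeZero M] [NeZero N] : State (Mem M N s) ≃ₗᵢ[ℂ] State (Mem M N s) :=
  (zeroReflection M N s).trans (permGate (negPerm M N s))

/-- The first query writes F(x), the reflection flips the sign if this is nonzero, and after
negation the second query erases it: −F(x) + F(x) = 0. Up to sign this is the usual marking; the
diffusion has the opposite sign too, so the product is the standard Grover iteration. -/
theorem phaseGate_markGate_phaseGate (F : Fin M → Fin N) (f : Fin M → ℂ) :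
    phaseGate s F (markGate M N s (phaseGate s F (superposition s f))) =
      superposition s fun x => if F x = 0 then f x else -f x := by
  simp only [superposition, map_sum, map_smul]
  refine Finset.sum_congr rfl fun x _ => ?_
  rw [phaseGate_fourierVec, zero_add, markGate, LinearIsometryEquiv.trans_apply,
    zeroReflection_fourierVec, map_smul, permGate_fourierVec, map_smul]
  have h : negPerm M N s (x, F x, 0) = (x, -F x, 0) := rfl
  rw [h, phaseGate_fourierVec, neg_add_cancel, smul_smul]
  split_ifs <;> simp

open scoped Classical in
/-- A unitary that prepares the uniform superposition of the first `m` inputs. -/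
def prepareGate (M N s m : ℕ) [NeZero M] [NeZero N] :
    State (Mem M N s) ≃ₗᵢ[ℂ] State (Mem M N s) :=
  if h : ∃ U : State (Mem M N s) ≃ₗᵢ[ℂ] State (Mem M N s), U (ket (0, 0, 0)) =
    superposition s fun x => ((Real.sqrt m : ℝ) : ℂ)⁻¹ * firstInputs M m x
  then h.choose else LinearIsometryEquiv.refl ℂ _

theorem prepareGate_ket {m : ℕ} (hm0 : 0 < m) (hm : m ≤ M) :
    prepareGate M N s m (ket (0, 0, 0)) =
      superposition s fun x => ((Real.sqrt m : ℝ) : ℂ)⁻¹ * firstInputs M m x := by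
  have hm1 : (0 : ℝ) < m := Nat.cast_pos.mpr hm0
  have h1 : (superposition s fun x => ((Real.sqrt m : ℝ) : ℂ)⁻¹ * firstInputs M m x :
      State (Mem M N s)) = ((Real.sqrt m : ℝ) : ℂ)⁻¹ • superposition s (firstInputs M m) := by
    simp only [superposition, Finset.smul_sum, smul_smul]
  have h2 : ‖(superposition s fun x => ((Real.sqrt m : ℝ) : ℂ)⁻¹ * firstInputs M m x :
      State (Mem M N s))‖ = 1 := by
    rw [← sq_eq_sq₀ (norm_nonneg _) zero_le_one, h1, norm_smul, mul_pow,
      norm_sq_superposition_firstInputs hm, norm_inv, Complex.norm_real, Real.norm_eq_abs,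
      inv_pow, sq_abs, Real.sq_sqrt hm1.le, one_pow, inv_mul_cancel₀ hm1.ne']
  have h := exists_linearIsometryEquiv_apply_eq ((0, 0, 0) : Mem M N s) h2
  rw [prepareGate, dif_pos h]
  exact h.choose_spec

/-- Add the one-hot encoding of the index register to the workspace. -/
def copyPerm (M N : ℕ) [NeZero N] : Mem M N M ≃ Mem M N M where
  toFun b := (b.1, b.2.1, b.2.2 + Pi.single b.1 1)
  invFun b := (b.1, b.2.1, b.2.2 - Pi.single b.1 1)
  left_inv := by rintro ⟨x, y, w⟩; simp
  right_inv := by rintro ⟨x, y, w⟩; simp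

theorem permGate_copyPerm_superposition (f : Fin M → ℂ) :
    permGate (copyPerm M N) (superposition M f) =
      ∑ x, f x • fourierVec (x, 0, Pi.single x 1) := by
  simp only [superposition, map_sum, map_smul]
  refine Finset.sum_congr rfl fun x _ => ?_
  rw [permGate_fourierVec]
  have h : copyPerm M N (x, 0, 0) = (x, 0, Pi.single x 1) := by
    simp [copyPerm]
  rw [h]

end GroverGates

/-! ### Growth of the marked amplitude under Grover iterations. -/

section GroverAmplitudes
variable {M N : ℕ} [NeZero N]

/-- One Grover iteration on the amplitudes. -/
def groverStep (m : ℕ) (F : Fin M → Fin N) (f : Fin M → ℂ) (x : Fin M) : ℂ :=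
  (if F x = 0 then f x else -f x) -
    2 / m * (∑ y with y.val < m, if F y = 0 then f y else -f y) * firstInputs M m x

/-- The amplitudes after `k` Grover iterations. -/
def groverState (m : ℕ) (F : Fin M → Fin N) : ℕ → Fin M → ℂ
  | 0 => fun x => ((Real.sqrt m : ℝ) : ℂ)⁻¹ * firstInputs M m x
  | k + 1 => groverStep m F (groverState m F k)

/-- The amplitudes of the marked and of the other inputs, scaled by `√m`. -/
def groverAmp (m : ℕ) : ℕ → ℝ × ℝ
  | 0 => (1, 1)
  | k + 1 =>
    let p := groverAmp m k
    (p.1 - 2 / m * (p.1 - (m - 1) * p.2), -p.2 - 2 / m * (p.1 - (m - 1) * p.2))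

/-- An elementary substitute for the sine formula. While (2k+1)² ≤ m the unmarked amplitude stays at
least 1/2, and the marked one gains between 1 and 2 in each iteration. The upper bounds are needed
to control the loss of the unmarked amplitude. -/
theorem groverAmp_bounds (m : ℕ) (k : ℕ) (h : (2 * k + 1) ^ 2 ≤ m) :
    (k + 1 : ℝ) ≤ (groverAmp m k).1 ∧ (groverAmp m k).1 ≤ 2 * k + 1 ∧
      1 - 2 * k * (k + 1) / m ≤ (groverAmp m k).2 ∧ (groverAmp m k).2 ≤ 1 := by
  have hm0 : 0 < m := lt_of_lt_of_le (by positivity) h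
  have hm : (0 : ℝ) < m := Nat.cast_pos.mpr hm0
  induction k with
  | zero => simp [groverAmp]
  | succ k ih =>
    have hk : (2 * k + 1) ^ 2 ≤ m := le_trans (Nat.pow_le_pow_left (by omega) 2) h
    obtain ⟨h1, h2, h3, h4⟩ := ih hk
    have hR : (2 * ((k : ℝ) + 1) + 1) ^ 2 ≤ m := by exact_mod_cast h
    set a := (groverAmp m k).1
    set b := (groverAmp m k).2
    have ha : (groverAmp m (k + 1)).1 = a + 2 * b - 2 * (a + b) / m := by
      simp only [groverAmp]
      field_simp
      ring
    have hb : (groverAmp m (k + 1)).2 = b - 2 * (a + b) / m := by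
      simp only [groverAmp]
      field_simp
      ring
    have hk0 : (0 : ℝ) ≤ k := Nat.cast_nonneg k
    have h5 : 2 * (k : ℝ) * (k + 1) / m ≤ 1 / 2 := by
      rw [div_le_iff₀ hm]; nlinarith
    have h6 : 0 ≤ 2 * (a + b) / m := by
      have : 0 ≤ a + b := by linarith
      positivity
    have h7 : 2 * (a + b) / m ≤ 4 * ((k : ℝ) + 1) / m :=
      (div_le_div_iff_of_pos_right hm).mpr (by linarith)
    have h8 : 2 * (k : ℝ) * (k + 1) / m + 4 * (k + 1) / m = 2 * (k + 1) * (k + 2) / m := by ring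
    have h9 : 4 * (k : ℝ) * (k + 1) / m + 4 * (k + 1) / m ≤ 1 := by
      rw [← add_div, div_le_iff₀ hm]; nlinarith
    have h10 : 4 * (k : ℝ) * (k + 1) / m = 2 * (2 * (k : ℝ) * (k + 1) / m) := by ring
    rw [ha, hb]
    push_cast
    have h11 : 2 * ((k : ℝ) + 1) * (k + 1 + 1) / m = 2 * (k + 1) * (k + 2) / m := by ring
    rw [h11]
    refine ⟨by linarith, by linarith, by linarith, by linarith⟩

/-- By symmetry all unmarked inputs among the first `m` share one amplitude, so the iteration is a
recursion in two real numbers. -/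
theorem groverState_eq {m : ℕ} (hm : m ≤ M) {x₀ : Fin M} (hx : x₀.val < m)
    {F : Fin M → Fin N} (hF : UniqueZero m x₀ F) (k : ℕ) (x : Fin M) (hxm : x.val < m) :
    groverState m F k x = ((Real.sqrt m : ℝ) : ℂ)⁻¹ *
      if x = x₀ then ((groverAmp m k).1 : ℂ) else ((groverAmp m k).2 : ℂ) := by
  induction k generalizing x with
  | zero => simp [groverState, groverAmp, firstInputs, hxm]
  | succ k ih =>
    set r := ((Real.sqrt m : ℝ) : ℂ)⁻¹
    set a := (groverAmp m k).1
    set b := (groverAmp m k).2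
    have h1 : ∀ y : Fin M, y.val < m →
        (if F y = 0 then groverState m F k y else -groverState m F k y) =
          r * if y = x₀ then (a : ℂ) else -(b : ℂ) := by
      intro y hy
      rw [ih y hy]
      by_cases hyx : y = x₀
      · subst hyx; simp [hF.1]
      · simp [hyx, hF.2 y hy hyx]
    have h2 : (∑ y with y.val < m, if F y = 0 then groverState m F k y
        else -groverState m F k y) = r * (a - (m - 1) * b) := by
      rw [Finset.sum_congr rfl fun y hy => h1 y (Finset.mem_filter.mp hy).2, ← Finset.mul_sum]
      congr 1
      rw [← Finset.add_sum_erase _ _ (a := x₀) (by simpa using hx), if_pos rfl,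
        Finset.sum_congr rfl fun y hy => if_neg (Finset.ne_of_mem_erase hy), Finset.sum_const,
        Finset.card_erase_of_mem (by simpa using hx), Fin.card_filter_val_lt, min_eq_right hm,
        nsmul_eq_mul, Nat.cast_sub (by omega)]
      push_cast
      ring
    rw [groverState, groverStep, h2, h1 x hxm, firstInputs, if_pos hxm]
    simp only [groverAmp]
    split_ifs
    · push_cast; ring
    · push_cast; ring

end GroverAmplitudes

/-! ### Grover search as a hybrid algorithm, and its success probability. -/

section GroverSearch
variable {M N c q : ℕ} [NeZero M] [NeZero N]

/-- The unitary applied after `t` queries, before the final copy: nothing for `t < n`, then the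
preparation, then alternately the two gates of a Grover iteration. -/
def iterationGate (M N s m n t : ℕ) [NeZero M] [NeZero N] :
    State (Mem M N s) ≃ₗᵢ[ℂ] State (Mem M N s) :=
  if t < n then LinearIsometryEquiv.refl ℂ _ else if t = n then prepareGate M N s m else
    if (t - n) % 2 = 1 then markGate M N s else diffusionGate M N s m

/-- The unitary that Grover search applies after `t` queries, out of `l` queries in total. -/
def groverGate (M N m n l t : ℕ) [NeZero M] [NeZero N] :
    State (Mem M N M) ≃ₗᵢ[ℂ] State (Mem M N M) :=
  if t = l then (iterationGate M N M m n t).trans (permGate (copyPerm M N))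
  else iterationGate M N M m n t

open scoped Classical in
/-- Grover search among the first `m` inputs with `k` iterations, which uses the last `2 * k`
queries. -/
def groverSearch (M N c q m k : ℕ) [NeZero M] [NeZero N] : HybridAlg M N c q where
  s := M
  kind := classicalFirst c q
  card_quantum := card_classicalFirst c q
  U i := groverGate M N m (c + q - 2 * k) (c + q) i.val
  out w := if h : ∃ x : Fin M, w = Pi.single x 1 then h.choose else 0

variable {m k : ℕ}

theorem groverSearch_out (hN : 2 ≤ N) (x : Fin M) :
    (groverSearch M N c q m k).out (Pi.single x (1 : Fin N) : Fin M → Fin N) = x := by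
  have h : ∃ x' : Fin M, (Pi.single x (1 : Fin N) : Fin M → Fin N) = Pi.single x' 1 := ⟨x, rfl⟩
  have h1 : (groverSearch M N c q m k).out (Pi.single x (1 : Fin N) : Fin M → Fin N) =
      h.choose := dif_pos h
  rw [h1]
  -- Two one-hot words at different positions are told apart by 1 ≠ 0, which needs N ≥ 2.
  have h2 := congrFun h.choose_spec h.choose
  by_contra hne
  rw [Pi.single_eq_same, Pi.single_eq_of_ne hne] at h2
  have h3 := congrArg Fin.val h2
  rw [Fin.val_one', Fin.val_zero, Nat.mod_eq_of_lt (by omega)] at h3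
  exact zero_ne_one h3

theorem ket_support {ι : Type} [Fintype ι] {i j : ι} (h : (ket i : State ι) j ≠ 0) : j = i := by
  classical
  by_contra hne
  exact h (by rw [ket_apply, if_neg hne])

/-- With phase register 0 a query is invisible to the memory; all queries before the preparation are
spent this way. -/
theorem phaseGate_ket_zero {s : ℕ} (F : Fin M → Fin N) :
    phaseGate s F (ket (0, 0, 0)) = ket (0, 0, 0) := by
  rw [phaseGate_ket, phase_zero_left, one_smul]

theorem groverSearch_stateAfter_of_lt (F : Fin M → Fin N) (t : ℕ) (h : t ≤ c + q)
    (ht : t < c + q - 2 * k) : ∃ H : Hist M (Fin N) c,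
      (groverSearch M N c q m k).stateAfter F t h =
        tensorKet H (ket (0, 0, 0) : State (Mem M N M)) := by
  have hU : ∀ t < c + q - 2 * k, ∀ v, groverGate M N m (c + q - 2 * k) (c + q) t v = v := by
    intro t ht v
    rw [groverGate, if_neg (by omega), iterationGate, if_pos ht]
    rfl
  induction t with
  | zero =>
    exact ⟨_, ((groverSearch M N c q m k).stateAfter_zero_eq_tensorKet F h).trans
      (congrArg _ (hU 0 ht _))⟩
  | succ t ih =>
    obtain ⟨H, h1⟩ := ih (Nat.le_of_succ_le h) (by omega)
    obtain ⟨H', h2⟩ := (groverSearch M N c q m k).exists_stateAfter_succ F h h1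
      fun m hm => congrArg Prod.fst (ket_support hm)
    refine ⟨H', h2.trans (congrArg _ ?_)⟩
    exact (hU (t + 1) ht _).trans (phaseGate_ket_zero F)

/-- The gate that is still missing after `j` out of `k` iterations. -/
def finalGate (M N k j : ℕ) [NeZero M] [NeZero N] :
    State (Mem M N M) ≃ₗᵢ[ℂ] State (Mem M N M) :=
  if j = k then permGate (copyPerm M N) else LinearIsometryEquiv.refl ℂ _

theorem groverGate_eq_trans {n t j : ℕ} (hj : t = n + 2 * j) :
    groverGate M N m n (n + 2 * k) t =
      (iterationGate M N M m n t).trans (finalGate M N k j) := by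
  subst hj
  rw [groverGate, finalGate]
  by_cases h : j = k
  · subst h
    simp
  · rw [if_neg h, if_neg (by omega)]
    rfl

theorem groverSearch_stateAfter (hm0 : 0 < m) (hm : m ≤ M) (hk : 2 * k ≤ q)
    (F : Fin M → Fin N) (j : ℕ) (hj : j ≤ k) (t : ℕ) (h : t ≤ c + q)
    (ht : t = (c + q - 2 * k) + 2 * j) : ∃ H : Hist M (Fin N) c,
      (groverSearch M N c q m k).stateAfter F t h =
        tensorKet H (finalGate M N k j (superposition M (groverState m F j))) := by
  set n := c + q - 2 * k with hn
  have hl : n + 2 * k = c + q := by omega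
  have hG : ∀ {t j : ℕ}, t = n + 2 * j → groverGate M N m n (c + q) t =
      (iterationGate M N M m n t).trans (finalGate M N k j) := by
    intro t j hj
    rw [← hl]
    exact groverGate_eq_trans hj
  induction j generalizing t with
  | zero =>
    have hU : groverGate M N m n (c + q) t (ket (0, 0, 0)) =
        finalGate M N k 0 (superposition M (groverState m F 0)) := by
      rw [hG ht, LinearIsometryEquiv.trans_apply, iterationGate, if_neg (by omega),
        if_pos (by omega), prepareGate_ket hm0 hm]
      rfl
    cases t with
    | zero =>
      exact ⟨_, ((groverSearch M N c q m k).stateAfter_zero_eq_tensorKet F h).trans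
        (congrArg _ hU)⟩
    | succ t =>
      obtain ⟨H, h1⟩ := groverSearch_stateAfter_of_lt (m := m) (k := k) F t
        (Nat.le_of_succ_le h) (by omega)
      obtain ⟨H', h2⟩ := (groverSearch M N c q m k).exists_stateAfter_succ F h h1
        fun m hm => congrArg Prod.fst (ket_support hm)
      refine ⟨H', h2.trans (congrArg _ ?_)⟩
      exact (congrArg _ (phaseGate_ket_zero F)).trans hU
  | succ j ih =>
    obtain ⟨t, rfl⟩ : ∃ t', t = t' + 2 := ⟨t - 2, by omega⟩
    obtain ⟨H, h1⟩ := ih (by omega) t (by omega) (by omega)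
    -- The last 2k queries are quantum because 2k ≤ q and the classical ones come first; classical
    -- queries would entangle the superposed index with the history.
    have hkind : ∀ (i : ℕ) (hi : i < c + q), n ≤ i →
        (groverSearch M N c q m k).kind ⟨i, hi⟩ = .quantum := by
      intro i hi hni
      exact if_neg (by simp only; omega)
    have h2 := (groverSearch M N c q m k).stateAfter_succ_of_quantum F (t := t) (by omega) h1
      (hkind t (by omega) (by omega))
    have h3 := (groverSearch M N c q m k).stateAfter_succ_of_quantum F (t := t + 1) h h2
      (hkind (t + 1) (by omega) (by omega))
    refine ⟨H, h3.trans (congrArg _ ?_)⟩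
    have h4 : finalGate M N k j = LinearIsometryEquiv.refl ℂ _ := by
      rw [finalGate, if_neg (by omega)]
    have h5 : groverGate M N m n (c + q) (t + 1) = markGate M N M := by
      rw [groverGate, if_neg (by omega), iterationGate, if_neg (by omega), if_neg (by omega),
        if_pos (by omega)]
    have h6 : iterationGate M N M m n (t + 2) = diffusionGate M N M m := by
      rw [iterationGate, if_neg (by omega), if_neg (by omega), if_neg (by omega)]
    change groverGate M N m n (c + q) (t + 2) (phaseGate M F
      (groverGate M N m n (c + q) (t + 1) (phaseGate M F
        (finalGate M N k j (superposition M (groverState m F j)))))) = _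
    rw [hG ht, h4, h5, LinearIsometryEquiv.trans_apply, h6]
    refine congrArg _ ?_
    refine (congrArg _ (phaseGate_markGate_phaseGate F (groverState m F j))).trans ?_
    rw [diffusionGate_superposition hm]
    rfl

/-- The one-hot copy makes the measured workspace reveal the index. The phase register is in a
Fourier state, so the probability of `x` is spread evenly over its `N` values and is recovered by
summing over them. -/
theorem groverSearch_successProbFor (hN : 2 ≤ N) (hm0 : 0 < m) (hm : m ≤ M) (hk : 2 * k ≤ q)
    {x : Fin M} {F : Fin M → Fin N} (hF : F x = 0) :
    ‖groverState m F k x‖ ^ 2 ≤ (groverSearch M N c q m k).successProbFor F := by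
  have hN0 : (N : ℝ) ≠ 0 := Nat.cast_ne_zero.mpr (NeZero.ne N)
  obtain ⟨H, h1⟩ := groverSearch_stateAfter (c := c) hm0 hm hk F k le_rfl (c + q) le_rfl
    (by omega)
  have h2 : finalGate M N k k (superposition M (groverState m F k)) =
      ∑ x, groverState m F k x • fourierVec (x, 0, Pi.single x 1) := by
    rw [finalGate, if_pos rfl, permGate_copyPerm_superposition]
  rw [h2] at h1
  rw [HybridAlg.successProbFor, h1]
  refine le_trans (le_of_eq ?_) (sum_norm_sq_le_norm_sq_proj_tensorKet (s := M) H
    (∑ x, groverState m F k x • fourierVec (x, 0, Pi.single x 1)) (x := x) (w := Pi.single x 1)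
    fun p => ?_)
  · have h4 : ∀ p : Fin N, (∑ x', groverState m F k x' •
        (fourierVec (x', 0, Pi.single x' 1) : State (Mem M N M))) (x, p, Pi.single x 1) =
          groverState m F k x * fourierVec (x, 0, Pi.single x 1) (x, p, Pi.single x 1) := by
      intro p
      rw [WithLp.ofLp_sum, Finset.sum_apply, Finset.sum_eq_single x]
      · rfl
      · intro x' _ hx'
        have : (fourierVec (x', 0, Pi.single x' 1) : State (Mem M N M)) (x, p, Pi.single x 1) =
          0 := if_neg fun h => hx' h.1.symm
        simp [this]
      · simp
    simp only [h4, norm_mul, mul_pow, norm_sq_fourierVec_apply]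
    rw [Finset.sum_const, Finset.card_univ, Fintype.card_fin, nsmul_eq_mul]
    field_simp
  · have h6 : (groverSearch M N c q m k).out (Pi.single x (1 : Fin N) : Fin M → Fin N) = x :=
      groverSearch_out hN x
    exact (congrArg F h6).trans hF

/-- The marked amplitude is at least (k+1)/√m, hence at least (2k+1)/(2√m); the `m` possible
positions, each of weight 1/(2N), cancel the `m`. -/
theorem groverSearch_successProb_ge (hN : 2 ≤ N) (hm : m ≤ M) (hmN : 2 * (m - 1) ≤ N)
    (hk : 2 * k ≤ q) (hkm : (2 * k + 1) ^ 2 ≤ m) :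
    (2 * k + 1 : ℝ) ^ 2 / (8 * N) ≤ (groverSearch M N c q m k).successProb := by
  have hm0 : 0 < m := lt_of_lt_of_le (by positivity) hkm
  have hmR : (0 : ℝ) < m := Nat.cast_pos.mpr hm0
  have hNR : (0 : ℝ) < N := Nat.cast_pos.mpr (NeZero.pos N)
  have h := (groverSearch M N c q m k).le_successProb hm hmN
    (p := (2 * k + 1 : ℝ) ^ 2 / (4 * m)) (by positivity) fun x F hx hF => by
      refine le_trans ?_ (groverSearch_successProbFor hN hm0 hm hk hF.1)
      rw [groverState_eq hm hx hF k x hx, if_pos rfl, norm_mul, mul_pow, norm_inv,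
        Complex.norm_real, Complex.norm_real, Real.norm_eq_abs, Real.norm_eq_abs, inv_pow, sq_abs,
        sq_abs, Real.sq_sqrt hmR.le]
      have h1 := (groverAmp_bounds m k hkm).1
      have h2 : (2 * k + 1 : ℝ) ^ 2 / 4 ≤ (groverAmp m k).1 ^ 2 := by
        have hk0 : (0 : ℝ) ≤ k := Nat.cast_nonneg k
        nlinarith
      calc (2 * k + 1 : ℝ) ^ 2 / (4 * m) = (m : ℝ)⁻¹ * ((2 * k + 1 : ℝ) ^ 2 / 4) := by
            field_simp
        _ ≤ _ := by gcongr
  refine le_trans (le_of_eq ?_) h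
  field_simp
  norm_num

end GroverSearch

/-! ## The optimal success probability -/

section Optimal
variable {M N : ℕ} [NeZero M] [NeZero N]

/-- Take the most iterations that the queries and the condition 2k + 1 ≤ ⌊√m⌋ allow. Rounding loses
at most a factor 3 in 2k + 1, hence 9 after squaring. -/
theorem exists_iterations (q : ℕ) {m : ℕ} (hm : 0 < m) :
    ∃ k, 2 * k ≤ q ∧ (2 * k + 1) ^ 2 ≤ m ∧ min (q ^ 2) m ≤ 9 * (2 * k + 1) ^ 2 := by
  set r := Nat.sqrt m with hr
  have hr0 : 0 < r := Nat.sqrt_pos.mpr hm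
  have h1 : r ^ 2 ≤ m := Nat.sqrt_le' m
  have h2 : m < (r + 1) ^ 2 := Nat.lt_succ_sqrt' m
  refine ⟨min (q / 2) ((r - 1) / 2), by omega, ?_, ?_⟩
  · exact le_trans (Nat.pow_le_pow_left (by omega) 2) h1
  · rcases le_total (q / 2) ((r - 1) / 2) with h | h
    · rw [min_eq_left h]
      have h3 : q ≤ 2 * (q / 2) + 1 := by omega
      calc min (q ^ 2) m ≤ q ^ 2 := min_le_left _ _
        _ ≤ (2 * (q / 2) + 1) ^ 2 := Nat.pow_le_pow_left h3 2
        _ ≤ _ := Nat.le_mul_of_pos_left _ (by norm_num)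
    · rw [min_eq_right h]
      have h3 : r + 1 ≤ 3 * (2 * ((r - 1) / 2) + 1) := by omega
      calc min (q ^ 2) m ≤ m := min_le_right _ _
        _ ≤ (r + 1) ^ 2 := h2.le
        _ ≤ (3 * (2 * ((r - 1) / 2) + 1)) ^ 2 := Nat.pow_le_pow_left h3 2
        _ = _ := by ring

theorem exists_successProb_ge (c q : ℕ) :
    ∃ A : HybridAlg M N c q,
      1 / 288 * (min ((c : ℝ) + (q : ℝ) ^ 2) (min (M : ℝ) (N : ℝ)) / N) ≤ A.successProb := by
  have hM0 : 0 < M := NeZero.pos M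
  have hN0 : 0 < N := NeZero.pos N
  have hNR : (0 : ℝ) < N := Nat.cast_pos.mpr hN0
  -- For N = 1 every output succeeds; this case is separate because one-hot words need N ≥ 2.
  rcases Nat.lt_or_ge N 2 with hN | hN
  · obtain rfl : N = 1 := by omega
    refine ⟨classicalSearch M 1 c q, ?_⟩
    have h1 : (classicalSearch M 1 c q).successProb = 1 := by
      rw [HybridAlg.successProb, Finset.sum_congr rfl fun F _ =>
        classicalSearch_successProbFor F (Subsingleton.elim _ _)]
      simp
    rw [h1]
    have h2 : min ((c : ℝ) + (q : ℝ) ^ 2) (min (M : ℝ) ((1 : ℕ) : ℝ)) ≤ 1 :=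
      (min_le_right _ _).trans ((min_le_right _ _).trans (by simp))
    simp only [Nat.cast_one, div_one] at h2 ⊢
    linarith
  -- Half of `N`, rounded up, is the most that 2(m − 1) ≤ N is certain to allow for either parity,
  -- and it keeps min(M, N) ≤ 2m.
  set m := min M ((N + 1) / 2) with hm
  have hmM : m ≤ M := min_le_left _ _
  have hmN : 2 * (m - 1) ≤ N := by omega
  have hm0 : 0 < m := by omega
  rcases Nat.lt_or_ge c (q ^ 2) with hc | hc
  · obtain ⟨k, hk, hkm, hk9⟩ := exists_iterations q hm0
    refine ⟨groverSearch M N c q m k, le_trans ?_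
      (groverSearch_successProb_ge hN hmM hmN hk hkm)⟩
    -- Here c + q² < 2q² and min(M, N) ≤ 2m. The constant is 288 = 4 · 9 · 8, the 8 coming from the
    -- Grover bound.
    have h1 : min (c + q ^ 2) (min M N) ≤ 4 * (9 * (2 * k + 1) ^ 2) := by omega
    have h2 : min ((c : ℝ) + (q : ℝ) ^ 2) (min (M : ℝ) (N : ℝ)) ≤
        4 * (9 * (2 * (k : ℝ) + 1) ^ 2) := by exact_mod_cast h1
    calc 1 / 288 * (min ((c : ℝ) + (q : ℝ) ^ 2) (min (M : ℝ) (N : ℝ)) / N) ≤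
          1 / 288 * (4 * (9 * (2 * (k : ℝ) + 1) ^ 2) / N) := by gcongr
      _ = _ := by ring
  · refine ⟨classicalSearch M N c q, le_trans ?_ (classicalSearch_successProb_ge (m := min m c)
      ((min_le_left _ _).trans hmM) (min_le_right _ _) (by omega))⟩
    have h1 : min (c + q ^ 2) (min M N) ≤ 2 * min m c := by omega
    have h2 : min ((c : ℝ) + (q : ℝ) ^ 2) (min (M : ℝ) (N : ℝ)) ≤
        2 * ((min m c : ℕ) : ℝ) := by exact_mod_cast h1
    calc 1 / 288 * (min ((c : ℝ) + (q : ℝ) ^ 2) (min (M : ℝ) (N : ℝ)) / N) ≤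
          1 / 288 * (2 * ((min m c : ℕ) : ℝ) / N) := by gcongr
      _ = 1 / 144 * (((min m c : ℕ) : ℝ) / N) := by ring
      _ ≤ 1 / 2 * (((min m c : ℕ) : ℝ) / N) := by gcongr; norm_num
      _ = _ := by ring

end Optimal

end HybridOracle

end

theorem mainTheorem2 :
    (∃ k K : ℝ, 0 < k ∧ 0 < K ∧
      ∀ (M N c q : ℕ) [NeZero M] [NeZero N], 1 ≤ c + q →
        (∀ A : HybridOracle.HybridAlg M N c q,
          A.successProb ≤ K * (((c : ℝ) + (q : ℝ) ^ 2) / N)) ∧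
        (∃ A : HybridOracle.HybridAlg M N c q,
          k * (min ((c : ℝ) + (q : ℝ) ^ 2) (min (M : ℝ) (N : ℝ)) / N) ≤ A.successProb)) ∧
    (∃ K : ℝ, 0 < K ∧
      ∀ (M N s c : ℕ) [NeZero N] (φ : HybridOracle.State (HybridOracle.Joint M N s c)),
        ‖φ‖ = 1 →
        (∀ b, φ b ≠ 0 → HybridOracle.Consistent b) →
          ((∀ b, φ b ≠ 0 → b.2.1.1.length < c) →
            HybridOracle.potential (HybridOracle.recordClassical M N s c φ) ≤
              HybridOracle.potential φ + K / N) ∧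
          Real.sqrt (HybridOracle.potential (HybridOracle.recordQuantum M N s c φ)) ≤
            Real.sqrt (HybridOracle.potential φ) + K / Real.sqrt N) := by
  -- In the second part 4 serves both inequalities: it is exact for the classical query and exceeds
  -- √8 for the quantum one.
  refine ⟨⟨1 / 288, 22, by norm_num, by norm_num, fun M N c q _ _ h =>
    ⟨fun A => A.successProb_le h, HybridOracle.exists_successProb_ge c q⟩⟩,
    4, by norm_num, fun M N s c _ φ hφ hcons => ⟨fun hlen => ?_, ?_⟩⟩
  · have h := HybridOracle.potential_recordClassical_le hcons hlen
    rwa [hφ, one_pow, mul_one] at h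
  · have h := HybridOracle.sqrt_potential_recordQuantum_le φ
    rw [hφ] at h
    have h1 := HybridOracle.sqrt_eight_div_le N
    have h2 : 3 / Real.sqrt N ≤ 4 / Real.sqrt N := by gcongr; norm_num
    linarith
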